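/- Let $m,n\ge 0$ be integers. All algebras are over $\mathbb C$. Let $E_{ij}$ ($1\le i,j\le m+n$) be the standard basis of the Lie superalgebra $\mathfrak{gl}_{m|n}$, where $\bar\imath=0$ for $i\le m$, $\bar\imath=1$ for $i>m$, and $[E_{ij},E_{kl}]=\delta_{kj}E_{il}-\delta_{il}E_{kj}(-1)^{(\bar\imath+\bar\jmath)(\bar k+\bar l)}$ (supercommutator). Let $\mathfrak h$ be the span of $E_{11},\dots,E_{mm}$, let $R(\mathfrak h)$ be the field of fractions of $U(\mathfrak h)$, and put $h_i=E_{ii}-i+1$ for $1\le i\le m$. Let $U'=U(\mathfrak{gl}_{m|n})\otimes_{U(\mathfrak h)}R(\mathfrak h)$ be the localization of $U(\mathfrak{gl}_{m|n})$ at the nonzero elements of $U(\mathfrak h)$, let $J$ be the left ideal of $U'$ generated by the $E_{ij}$ with $1\le i<j\le m$, let $\operatorname{Norm}J=\{x\in U'\mid Jx\subseteq J\}$, and let $$Z(\mathfrak{gl}_{m|n},\mathfrak{gl}_m)=\operatorname{Norm}J/J\subseteq U'/J$$ be the Mickelsson–Zhelobenko superalgebra. Let $p=\prod_{i<j}p_{ij}$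 be the extremal projector of $\mathfrak{gl}_m$, acting on $U'/J$, where the product is taken over the pairs $1\le i<j\le m$ in the (normal) lexicographic order and $$p_{ij}=\sum_{k\ge 0}(E_{ji})^k(E_{ij})^k\frac{(-1)^k}{k!\,(h_i-h_j+1)\cdots(h_i-h_j+k)}.$$ The Yangian $Y(\mathfrak{gl}_n)$ is the unital associative algebra with generators $t_{ij}^{(r)}$ ($1\le i,j\le n$, $r\ge 1$) and relations $$[t_{ij}^{(r+1)},t_{kl}^{(s)}]-[t_{ij}^{(r)},t_{kl}^{(s+1)}]=t_{kj}^{(r)}t_{il}^{(s)}-t_{kj}^{(s)}t_{il}^{(r)}\qquad(r,s\ge 0),$$ where $t_{ij}^{(0)}=\delta_{ij}$; put $t_{ij}(u)=\sum_{r\ge 0}t_{ij}^{(r)}u^{-r}$. **Proposition.** For $1\le i\le m$ and $m+1\le a\le m+n$ the elements $$z_{ia}=pE_{ia}(h_i-h_1)\cdots(h_i-h_{i-1}),\qquad z_{ai}=pE_{ai}(h_i-h_{i+1})\cdots(h_i-h_m)$$ of $U'/J$ belong to $Z(\mathfrak{gl}_{m|n},\mathfrak{gl}_m)$. For $m+1\le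 a,b\le m+n$ set $$Z_{ab}(u)=\bigl(\delta_{ab}(u+m)+E_{ab}\bigr)\prod_{i=1}^m(u-h_i)+\sum_{i=1}^m z_{ai}z_{ib}\prod_{j\ne i}\frac{u-h_j}{h_i-h_j},$$ a polynomial in $u$ with coefficients in $Z(\mathfrak{gl}_{m|n},\mathfrak{gl}_m)$. Then $$t_{ij}(u)\mapsto Z_{m+i,m+j}(u)\,\frac{1}{(u+m)(u-h_1)\cdots(u-h_m)}$$ (expanded in powers of $u^{-1}$) defines an algebra homomorphism $\varphi:Y(\mathfrak{gl}_n)\to Z(\mathfrak{gl}_{m|n},\mathfrak{gl}_m)$. Moreover, $\varphi=\pi\circ\psi\circ\sigma$, where $\sigma$ is the automorphism of $Y(\mathfrak{gl}_n)$ given by $t_{ij}(u)\mapsto t_{ij}(u+m)$, $\psi:Y(\mathfrak{gl}_n)\to U(\mathfrak{gl}_{m|n})^{\mathfrak{gl}_m}$ is the algebra homomorphism (the super Olshanski homomorphism) with values in the centralizer of $\mathfrak{gl}_m$ in $U(\mathfrak{gl}_{m|n})$ given by $$t_{ij}^{(1)}\mapsto E_{m+i,m+j},\qquad t_{ij}^{(r)}\mapsto\sum_{k,l=1}^m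 E_{m+i,k}\,(E^{r-2})_{kl}\,E_{l,m+j}\quad(r\ge 2),$$ with $E=(E_{kl})_{k,l=1}^m$, and $\pi:U(\mathfrak{gl}_{m|n})^{\mathfrak{gl}_m}\to Z(\mathfrak{gl}_{m|n},\mathfrak{gl}_m)$ is the natural projection. -/

import Mathlib

noncomputable section

namespace MickelssonZhelobenko

/-! ### The universal enveloping algebra of the Lie superalgebra `gl(m|n)` -/

/-- Indices of the standard basis of `ℂ^{m|n}`: `inl i` is the even index `i`,
`inr a` is the odd index `m + a`. -/
abbrev Idx (m n : ℕ) : Type := Fin m ⊕ Fin n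

/-- The parity of an index. -/
def par {m n : ℕ} : Idx m n → ℕ
  | Sum.inl _ => 0
  | Sum.inr _ => 1

/-- The sign `(-1)^{deg E_{ij} deg E_{kl}}`. -/
def superSign {m n : ℕ} (i j k l : Idx m n) : ℂ :=
  (-1) ^ ((par i + par j) * (par k + par l))

/-- The defining relations of `U(gl(m|n))`: the supercommutator `[E_{ij}, E_{kl}]` equals
`δ_{kj} E_{il} - (-1)^{deg E_{ij} deg E_{kl}} δ_{il} E_{kj}`. -/
inductive SuperRel (m n : ℕ) :
    FreeAlgebra ℂ (Idx m n × Idx m n) → FreeAlgebra ℂ (Idx m n × Idx m n) → Prop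
  | comm (i j k l : Idx m n) :
      SuperRel m n
        (FreeAlgebra.ι ℂ (i, j) * FreeAlgebra.ι ℂ (k, l)
          - superSign i j k l • (FreeAlgebra.ι ℂ (k, l) * FreeAlgebra.ι ℂ (i, j)))
        ((if k = j then FreeAlgebra.ι ℂ (i, l) else 0)
          - superSign i j k l • (if i = l then FreeAlgebra.ι ℂ (k, j) else 0))

/-- The universal enveloping algebra `U(gl(m|n))` over `ℂ`. -/
def UGl (m n : ℕ) : Type := RingQuot (SuperRel m n)

instance (m n : ℕ) : Ring (UGl m n) := inferInstanceAs (Ring (RingQuot (SuperRel m n)))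

instance (m n : ℕ) : Algebra ℂ (UGl m n) :=
  inferInstanceAs (Algebra ℂ (RingQuot (SuperRel m n)))

/-- The quotient map from the free algebra. -/
def UGl.mk (m n : ℕ) :
    FreeAlgebra ℂ (Idx m n × Idx m n) →ₐ[ℂ] UGl m n :=
  RingQuot.mkAlgHom ℂ (SuperRel m n)

theorem UGl.mk_rel {m n : ℕ} {x y : FreeAlgebra ℂ _} (h : SuperRel m n x y) :
    UGl.mk m n x = UGl.mk m n y :=
  RingQuot.mkAlgHom_rel ℂ h

/-- The element `E_{ij}` of `U(gl(m|n))`. -/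
def UGl.E {m n : ℕ} (i j : Idx m n) : UGl m n :=
  UGl.mk m n (FreeAlgebra.ι ℂ (i, j))

theorem UGl.comm {m n : ℕ} (i j k l : Idx m n) :
    UGl.E i j * UGl.E k l - superSign i j k l • (UGl.E k l * UGl.E i j)
      = (if k = j then UGl.E i l else 0)
        - superSign i j k l • (if i = l then UGl.E k j else (0 : UGl m n)) := by
  have h := UGl.mk_rel (SuperRel.comm i j k l)
  simp only [map_sub, map_mul, map_smul, apply_ite (UGl.mk m n),
    map_zero] at h
  exact h

/-- The centralizer `U(gl(m|n))^{gl(m)}` of the (purely even) subalgebra `gl(m)`. -/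
def glCentralizer (m n : ℕ) : Subalgebra ℂ (UGl m n) :=
  Subalgebra.centralizer ℂ
    {x | ∃ k l : Fin m, x = UGl.E (Sum.inl k) (Sum.inl l)}

/-! ### The extension `U'(gl(m|n))` -/

/-- The field of fractions `R(h)` of `U(h) = ℂ[E_{11}, …, E_{mm}]`; the variable `X i`
stands for `E_{ii}`. -/
abbrev CartanField (m : ℕ) : Type := FractionRing (MvPolynomial (Fin m) ℂ)

/-- `E_{ii}` as an element of `R(h)`. -/
def cartanE {m : ℕ} (i : Fin m) : CartanField m :=
  algebraMap (MvPolynomial (Fin m) ℂ) (CartanField m) (MvPolynomial.X i)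

/-- `h_i = E_{ii} - i + 1`, where `i` is counted from `1` (so `i : Fin m` from `0` gives
`E_{ii} - i`). -/
def cartanH {m : ℕ} (i : Fin m) : CartanField m := cartanE i - ((i : ℕ) : CartanField m)

/-- Generators of `U'(gl(m|n))`: the `E_{ij}` and the elements of `R(h)`. -/
abbrev ExtGen (m n : ℕ) : Type := (Idx m n × Idx m n) ⊕ CartanField m

/-- The defining relations of `U'(gl(m|n))`: those of `U(gl(m|n))`, those of the `ℂ`-algebra
`R(h)`, and the identification of the two copies of `U(h)`. -/
inductive ExtRel (m n : ℕ) :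
    FreeAlgebra ℂ (ExtGen m n) → FreeAlgebra ℂ (ExtGen m n) → Prop
  | comm (i j k l : Idx m n) :
      ExtRel m n
        (FreeAlgebra.ι ℂ (Sum.inl (i, j)) * FreeAlgebra.ι ℂ (Sum.inl (k, l))
          - superSign i j k l •
            (FreeAlgebra.ι ℂ (Sum.inl (k, l)) * FreeAlgebra.ι ℂ (Sum.inl (i, j))))
        ((if k = j then FreeAlgebra.ι ℂ (Sum.inl (i, l)) else 0)
          - superSign i j k l • (if i = l then FreeAlgebra.ι ℂ (Sum.inl (k, j)) else 0))
  | add (f g : CartanField m) :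
      ExtRel m n (FreeAlgebra.ι ℂ (Sum.inr (f + g)))
        (FreeAlgebra.ι ℂ (Sum.inr f) + FreeAlgebra.ι ℂ (Sum.inr g))
  | mul (f g : CartanField m) :
      ExtRel m n (FreeAlgebra.ι ℂ (Sum.inr (f * g)))
        (FreeAlgebra.ι ℂ (Sum.inr f) * FreeAlgebra.ι ℂ (Sum.inr g))
  | scalar (c : ℂ) :
      ExtRel m n (FreeAlgebra.ι ℂ (Sum.inr (algebraMap ℂ (CartanField m) c)))
        (algebraMap ℂ _ c)
  | cartan (i : Fin m) :
      ExtRel m n (FreeAlgebra.ι ℂ (Sum.inr (cartanE i)))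
        (FreeAlgebra.ι ℂ (Sum.inl (Sum.inl i, Sum.inl i)))

/-- The algebra `U'(gl(m|n)) = U(gl(m|n)) ⊗_{U(h)} R(h)`, i.e. the localization of
`U(gl(m|n))` at the nonzero elements of `U(h)`. It is presented by its universal property, as
the algebra generated by `U(gl(m|n))` and the field `R(h)` with the two copies of `U(h)`
identified. As the nonzero elements of `U(h)` satisfy the Ore condition in `U(gl(m|n))`
(`f(h) E_{kl} = E_{kl} f(h + α)` with `α` the weight of `E_{kl}`), every element is a sum of
products `x f` with `x` in `U(gl(m|n))` and `f` in `R(h)`. -/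
def UExt (m n : ℕ) : Type := RingQuot (ExtRel m n)

instance (m n : ℕ) : Ring (UExt m n) := inferInstanceAs (Ring (RingQuot (ExtRel m n)))

instance (m n : ℕ) : Algebra ℂ (UExt m n) :=
  inferInstanceAs (Algebra ℂ (RingQuot (ExtRel m n)))

/-- The quotient map from the free algebra. -/
def UExt.mk (m n : ℕ) :
    FreeAlgebra ℂ (ExtGen m n) →ₐ[ℂ] UExt m n :=
  RingQuot.mkAlgHom ℂ (ExtRel m n)

theorem UExt.mk_rel {m n : ℕ} {x y : FreeAlgebra ℂ _} (h : ExtRel m n x y) :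
    UExt.mk m n x = UExt.mk m n y :=
  RingQuot.mkAlgHom_rel ℂ h

namespace UExt

/-- The element `E_{ij}` of `U'(gl(m|n))`. -/
def E {m n : ℕ} (i j : Idx m n) : UExt m n :=
  mk m n (FreeAlgebra.ι ℂ (Sum.inl (i, j)))

theorem comm {m n : ℕ} (i j k l : Idx m n) :
    E i j * E k l - superSign i j k l • (E k l * E i j)
      = (if k = j then E i l else 0)
        - superSign i j k l • (if i = l then E k j else (0 : UExt m n)) := by
  have h := mk_rel (ExtRel.comm i j k l)
  simp only [map_sub, map_mul, map_smul, apply_ite (mk m n),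
    map_zero] at h
  exact h

/-- The embedding `R(h) → U'(gl(m|n))`. -/
def ofCartan (m n : ℕ) : CartanField m →ₐ[ℂ] UExt m n :=
  AlgHom.ofLinearMap
    { toFun := fun f => mk m n (FreeAlgebra.ι ℂ (Sum.inr f))
      map_add' := fun f g => by
        rw [mk_rel (ExtRel.add f g), map_add]
      map_smul' := fun c f => by
        rw [Algebra.smul_def, mk_rel (ExtRel.mul _ f), map_mul,
          mk_rel (ExtRel.scalar c), AlgHom.commutes, ← Algebra.smul_def,
          RingHom.id_apply] }
    (by
      have h := mk_rel (ExtRel.scalar (m := m) (n := n) 1)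
      rw [map_one, map_one, map_one] at h
      exact h)
    (fun f g => by
      have h := mk_rel (ExtRel.mul (m := m) (n := n) f g)
      rw [map_mul] at h
      exact h)

theorem ofCartan_cartanE {m n : ℕ} (i : Fin m) :
    ofCartan m n (cartanE i) = E (Sum.inl i) (Sum.inl i) :=
  mk_rel (ExtRel.cartan (m := m) (n := n) i)

/-- The natural homomorphism `U(gl(m|n)) → U'(gl(m|n))`. -/
def ofUGl (m n : ℕ) : UGl m n →ₐ[ℂ] UExt m n :=
  RingQuot.liftAlgHom ℂ
    ⟨FreeAlgebra.lift ℂ (fun ij : Idx m n × Idx m n => E ij.1 ij.2), by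
      rintro _ _ ⟨i, j, k, l⟩
      simp only [map_sub, map_mul, map_smul, FreeAlgebra.lift_ι_apply,
        apply_ite (FreeAlgebra.lift ℂ (fun ij : Idx m n × Idx m n => E (m := m) (n := n) ij.1 ij.2)),
        map_zero]
      exact comm i j k l⟩

theorem ofUGl_E {m n : ℕ} (i j : Idx m n) : ofUGl m n (UGl.E i j) = E i j := by
  refine (RingQuot.liftAlgHom_mkAlgHom_apply ..).trans ?_
  simp

/-- The left ideal `J` of `U'(gl(m|n))` generated by the `E_{ij}` with `i < j ≤ m`. -/
def J (m n : ℕ) : Ideal (UExt m n) :=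
  Ideal.span {x | ∃ i j : Fin m, i < j ∧ x = E (Sum.inl i) (Sum.inl j)}

theorem E_mem_J {m n : ℕ} {i j : Fin m} (h : i < j) :
    (E (Sum.inl i) (Sum.inl j) : UExt m n) ∈ J m n :=
  Ideal.subset_span ⟨i, j, h, rfl⟩

/-- The normalizer `Norm J = {x | J x ⊆ J}`. -/
def normJ (m n : ℕ) : Subalgebra ℂ (UExt m n) where
  carrier := {x | ∀ y ∈ J m n, y * x ∈ J m n}
  mul_mem' := fun {a b} ha hb y hy => by
    rw [← mul_assoc]
    exact hb _ (ha _ hy)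
  add_mem' := fun {a b} ha hb y hy => by
    rw [mul_add]
    exact (J m n).add_mem (ha _ hy) (hb _ hy)
  algebraMap_mem' := fun c y hy => by
    rw [← Algebra.commutes]
    exact (J m n).mul_mem_left _ hy

theorem mem_normJ_of_gen {m n : ℕ} {x : UExt m n}
    (h : ∀ i j : Fin m, i < j → E (Sum.inl i) (Sum.inl j) * x ∈ J m n) : x ∈ normJ m n := by
  intro y hy
  induction hy using Submodule.span_induction with
  | mem z hz =>
    obtain ⟨i, j, hij, rfl⟩ := hz
    exact h i j hij
  | zero => simp
  | add a b _ _ ha hb =>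
    rw [add_mul]
    exact (J m n).add_mem ha hb
  | smul a b _ hb =>
    rw [smul_eq_mul, mul_assoc]
    exact (J m n).mul_mem_left _ hb

/-- The shift of the variables by the weight of `E_{kl}`. -/
def shift {m : ℕ} (k l : Fin m) (c : ℂ) : MvPolynomial (Fin m) ℂ →ₐ[ℂ] MvPolynomial (Fin m) ℂ :=
  MvPolynomial.aeval fun i =>
    MvPolynomial.X i + MvPolynomial.C (c * ((if i = l then 1 else 0) - (if i = k then 1 else 0)))

theorem shift_shift {m : ℕ} (k l : Fin m) (f : MvPolynomial (Fin m) ℂ) :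
    shift k l (-1) (shift k l 1 f) = f := by
  have h : (shift k l (-1)).comp (shift k l 1) = AlgHom.id ℂ _ := by
    ext1 i
    simp only [shift, AlgHom.comp_apply, MvPolynomial.aeval_X, map_add, MvPolynomial.algHom_C,
      MvPolynomial.algebraMap_eq, AlgHom.id_apply]
    rw [add_assoc, ← map_add]
    ring_nf
    simp
  exact DFunLike.congr_fun h f

theorem E_mul_cartanE {m n : ℕ} (k l i : Fin m) :
    (E (Sum.inl k) (Sum.inl l) : UExt m n) * ofCartan m n (cartanE i)
      = (ofCartan m n (cartanE i)
          + algebraMap ℂ _ ((if i = l then 1 else 0) - (if i = k then 1 else 0)))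
        * E (Sum.inl k) (Sum.inl l) := by
  have h := comm (m := m) (n := n) (Sum.inl k) (Sum.inl l) (Sum.inl i) (Sum.inl i)
  simp only [superSign, par, Sum.inl.injEq, add_zero, mul_zero, pow_zero, one_smul] at h
  rw [ofCartan_cartanE, add_mul, ← sub_eq_iff_eq_add', h, map_sub, sub_mul]
  congr 1
  · split_ifs with h1
    · subst h1; simp
    · simp
  · by_cases h1 : k = i
    · subst h1; simp
    · simp [h1, Ne.symm h1]

theorem E_mul_poly {m n : ℕ} (k l : Fin m) (f : MvPolynomial (Fin m) ℂ) :
    (E (Sum.inl k) (Sum.inl l) : UExt m n) * ofCartan m n (algebraMap _ _ f)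
      = ofCartan m n (algebraMap _ _ (shift k l 1 f)) * E (Sum.inl k) (Sum.inl l) := by
  induction f using MvPolynomial.induction_on with
  | C c =>
    have h : ∀ c : ℂ, ofCartan m n (algebraMap (MvPolynomial (Fin m) ℂ) (CartanField m)
        (MvPolynomial.C c)) = algebraMap ℂ (UExt m n) c := fun c => by
      rw [← MvPolynomial.algebraMap_eq, ← IsScalarTower.algebraMap_apply, AlgHom.commutes]
    rw [shift, MvPolynomial.algHom_C, MvPolynomial.algebraMap_eq, h, Algebra.commutes]
  | add p q hp hq => simp only [map_add, mul_add, add_mul, hp, hq]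
  | mul_X p i hp =>
    have h : ofCartan m n (algebraMap (MvPolynomial (Fin m) ℂ) (CartanField m)
        (shift k l 1 (MvPolynomial.X i))) = ofCartan m n (cartanE i)
          + algebraMap ℂ _ ((if i = l then 1 else 0) - (if i = k then 1 else 0)) := by
      rw [shift, MvPolynomial.aeval_X, map_add, map_add, ← MvPolynomial.algebraMap_eq,
        ← IsScalarTower.algebraMap_apply, AlgHom.commutes, one_mul]
      rfl
    rw [map_mul, map_mul, map_mul, map_mul, map_mul, h, ← mul_assoc, hp, mul_assoc, mul_assoc]
    congr 1
    exact E_mul_cartanE k l i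

theorem ofCartan_mem_normJ {m n : ℕ} (r : CartanField m) : ofCartan m n r ∈ normJ m n := by
  obtain ⟨f, g, hg, rfl⟩ := IsFractionRing.div_surjective (A := MvPolynomial (Fin m) ℂ) r
  have hinj := IsFractionRing.injective (MvPolynomial (Fin m) ℂ) (CartanField m)
  have hg0 : g ≠ 0 := nonZeroDivisors.ne_zero hg
  rw [div_eq_mul_inv, map_mul]
  refine (normJ m n).mul_mem (mem_normJ_of_gen fun i j hij => ?_)
    (mem_normJ_of_gen fun i j hij => ?_)
  · rw [E_mul_poly]
    exact (J m n).mul_mem_left _ (E_mem_J hij)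
  · have hs : shift i j 1 g ≠ 0 := fun h0 => hg0 (by
      rw [← shift_shift i j g, h0, map_zero])
    have hs' : algebraMap _ (CartanField m) (shift i j 1 g) ≠ 0 := fun h0 =>
      hs (hinj (by rw [h0, map_zero]))
    have hg' : algebraMap _ (CartanField m) g ≠ 0 := fun h0 =>
      hg0 (hinj (by rw [h0, map_zero]))
    have key : (E (Sum.inl i) (Sum.inl j) : UExt m n) * ofCartan m n (algebraMap _ _ g)⁻¹
        = ofCartan m n (algebraMap _ _ (shift i j 1 g))⁻¹ * E (Sum.inl i) (Sum.inl j) := by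
      calc (E (Sum.inl i) (Sum.inl j) : UExt m n) * ofCartan m n (algebraMap _ _ g)⁻¹
          = ofCartan m n ((algebraMap _ _ (shift i j 1 g))⁻¹ * algebraMap _ _ (shift i j 1 g))
              * (E (Sum.inl i) (Sum.inl j) * ofCartan m n (algebraMap _ _ g)⁻¹) := by
            rw [inv_mul_cancel₀ hs', map_one, one_mul]
        _ = ofCartan m n (algebraMap _ _ (shift i j 1 g))⁻¹
              * (ofCartan m n (algebraMap _ _ (shift i j 1 g)) * E (Sum.inl i) (Sum.inl j))
              * ofCartan m n (algebraMap _ _ g)⁻¹ := by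
            rw [map_mul]; simp only [mul_assoc]
        _ = ofCartan m n (algebraMap _ _ (shift i j 1 g))⁻¹ * E (Sum.inl i) (Sum.inl j)
              * ofCartan m n (algebraMap _ _ g * (algebraMap _ _ g)⁻¹) := by
            rw [← E_mul_poly, map_mul]; simp only [mul_assoc]
        _ = _ := by rw [mul_inv_cancel₀ hg', map_one, mul_one]
    rw [key]
    exact (J m n).mul_mem_left _ (E_mem_J hij)

theorem ofUGl_mem_normJ {m n : ℕ} {x : UGl m n} (hx : x ∈ glCentralizer m n) :
    ofUGl m n x ∈ normJ m n := by
  refine mem_normJ_of_gen fun i j hij => ?_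
  have h := (Subalgebra.mem_centralizer_iff ℂ).1 hx _ ⟨i, j, rfl⟩
  rw [← ofUGl_E, ← map_mul, h, map_mul, ofUGl_E]
  exact (J m n).mul_mem_left _ (E_mem_J hij)

/-- `J` as an ideal of `Norm J`. (As `J ⊆ Norm J`, the restriction loses nothing.) -/
def JNorm (m n : ℕ) : Ideal (normJ m n) := (J m n).comap (normJ m n).val

instance (m n : ℕ) : (JNorm m n).IsTwoSided :=
  ⟨fun b ha => b.2 _ ha⟩

end UExt

/-- The Mickelsson--Zhelobenko superalgebra `Z(gl(m|n), gl(m)) = Norm J / J`. -/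
abbrev MZ (m n : ℕ) : Type := UExt.normJ m n ⧸ UExt.JNorm m n

namespace MZ

/-- The embedding of `R(h)` into `Z(gl(m|n), gl(m))`. -/
def ofCartan (m n : ℕ) : CartanField m →ₐ[ℂ] MZ m n :=
  (Ideal.Quotient.mkₐ ℂ (UExt.JNorm m n)).comp
    ((UExt.ofCartan m n).codRestrict (UExt.normJ m n) UExt.ofCartan_mem_normJ)

/-- The natural homomorphism `U(gl(m|n))^{gl(m)} → Z(gl(m|n), gl(m))`. -/
def ofCentralizer (m n : ℕ) : glCentralizer m n →ₐ[ℂ] MZ m n :=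
  (Ideal.Quotient.mkₐ ℂ (UExt.JNorm m n)).comp
    (((UExt.ofUGl m n).comp (glCentralizer m n).val).codRestrict (UExt.normJ m n)
      fun x => UExt.ofUGl_mem_normJ x.2)

theorem E_mem_glCentralizer {m n : ℕ} (a b : Fin n) :
    (UGl.E (Sum.inr a) (Sum.inr b) : UGl m n) ∈ glCentralizer m n := by
  rw [glCentralizer, Subalgebra.mem_centralizer_iff]
  rintro _ ⟨k, l, rfl⟩
  have h := UGl.comm (m := m) (n := n) (Sum.inl k) (Sum.inl l) (Sum.inr a) (Sum.inr b)
  simpa [superSign, par, sub_eq_zero] using h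

/-- The element `E_{ab}` of `Z(gl(m|n), gl(m))`, for odd indices `a`, `b`. -/
def E {m n : ℕ} (a b : Fin n) : MZ m n :=
  ofCentralizer m n ⟨UGl.E (Sum.inr a) (Sum.inr b), E_mem_glCentralizer a b⟩

/-- The inclusion `Norm J / J ⊆ U'(gl(m|n)) / J`. -/
def incl (m n : ℕ) : MZ m n →+ UExt m n ⧸ UExt.J m n :=
  QuotientAddGroup.map _ _ (UExt.normJ m n).val.toRingHom.toAddMonoidHom (fun _ hx => hx)

theorem incl_mk {m n : ℕ} (x : UExt.normJ m n) :
    incl m n (Ideal.Quotient.mk _ x) = Submodule.Quotient.mk (x : UExt m n) := rfl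

theorem incl_injective (m n : ℕ) : Function.Injective (incl m n) := by
  rw [injective_iff_map_eq_zero]
  intro z hz
  obtain ⟨x, rfl⟩ := Ideal.Quotient.mk_surjective z
  rw [incl_mk, Submodule.Quotient.mk_eq_zero] at hz
  exact Ideal.Quotient.eq_zero_iff_mem.2 hz

end MZ

/-! ### The extremal projector -/

/-- The action on `U'(gl(m|n)) / J` of the series
`p_{ij} = ∑_k E_{ji}^k E_{ij}^k (-1)^k / (k! (h_i - h_j + 1) ⋯ (h_i - h_j + k))`.
The sum is finite on each vector, as `E_{ij}` with `i < j` acts locally nilpotently. -/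
def rootProjector {m n : ℕ} (i j : Fin m) (v : UExt m n ⧸ UExt.J m n) : UExt m n ⧸ UExt.J m n :=
  ∑ᶠ k : ℕ,
    (UExt.E (Sum.inl j) (Sum.inl i) ^ k * UExt.E (Sum.inl i) (Sum.inl j) ^ k
      * UExt.ofCartan m n ((-1) ^ k /
          ((k.factorial : CartanField m)
            * ∏ s ∈ Finset.Icc 1 k, (cartanH i - cartanH j + (s : CartanField m))))) • v

/-- The positive roots of `gl(m)` in lexicographic order
`(1,2), (1,3), …, (1,m), (2,3), …, (m-1,m)`, which is a normal ordering. -/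
def positiveRoots (m : ℕ) : List (Fin m × Fin m) :=
  ((List.finRange m).product (List.finRange m)).filter fun ij => ij.1 < ij.2

/-- The action of the extremal projector `p = ∏_{i < j} p_{ij}` on `U'(gl(m|n)) / J`. (The
product does not depend on the choice of a normal ordering.) -/
def extremalProjector {m n : ℕ} (v : UExt m n ⧸ UExt.J m n) : UExt m n ⧸ UExt.J m n :=
  (positiveRoots m).foldr (fun ij w => rootProjector ij.1 ij.2 w) v

/-- `p E_{ia} (h_i - h_1) ⋯ (h_i - h_{i-1})` as an element of `U'(gl(m|n)) / J`. -/
def raising {m n : ℕ} (i : Fin m) (a : Fin n) : UExt m n ⧸ UExt.J m n :=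
  extremalProjector (Submodule.Quotient.mk
    (UExt.E (Sum.inl i) (Sum.inr a)
      * UExt.ofCartan m n (∏ j ∈ Finset.univ.filter (fun j => j < i), (cartanH i - cartanH j))))

/-- `p E_{ai} (h_i - h_{i+1}) ⋯ (h_i - h_m)` as an element of `U'(gl(m|n)) / J`. -/
def lowering {m n : ℕ} (a : Fin n) (i : Fin m) : UExt m n ⧸ UExt.J m n :=
  extremalProjector (Submodule.Quotient.mk
    (UExt.E (Sum.inr a) (Sum.inl i)
      * UExt.ofCartan m n (∏ j ∈ Finset.univ.filter (fun j => i < j), (cartanH i - cartanH j))))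

/-! ### The polynomials `Z_{ab}(u)` -/

open Polynomial in
/-- The polynomial
`Z_{ab}(u) = (δ_{ab} (u + m) + E_{ab}) ∏_i (u - h_i)
  + ∑_i z_{ai} z_{ib} ∏_{j ≠ i} (u - h_j) / (h_i - h_j)`
in `u`, with coefficients in `Z(gl(m|n), gl(m))` on the left of the powers of `u`, for given
elements `zUp i b = z_{ib}` and `zDown a i = z_{ai}`. -/
def Zpoly {m n : ℕ} (zUp : Fin m → Fin n → MZ m n) (zDown : Fin n → Fin m → MZ m n)
    (a b : Fin n) : (MZ m n)[X] :=
  ((if a = b then X + C (m : MZ m n) else 0) + C (MZ.E a b))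
      * (∏ i : Fin m, (X - C (cartanH i))).map (MZ.ofCartan m n).toRingHom
    + ∑ i : Fin m, C (zDown a i * zUp i b)
      * (∏ j ∈ Finset.univ.erase i,
          (X - C (cartanH j)) * C (cartanH i - cartanH j)⁻¹).map (MZ.ofCartan m n).toRingHom

open Polynomial in
/-- The polynomial `(u + m) (u - h_1) ⋯ (u - h_m)`. -/
def denomPoly (m n : ℕ) : (MZ m n)[X] :=
  ((X + C (m : CartanField m)) * ∏ i : Fin m, (X - C (cartanH i))).map
    (MZ.ofCartan m n).toRingHom

/-- A polynomial in `u`, regarded as a Laurent series in `u⁻¹`, i.e. as an element of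
`A((u⁻¹))`, where `u⁻¹` is `HahnSeries.single 1 1`. -/
def polyAtInfinity {A : Type} [Ring A] (f : Polynomial A) : HahnSeries ℤ A :=
  f.sum fun k c => HahnSeries.single (-(k : ℤ)) c

/-! ### The Yangian of `gl(n)` -/

/-- The generator `t_{ij}^{(r)}` in the free algebra, with `t_{ij}^{(0)} = δ_{ij}`; the letter
`(i, j, r)` stands for `t_{ij}^{(r+1)}`. -/
def freeT {n : ℕ} (i j : Fin n) : ℕ → FreeAlgebra ℂ (Fin n × Fin n × ℕ)
  | 0 => if i = j then 1 else 0
  | r + 1 => FreeAlgebra.ι ℂ (i, j, r)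

/-- The defining relations of the Yangian:
`[t_{ij}^{(r+1)}, t_{kl}^{(s)}] - [t_{ij}^{(r)}, t_{kl}^{(s+1)}]
  = t_{kj}^{(r)} t_{il}^{(s)} - t_{kj}^{(s)} t_{il}^{(r)}` for `r, s ≥ 0`. -/
inductive YangianRel (n : ℕ) :
    FreeAlgebra ℂ (Fin n × Fin n × ℕ) → FreeAlgebra ℂ (Fin n × Fin n × ℕ) → Prop
  | rel (i j k l : Fin n) (r s : ℕ) :
      YangianRel n
        ((freeT i j (r + 1) * freeT k l s - freeT k l s * freeT i j (r + 1))
          - (freeT i j r * freeT k l (s + 1) - freeT k l (s + 1) * freeT i j r))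
        (freeT k j r * freeT i l s - freeT k j s * freeT i l r)

/-- The Yangian `Y(gl(n))` over `ℂ`. -/
def Yangian (n : ℕ) : Type := RingQuot (YangianRel n)

instance (n : ℕ) : Ring (Yangian n) := inferInstanceAs (Ring (RingQuot (YangianRel n)))

instance (n : ℕ) : Algebra ℂ (Yangian n) :=
  inferInstanceAs (Algebra ℂ (RingQuot (YangianRel n)))

/-- The quotient map from the free algebra. -/
def Yangian.mk (n : ℕ) :
    FreeAlgebra ℂ (Fin n × Fin n × ℕ) →ₐ[ℂ] Yangian n :=
  RingQuot.mkAlgHom ℂ (YangianRel n)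

theorem Yangian.mk_rel {n : ℕ} {x y : FreeAlgebra ℂ _} (h : YangianRel n x y) :
    Yangian.mk n x = Yangian.mk n y :=
  RingQuot.mkAlgHom_rel ℂ h

/-- The element `t_{ij}^{(r)}` of `Y(gl(n))`; it is `δ_{ij}` for `r = 0`. -/
def Yangian.t {n : ℕ} (i j : Fin n) (r : ℕ) : Yangian n :=
  Yangian.mk n (freeT i j r)

/-- The image `∑_r φ(t_{ij}^{(r)}) u^{-r}` of the series `t_{ij}(u)` under a homomorphism. -/
def Yangian.mapSeries {n : ℕ} {A : Type} [Ring A] [Algebra ℂ A] (φ : Yangian n →ₐ[ℂ] A)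
    (i j : Fin n) : HahnSeries ℤ A :=
  HahnSeries.ofPowerSeries ℤ A (PowerSeries.mk fun r => φ (Yangian.t i j r))

/-- The coefficient of `u^{-r}` in `t_{ij}(u + c)`: as
`(u + c)^{-s} = ∑_{r ≥ s} binom(r-1, r-s) (-c)^{r-s} u^{-r}` for `s ≥ 1`, it equals
`∑_{s=1}^{r} binom(r-1, r-s) (-c)^{r-s} t_{ij}^{(s)}` for `r ≥ 1`. -/
def Yangian.shiftT {n : ℕ} (c : ℂ) (i j : Fin n) (r : ℕ) : Yangian n :=
  if r = 0 then (if i = j then 1 else 0)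
  else ∑ s ∈ Finset.Icc 1 r, (((r - 1).choose (r - s) : ℂ) * (-c) ^ (r - s)) • Yangian.t i j s

end MickelssonZhelobenko

end

/-! The homomorphism is taken to be the composite `MZ.ofYangian` of the shift, the Olshanski map and
the projection. It remains to see that the factors exist, that the projected elements lie in Norm J
/ J, and that the composite has the required generating series.

Shift and Olshanski map. A sequence t^(1), t^(2), … is encoded as the linear functional X^k ↦
t^(k+1) on ℂ[X]; the substitution u ↦ u + c then becomes X ↦ X - c, and the Yangian relations become
a bilinear identity of functionals. For the Olshanski map, split the generating matrix of U(gl(m|n))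
into blocks A, B, C, D, with B and C odd, and let R = (1 - xA)⁻¹. The series 1 + xD + x²CRB commutes
with A and has simple commutators with B and C; together with the resolvent identity these give the
Yangian relations (`schurSeries_relation`).

Projected elements. A class in U'/J comes from Norm J exactly when it is singular, i.e. killed by
all E_{pq} with p < q ≤ m. The classes of E_{ib} and E_{ai} are killed by every product E_{dq}
E_{dr} with q, r > d, and this survives the root projectors of the later rows. So every factor of p
truncates to two terms, and a rank two computation, done row by row, gives singularity
(`UModJ.singular_extremalProjector`).

Generating series. The normalized Casimir operator Ω sends E_{kb} to ∑_q E_{kq} E_{qb} in U'/J. It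
is triangular on these vectors, with distinct diagonal entries h_k + m, so Lagrange interpolation in
Ω splits E_{kb} into eigencomponents `upPart i k b`. Hence ∑ E_{ak} (E^s)_{kl} E_{lb} equals ∑_i τ_i
(h_i + m)^s, where τ_i = ∑_k E_{ak} `upPart i k b` (`tau`). The main point is that τ_i is z_{ai}
z_{ib} divided by ∏_{j≠i} (h_i - h_j) (`MZ.incl_lowering_mul_raising`). Indeed p E_{ib} is `upPart i
i b`, while p E_{ai} is the row (E_{ak}) applied to the column g_i(E)e_i, with g_i a Lagrange
polynomial. After right multiplication by p E_{ib} the entries of that column obey the same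
recursion as `upPart i k b`, and the proportionality constant is the diagonal entry found in
`diag_basis_eq`.

After the shift by m the series is δ_{ab} + E_{ab}/(u+m) + ∑_i τ_i/((u+m)(u-h_i)), which is
Z_{ab}(u) over the denominator. -/

noncomputable section

namespace MickelssonZhelobenko

open Polynomial

/-! ### The Yangian: universal property and shift automorphisms. -/

namespace Yangian

theorem t_zero {n : ℕ} (i j : Fin n) : t i j 0 = if i = j then 1 else 0 := by
  simp [t, freeT, apply_ite (mk n)]

theorem t_relation {n : ℕ} (i j k l : Fin n) (r s : ℕ) :
    (t i j (r + 1) * t k l s - t k l s * t i j (r + 1))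
        - (t i j r * t k l (s + 1) - t k l (s + 1) * t i j r)
      = t k j r * t i l s - t k j s * t i l r := by
  have h := mk_rel (YangianRel.rel i j k l r s)
  simp only [map_sub, map_mul] at h
  exact h

/-- The homomorphism from the Yangian determined by a family of elements that satisfies the
defining relations. -/
def lift {n : ℕ} {A : Type*} [Ring A] [Algebra ℂ A] (T : Fin n → Fin n → ℕ → A)
    (h0 : ∀ i j, T i j 0 = if i = j then 1 else 0)
    (hT : ∀ i j k l r s, (T i j (r + 1) * T k l s - T k l s * T i j (r + 1))
        - (T i j r * T k l (s + 1) - T k l (s + 1) * T i j r)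
      = T k j r * T i l s - T k j s * T i l r) : Yangian n →ₐ[ℂ] A :=
  RingQuot.liftAlgHom ℂ
    ⟨FreeAlgebra.lift ℂ (fun x : Fin n × Fin n × ℕ => T x.1 x.2.1 (x.2.2 + 1)), by
      have key : ∀ i j r, FreeAlgebra.lift ℂ
          (fun x : Fin n × Fin n × ℕ => T x.1 x.2.1 (x.2.2 + 1)) (freeT i j r) = T i j r := by
        intro i j r
        cases r with
        | zero => rw [h0, freeT]; split_ifs <;> simp
        | succ r => simp [freeT]
      rintro _ _ ⟨i, j, k, l, r, s⟩
      simp only [map_sub, map_mul, key]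
      exact hT i j k l r s⟩

theorem lift_t {n : ℕ} {A : Type*} [Ring A] [Algebra ℂ A] (T : Fin n → Fin n → ℕ → A)
    (h0 : ∀ i j, T i j 0 = if i = j then 1 else 0)
    (hT : ∀ i j k l r s, (T i j (r + 1) * T k l s - T k l s * T i j (r + 1))
        - (T i j r * T k l (s + 1) - T k l (s + 1) * T i j r)
      = T k j r * T i l s - T k j s * T i l r) (i j : Fin n) (r : ℕ) :
    lift T h0 hT (t i j r) = T i j r := by
  refine (RingQuot.liftAlgHom_mkAlgHom_apply ..).trans ?_
  cases r with
  | zero => rw [h0, freeT]; split_ifs <;> simp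
  | succ r => simp [freeT]

theorem algHom_ext {n : ℕ} {A : Type*} [Ring A] [Algebra ℂ A] {f g : Yangian n →ₐ[ℂ] A}
    (h : ∀ i j r, f (t i j (r + 1)) = g (t i j (r + 1))) : f = g := by
  refine RingQuot.ringQuot_ext' ℂ _ _ ?_
  ext ⟨i, j, r⟩
  exact h i j r

end Yangian

/-- The linear functional on polynomials that sends `X ^ k` to the `(k + 1)`-st term of a
sequence. -/
def seqFunctional {A : Type*} [Ring A] [Algebra ℂ A] (T : ℕ → A) : ℂ[X] →ₗ[ℂ] A :=
  Polynomial.lsum fun k => LinearMap.toSpanSingleton ℂ A (T (k + 1))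

theorem seqFunctional_monomial {A : Type*} [Ring A] [Algebra ℂ A] (T : ℕ → A) (k : ℕ) (c : ℂ) :
    seqFunctional T (monomial k c) = c • T (k + 1) := by
  simp [seqFunctional, Polynomial.lsum_apply]

theorem seqFunctional_X_pow {A : Type*} [Ring A] [Algebra ℂ A] (T : ℕ → A) (k : ℕ) :
    seqFunctional T (X ^ k) = T (k + 1) := by
  rw [← monomial_one_right_eq_X_pow, seqFunctional_monomial, one_smul]

theorem seqFunctional_one {A : Type*} [Ring A] [Algebra ℂ A] (T : ℕ → A) :
    seqFunctional T 1 = T 1 := by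
  rw [← pow_zero X, seqFunctional_X_pow]

theorem map_seqFunctional {A B : Type*} [Ring A] [Algebra ℂ A] [Ring B] [Algebra ℂ B]
    (φ : A →ₐ[ℂ] B) (T : ℕ → A) (f : ℂ[X]) :
    φ (seqFunctional T f) = seqFunctional (fun r => φ (T r)) f := by
  induction f using Polynomial.induction_on' with
  | add p q hp hq => simp only [map_add, hp, hq]
  | monomial k c => simp only [seqFunctional_monomial, map_smul]

/-- Replacing a sequence by the values of its functional on powers of g amounts to the substitution
X ↦ g. This is how shifts are composed. -/
theorem seqFunctional_comp {A : Type*} [Ring A] [Algebra ℂ A] (T : ℕ → A) (g f : ℂ[X]) :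
    seqFunctional (fun r => seqFunctional T (g ^ (r - 1))) f = seqFunctional T (f.comp g) := by
  induction f using Polynomial.induction_on' with
  | add p q hp hq => simp only [map_add, hp, hq, add_comp]
  | monomial k c =>
    rw [seqFunctional_monomial, monomial_comp, ← smul_eq_C_mul, map_smul, Nat.add_sub_cancel]

namespace Yangian

theorem shiftT_zero {n : ℕ} (c : ℂ) (i j : Fin n) :
    shiftT c i j 0 = if i = j then 1 else 0 := by simp [shiftT]

theorem seqFunctional_X_sub_C_pow {A : Type*} [Ring A] [Algebra ℂ A] (T : ℕ → A) (c : ℂ) (a : ℕ) :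
    seqFunctional T ((X - C c) ^ a)
      = ∑ s ∈ Finset.Icc 1 (a + 1), ((a.choose (a + 1 - s) : ℂ) * (-c) ^ (a + 1 - s)) • T s := by
  rw [sub_eq_add_neg, add_pow, map_sum]
  rw [show Finset.Icc 1 (a + 1) = (Finset.range (a + 1)).image (fun k => k + 1) by
    ext x
    simp only [Finset.mem_Icc, Finset.mem_image, Finset.mem_range]
    constructor
    · rintro ⟨h1, h2⟩
      exact ⟨x - 1, by omega, by omega⟩
    · rintro ⟨k, hk, rfl⟩
      omega]
  rw [Finset.sum_image (fun x _ y _ h => Nat.succ_injective h)]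
  refine Finset.sum_congr rfl fun k hk => ?_
  have hk' : k ≤ a := by simpa [Nat.lt_succ_iff] using hk
  have h : X ^ k * (-C c) ^ (a - k) * (a.choose k : ℂ[X])
      = monomial k ((a.choose k : ℂ) * (-c) ^ (a - k)) := by
    rw [← C_mul_X_pow_eq_monomial, ← C_neg, ← C_pow, C_mul]
    simp only [map_natCast]
    ring
  rw [h, seqFunctional_monomial, Nat.add_sub_add_right, Nat.choose_symm hk']

theorem shiftT_succ {n : ℕ} (c : ℂ) (i j : Fin n) (a : ℕ) :
    shiftT c i j (a + 1) = seqFunctional (t i j) ((X - C c) ^ a) := by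
  rw [seqFunctional_X_sub_C_pow, shiftT, if_neg (Nat.succ_ne_zero a), Nat.add_sub_cancel]

/-- Both sides are bilinear in f and g, and on monomials this is a defining relation with positive
upper indices. -/
theorem functional_relation {n : ℕ} (i j k l : Fin n) (f g : ℂ[X]) :
    (seqFunctional (t i j) (X * f) * seqFunctional (t k l) g
        - seqFunctional (t k l) g * seqFunctional (t i j) (X * f))
      - (seqFunctional (t i j) f * seqFunctional (t k l) (X * g)
        - seqFunctional (t k l) (X * g) * seqFunctional (t i j) f)
      = seqFunctional (t k j) f * seqFunctional (t i l) g
        - seqFunctional (t k j) g * seqFunctional (t i l) f := by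
  induction f using Polynomial.induction_on' with
  | add p q hp hq =>
    simp only [mul_add, map_add, add_mul]
    linear_combination (norm := abel) hp + hq
  | monomial a c =>
    induction g using Polynomial.induction_on' with
    | add p q hp hq =>
      simp only [mul_add, map_add, add_mul] at hp hq ⊢
      linear_combination (norm := abel) hp + hq
    | monomial b d =>
      simp only [X_mul_monomial, seqFunctional_monomial, smul_mul_smul_comm, mul_comm d c,
        ← smul_sub]
      rw [t_relation i j k l (a + 1) (b + 1)]

/-- The functional does not see t^(0), so the defining relation with r = 0 needs a separate form. -/
theorem functional_relation_one {n : ℕ} (i j k l : Fin n) (g : ℂ[X]) :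
    t i j 1 * seqFunctional (t k l) g - seqFunctional (t k l) g * t i j 1
      = (if k = j then seqFunctional (t i l) g else 0)
        - (if i = l then seqFunctional (t k j) g else 0) := by
  induction g using Polynomial.induction_on' with
  | add p q hp hq =>
    simp only [mul_add, map_add, add_mul] at hp hq ⊢
    split_ifs at * <;> linear_combination (norm := abel) hp + hq
  | monomial b d =>
    have h := t_relation i j k l 0 (b + 1)
    simp only [t_zero, zero_add] at h
    simp only [seqFunctional_monomial, mul_smul_comm, smul_mul_assoc, ← smul_sub]
    simp only [ite_mul, mul_ite, one_mul, mul_one, zero_mul, mul_zero] at h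
    have h' : t i j 1 * t k l (b + 1) - t k l (b + 1) * t i j 1
      = (if k = j then t i l (b + 1) else 0) - (if i = l then t k j (b + 1) else 0) := by
      rw [← h]
      by_cases hij : i = j <;> simp [hij]
    rw [h']
    split_ifs <;> simp [smul_sub]

/-- The endomorphism `t_{ij}(u) ↦ t_{ij}(u + c)` of the Yangian. -/
def shiftHom {n : ℕ} (c : ℂ) : Yangian n →ₐ[ℂ] Yangian n :=
  lift (shiftT c) (shiftT_zero c) (by
    intro i j k l r s
    -- The terms with the factor c occur in both commutators of the relation and cancel.
    have hX : ∀ a : ℕ, (X - C c) ^ (a + 1) = X * (X - C c) ^ a - c • (X - C c) ^ a := fun a => by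
      rw [smul_eq_C_mul]; ring
    cases r with
    | zero =>
      cases s with
      | zero =>
        simp only [shiftT_zero, shiftT_succ, pow_zero, zero_add, seqFunctional_one]
        split_ifs <;> simp
      | succ s =>
        have h := functional_relation_one i j k l ((X - C c) ^ s)
        simp only [shiftT_zero, shiftT_succ, pow_zero, zero_add, seqFunctional_one, h]
        split_ifs <;> simp
    | succ r =>
      cases s with
      | zero =>
        have h := functional_relation_one k l i j ((X - C c) ^ r)
        simp only [shiftT_zero, shiftT_succ, pow_zero, zero_add, seqFunctional_one]
        rw [← neg_sub (t k l 1 * _), h]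
        split_ifs <;> simp
      | succ s =>
        have h := functional_relation i j k l ((X - C c) ^ r) ((X - C c) ^ s)
        rw [shiftT_succ, shiftT_succ, shiftT_succ, shiftT_succ, shiftT_succ, shiftT_succ,
          shiftT_succ, shiftT_succ, ← h, hX, hX]
        simp only [map_sub, map_smul, sub_mul, mul_sub, smul_mul_assoc, mul_smul_comm]
        abel)

theorem shiftHom_t {n : ℕ} (c : ℂ) (i j : Fin n) (r : ℕ) :
    shiftHom c (t i j r) = shiftT c i j r := lift_t ..

theorem shiftHom_comp_neg {n : ℕ} (c : ℂ) :
    (shiftHom c).comp (shiftHom (-c)) = AlgHom.id ℂ (Yangian n) := by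
  refine algHom_ext fun i j r => ?_
  rw [AlgHom.comp_apply, shiftHom_t, shiftT_succ, map_seqFunctional, AlgHom.id_apply]
  have h : seqFunctional (fun r => shiftHom c (t i j r))
      = seqFunctional (fun r => seqFunctional (t i j) ((X - C c) ^ (r - 1))) := by
    ext k
    simp [seqFunctional_monomial, shiftHom_t, shiftT_succ]
  rw [h, seqFunctional_comp, pow_comp, sub_comp, X_comp, C_comp, C_neg, sub_neg_eq_add,
    sub_add_cancel, seqFunctional_X_pow]

/-- The automorphism `t_{ij}(u) ↦ t_{ij}(u + c)` of the Yangian. -/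
def shiftEquiv (n : ℕ) (c : ℂ) : Yangian n ≃ₐ[ℂ] Yangian n :=
  AlgEquiv.ofAlgHom (shiftHom c) (shiftHom (-c)) (shiftHom_comp_neg c)
    (by simpa using shiftHom_comp_neg (n := n) (-c))

theorem shiftEquiv_t {n : ℕ} (c : ℂ) (i j : Fin n) (r : ℕ) :
    shiftEquiv n c (t i j r) = shiftT c i j r := shiftHom_t c i j r

end Yangian

end MickelssonZhelobenko

end

noncomputable section

namespace MickelssonZhelobenko

/-- The commutation relations between the four blocks of the generating matrix of
`U(gl(m|n))`. -/
structure BlockRelations {ι κ S : Type*} [DecidableEq ι] [DecidableEq κ] [Ring S]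
    (A : Matrix ι ι S) (B : Matrix ι κ S) (C : Matrix κ ι S) (D : Matrix κ κ S) : Prop where
  AA : ∀ p q k l, A p q * A k l - A k l * A p q
    = (if k = q then A p l else 0) - (if p = l then A k q else 0)
  AB : ∀ k l p j, A k l * B p j - B p j * A k l = if l = p then B k j else 0
  AC : ∀ k l i p, A k l * C i p - C i p * A k l = -(if p = k then C i l else 0)
  AD : ∀ k l i j, A k l * D i j - D i j * A k l = 0
  DB : ∀ i j k l, D i j * B k l - B k l * D i j = -(if i = l then B k j else 0)
  DC : ∀ i j k l, D i j * C k l - C k l * D i j = if j = k then C i l else 0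
  DD : ∀ i j k l, D i j * D k l - D k l * D i j
    = (if k = j then D i l else 0) - (if i = l then D k j else 0)
  BC : ∀ k j i l, B k j * C i l + C i l * B k j
    = (if j = i then A k l else 0) + (if k = l then D i j else 0)
  BB : ∀ k j l i, B k j * B l i + B l i * B k j = 0
  CC : ∀ i k j l, C i k * C j l + C j l * C i k = 0

/-! ### Commutators with the resolvent (1 - xA)⁻¹. -/

section Resolvent

variable {ι κ k S : Type*} [Fintype ι] [DecidableEq ι] [DecidableEq κ]
  [CommRing k] [Ring S] [Algebra k S]
  {A R Q : Matrix ι ι S} {B : Matrix ι κ S} {C : Matrix κ ι S} {D : Matrix κ κ S} {x y : k}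

omit [DecidableEq ι] in
theorem mul_entry {κ' κ'' : Type*} (M : Matrix κ' ι S) (N : Matrix ι κ'' S) (i : κ') (j : κ'') :
    (M * N) i j = ∑ a, M i a * N a j := rfl

/-- The Leibniz rule for an inverse: [X, R] = x R [X, A] R, with X regarded as a scalar matrix. -/
theorem commutator_resolvent (h1 : (1 - x • A) * R = 1) (h2 : R * (1 - x • A) = 1)
    (X : S) (p q : ι) :
    X * R p q - R p q * X = x • ∑ b, (∑ a, R p a * (X * A a b - A a b * X)) * R b q := by
  have h : Matrix.diagonal (fun _ => X) * R - R * Matrix.diagonal (fun _ => X)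
      = x • (R * (Matrix.diagonal (fun _ => X) * A - A * Matrix.diagonal (fun _ => X)) * R) := by
    calc _ = R * (1 - x • A) * Matrix.diagonal (fun _ => X) * R
          - R * Matrix.diagonal (fun _ => X) * ((1 - x • A) * R) := by
          rw [h1, h2, one_mul, mul_one]
      _ = _ := by
          simp only [mul_sub, sub_mul, mul_one, one_mul, smul_mul_assoc, mul_smul_comm, smul_sub,
            mul_assoc]
          abel
  have h' := congrFun (congrFun h p) q
  rw [Matrix.sub_apply, Matrix.diagonal_mul, Matrix.mul_diagonal, Matrix.smul_apply,
    mul_entry] at h'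
  simpa only [mul_entry R, Matrix.sub_apply, Matrix.diagonal_mul, Matrix.mul_diagonal] using h'

theorem resolvent_mul_self (h2 : R * (1 - x • A) = 1) : x • (R * A) = R - 1 := by
  rw [← h2]; simp [mul_sub]

theorem self_mul_resolvent (h1 : (1 - x • A) * R = 1) : x • (A * R) = R - 1 := by
  rw [← h1]; simp [sub_mul]

/-- The resolvent identity. -/
theorem resolvent_identity (h2 : R * (1 - x • A) = 1) (h3 : (1 - y • A) * Q = 1) :
    (x - y) • (R * Q) = x • R - y • Q := by
  calc (x - y) • (R * Q)
      = x • (R * ((1 - y • A) * Q)) - y • (R * (1 - x • A) * Q) := by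
        simp only [mul_sub, sub_mul, mul_one, one_mul, smul_mul_assoc, mul_smul_comm, smul_sub,
          mul_assoc, smul_smul, mul_comm x y]
        module
    _ = _ := by rw [h2, h3, mul_one, one_mul]

/-- As x and y are central, 1 - xA and 1 - yA commute even though the entries of A do not; hence so
do their inverses. -/
theorem resolvent_commute (h1 : (1 - x • A) * R = 1) (h2 : R * (1 - x • A) = 1)
    (h3 : (1 - y • A) * Q = 1) (h4 : Q * (1 - y • A) = 1) : R * Q = Q * R := by
  have h : (1 - y • A) * (1 - x • A) = (1 - x • A) * (1 - y • A) := by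
    simp only [mul_sub, sub_mul, mul_one, one_mul, smul_mul_assoc, mul_smul_comm, smul_smul,
      smul_sub]
    module
  calc R * Q = Q * (1 - y • A) * (R * Q) := by rw [h4, one_mul]
    _ = Q * (R * ((1 - x • A) * (1 - y • A)) * R * Q) := by
        rw [← mul_assoc R, h2, one_mul]
        noncomm_ring
    _ = Q * ((R * (1 - y • A)) * ((1 - x • A) * R) * Q) := by rw [← h]; noncomm_ring
    _ = Q * (R * ((1 - y • A) * Q)) := by rw [h1, mul_one, mul_assoc]
    _ = Q * R := by rw [h3, mul_one]

variable (hb : BlockRelations A B C D) (h1 : (1 - x • A) * R = 1) (h2 : R * (1 - x • A) = 1)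

include hb h1 h2

/-- The Kronecker deltas in [A, A] collapse the double sum of `commutator_resolvent` to products
with RA and AR, and both x RA and x AR equal R - 1. -/
theorem A_comm_resolvent (p q r s : ι) : A p q * R r s - R r s * A p q
    = (if q = r then R p s else 0) - (if p = s then R r q else 0) := by
  rw [commutator_resolvent h1 h2]
  simp only [hb.AA, mul_sub, Finset.sum_sub_distrib, sub_mul, mul_ite, mul_zero, Finset.sum_ite_eq',
    Finset.mem_univ, if_true]
  have e1 : ∑ b, R r q * A p b * R b s = R r q * (A * R) p s := by
    simp only [Matrix.mul_apply, Finset.mul_sum, mul_assoc]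
  have e2 : ∑ b, (∑ a, if p = b then R r a * A a q else 0) * R b s = (R * A) r q * R p s := by
    rw [Finset.sum_eq_single p]
    · simp [Matrix.mul_apply]
    · intro b _ hb'; simp [Ne.symm hb']
    · simp
  rw [e1, e2, smul_sub, ← mul_smul_comm, ← smul_mul_assoc, ← Matrix.smul_apply,
    ← Matrix.smul_apply, resolvent_mul_self h2, self_mul_resolvent h1]
  simp only [Matrix.sub_apply, Matrix.one_apply, mul_sub, sub_mul, ite_mul, mul_ite, mul_one,
    one_mul, mul_zero, zero_mul, eq_comm (a := r)]
  abel

theorem B_comm_resolvent (p : ι) (j : κ) (r s : ι) :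
    B p j * R r s - R r s * B p j = -(x • ((R * B) r j * R p s)) := by
  rw [commutator_resolvent h1 h2]
  have h : ∀ a b, B p j * A a b - A a b * B p j = -(if b = p then B a j else 0) := fun a b => by
    rw [← hb.AB, neg_sub]
  simp only [h, mul_neg, mul_ite, mul_zero, Finset.sum_neg_distrib, neg_mul, smul_neg]
  rw [Finset.sum_eq_single p]
  · simp [Matrix.mul_apply]
  · intro b _ hb'; simp [hb']
  · simp

theorem C_comm_resolvent (i : κ) (p r s : ι) :
    C i p * R r s - R r s * C i p = x • (R r p * (C * R) i s) := by
  rw [commutator_resolvent h1 h2]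
  have h : ∀ a b, C i p * A a b - A a b * C i p = if p = a then C i b else 0 := fun a b => by
    rw [← neg_sub, hb.AC, neg_neg]
  simp only [h, mul_ite, mul_zero, Finset.sum_ite_eq, Finset.mem_univ, if_true, Matrix.mul_apply,
    Finset.mul_sum, mul_assoc]

theorem D_comm_resolvent (i j : κ) (r s : ι) : D i j * R r s - R r s * D i j = 0 := by
  rw [commutator_resolvent h1 h2]
  have h : ∀ a b, D i j * A a b - A a b * D i j = 0 := fun a b => by
    rw [← neg_sub, hb.AD, neg_zero]
  simp [h]

/-- The sign comes from the anticommuting entries of C; the correction comes from moving C past R.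
-/
theorem CR_mul_C (i : κ) (b : ι) (l : κ) (p : ι) :
    (C * R) i b * C l p = -(C l p * (C * R) i b) - x • ((C * R) i p * (C * R) l b) := by
  have h : ∀ a, C i a * R a b * C l p
      = -(C l p * (C i a * R a b)) - x • (C i a * R a p * (C * R) l b) := fun a => by
    have e1 := C_comm_resolvent hb h1 h2 l p a b
    have e2 := hb.CC i a l p
    rw [mul_assoc, mul_assoc (C i a) (R a p), ← mul_smul_comm, ← e1, ← mul_assoc (C l p),
      eq_neg_of_add_eq_zero_right e2]
    noncomm_ring
  simp only [mul_entry C R i, Finset.sum_mul, Finset.mul_sum, h, Finset.sum_sub_distrib,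
    Finset.smul_sum, Finset.sum_neg_distrib]

theorem B_mul_RB (q : ι) (l : κ) (a : ι) (j : κ) :
    B q l * (R * B) a j = -((R * B) a j * B q l) - x • ((R * B) a l * (R * B) q j) := by
  have h : ∀ b, B q l * (R a b * B b j)
      = -(R a b * B b j * B q l) - x • ((R * B) a l * (R q b * B b j)) := fun b => by
    have e1 := B_comm_resolvent hb h1 h2 q l a b
    have e2 := hb.BB q l b j
    rw [← mul_assoc, sub_eq_iff_eq_add.1 e1, add_mul, mul_assoc (R a b), 
      eq_neg_of_add_eq_zero_left e2, neg_mul, smul_mul_assoc]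
    simp only [mul_assoc, mul_neg]
    abel
  simp only [mul_entry R B a j, mul_entry R B q j, Finset.sum_mul, Finset.mul_sum, h,
    Finset.sum_sub_distrib, Finset.smul_sum, Finset.sum_neg_distrib]

/-- The anticommutator of B and C contributes a term CRA. The factor x in front is there to rewrite
x CRA as CR - C. -/
theorem CRB_mul_C (i j l : κ) (p : ι) :
    x • ((C * R * B) i j * C l p - C l p * (C * R * B) i j)
      = (C * R) i p * (x • D l j + x • x • (C * R * B) l j)
        + (if j = l then (C * R) i p - C i p else 0) := by
  have h : ∀ b, (C * R) i b * B b j * C l p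
      = C l p * ((C * R) i b * B b j) + x • ((C * R) i p * ((C * R) l b * B b j))
        + (C * R) i b * ((if j = l then A b p else 0) + (if b = p then D l j else 0)) := fun b => by
    rw [← hb.BC b j l p, mul_add, ← mul_assoc _ (C l p), CR_mul_C hb h1 h2]
    simp only [sub_mul, neg_mul, smul_mul_assoc, mul_assoc]
    abel
  have hs : (C * R * B) i j * C l p = C l p * (C * R * B) i j
      + x • ((C * R) i p * (C * R * B) l j) + (if j = l then (C * R * A) i p else 0)
      + (C * R) i p * D l j := by
    simp only [mul_entry _ B, Finset.sum_mul, Finset.mul_sum, h, Finset.sum_add_distrib,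
      Finset.smul_sum, mul_add, add_assoc]
    congr 3
    · split_ifs <;> simp [mul_entry _ A]
    · simp [Finset.sum_ite_eq']
  have hA : x • (C * R * A) i p = (C * R) i p - C i p := by
    rw [← Matrix.smul_apply, Matrix.mul_assoc, ← Matrix.mul_smul, resolvent_mul_self h2, Matrix.mul_sub, Matrix.mul_one,
      Matrix.sub_apply]
  rw [hs, ← hA]
  split_ifs <;> simp only [mul_add, mul_smul_comm] <;> module

theorem B_mul_CRB (q : ι) (i j l : κ) :
    x • (B q l * (C * R * B) i j - (C * R * B) i j * B q l)
      = (x • D i l + x • x • (C * R * B) i l) * (R * B) q j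
        + (if l = i then (R * B) q j - B q j else 0) := by
  have h : ∀ a, B q l * (C i a * (R * B) a j)
      = C i a * (R * B) a j * B q l + x • (C i a * (R * B) a l * (R * B) q j)
        + ((if l = i then A q a else 0) + (if q = a then D i l else 0)) * (R * B) a j := fun a => by
    have e := B_mul_RB hb h1 h2 q l a j
    rw [← hb.BC q l i a, add_mul, mul_assoc (C i a) (B q l), e]
    simp only [mul_sub, mul_neg, mul_smul_comm, mul_assoc]
    abel
  have hs : B q l * (C * R * B) i j = (C * R * B) i j * B q l
      + x • ((C * R * B) i l * (R * B) q j) + (if l = i then (A * (R * B)) q j else 0)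
      + D i l * (R * B) q j := by
    rw [Matrix.mul_assoc]
    simp only [mul_entry C (R * B), Finset.sum_mul, Finset.mul_sum, h, Finset.sum_add_distrib,
      Finset.smul_sum, add_mul, add_assoc]
    congr 3
    · split_ifs <;> simp [mul_entry A]
    · simp [Finset.sum_ite_eq]
  have hA : x • (A * (R * B)) q j = (R * B) q j - B q j := by
    rw [← Matrix.smul_apply, ← Matrix.mul_assoc, ← Matrix.smul_mul, self_mul_resolvent h1,
      Matrix.sub_mul, Matrix.one_mul, Matrix.sub_apply]
  rw [hs, ← hA]
  split_ifs <;> simp only [add_mul, smul_mul_assoc] <;> module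

/-- The gl(m)-indices of CRB are contracted, so the contributions of the three factors cancel in
pairs. -/
theorem A_comm_CRB (p q : ι) (i j : κ) :
    A p q * (C * R * B) i j - (C * R * B) i j * A p q = 0 := by
  have hCR : ∀ b, A p q * (C * R) i b - (C * R) i b * A p q
      = -(if p = b then (C * R) i q else 0) := fun b => by
    have h : ∀ a, A p q * (C i a * R a b) - C i a * R a b * A p q
        = -((if a = p then C i q else 0) * R a b)
          + C i a * ((if q = a then R p b else 0) - (if p = b then R a q else 0)) := fun a => by
      rw [← A_comm_resolvent hb h1 h2, ← neg_mul, ← hb.AC]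
      noncomm_ring
    simp only [mul_entry C R, Finset.mul_sum, Finset.sum_mul, ← Finset.sum_sub_distrib, h]
    split_ifs with hpb
    · simp only [Finset.sum_add_distrib, mul_sub, Finset.sum_sub_distrib, ite_mul, mul_ite, zero_mul,
        mul_zero, Finset.sum_neg_distrib, Finset.sum_ite_eq, Finset.sum_ite_eq', Finset.mem_univ,
        if_true]
      abel
    · simp [Finset.sum_add_distrib, ite_mul, mul_ite]
  have h : ∀ b, A p q * ((C * R) i b * B b j) - (C * R) i b * B b j * A p q
      = -((if p = b then (C * R) i q else 0) * B b j)
        + (C * R) i b * (if q = b then B p j else 0) := fun b => by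
    rw [← hb.AB, ← neg_mul, ← hCR]
    noncomm_ring
  simp only [mul_entry _ B, Finset.mul_sum, Finset.sum_mul, ← Finset.sum_sub_distrib, h]
  simp [Finset.sum_add_distrib, ite_mul, mul_ite]

theorem CRB_comm_D (i j l s : κ) :
    (C * R * B) i j * D l s - D l s * (C * R * B) i j
      = (if l = j then (C * R * B) i s else 0) - (if i = s then (C * R * B) l j else 0) := by
  have hCR : ∀ b, D l s * (C * R) i b - (C * R) i b * D l s
      = if s = i then (C * R) l b else 0 := fun b => by
    have h : ∀ a, D l s * (C i a * R a b) - C i a * R a b * D l s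
        = (if s = i then C l a else 0) * R a b := fun a => by
      have e := D_comm_resolvent hb h1 h2 l s a b
      rw [← hb.DC, sub_mul, mul_assoc (C i a) (R a b), ← sub_eq_zero.1 e]
      noncomm_ring
    simp only [mul_entry C R, Finset.mul_sum, Finset.sum_mul, ← Finset.sum_sub_distrib, h]
    split_ifs <;> simp
  have h : ∀ b, (C * R) i b * B b j * D l s - D l s * ((C * R) i b * B b j)
      = (C * R) i b * (if l = j then B b s else 0)
        - (if s = i then (C * R) l b else 0) * B b j := fun b => by
    have e := hb.DB l s b j
    rw [← hCR, ← neg_neg (if l = j then B b s else 0), ← e]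
    noncomm_ring
  simp only [mul_entry _ B, Finset.mul_sum, Finset.sum_mul, ← Finset.sum_sub_distrib, h]
  simp only [eq_comm (a := s)]
  split_ifs <;> simp

omit hb h1 h2 in
/-- The generating series `t_{ij}(x) = δ_{ij} + x D_{ij} + x² (C (1 - x A)⁻¹ B)_{ij}`. -/
def schurSeries (B : Matrix ι κ S) (C : Matrix κ ι S) (D : Matrix κ κ S) (R : Matrix ι ι S) (x : k)
    (i j : κ) : S :=
  (if i = j then 1 else 0) + x • D i j + x • x • (C * R * B) i j

/-- The term -C left over in `CRB_mul_C` cancels against [D, C], and what remains assembles into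
another entry of the same series. -/
theorem schurSeries_mul_C (i j l : κ) (p : ι) :
    schurSeries B C D R x i j * C l p - C l p * schurSeries B C D R x i j
      = x • ((C * R) i p * schurSeries B C D R x l j) := by
  have e1 := CRB_mul_C hb h1 h2 i j l p
  have e2 := hb.DC i j l p
  have e3 : schurSeries B C D R x i j * C l p - C l p * schurSeries B C D R x i j
      = x • (D i j * C l p - C l p * D i j)
        + x • x • ((C * R * B) i j * C l p - C l p * (C * R * B) i j) := by
    simp only [schurSeries, add_mul, mul_add, smul_mul_assoc, mul_smul_comm, smul_sub, ite_mul,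
      mul_ite, one_mul, mul_one, zero_mul, mul_zero]
    abel
  rw [e3, e1, e2, schurSeries]
  simp only [eq_comm (a := l), mul_add]
  split_ifs <;> simp only [mul_one, mul_zero] <;> module

theorem B_mul_schurSeries (q : ι) (i j l : κ) :
    B q l * schurSeries B C D R x i j - schurSeries B C D R x i j * B q l
      = x • (schurSeries B C D R x i l * (R * B) q j) := by
  have e1 := B_mul_CRB hb h1 h2 q i j l
  have e2 := hb.DB i j q l
  have e3 : B q l * schurSeries B C D R x i j - schurSeries B C D R x i j * B q l
      = -(x • (D i j * B q l - B q l * D i j))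
        + x • x • (B q l * (C * R * B) i j - (C * R * B) i j * B q l) := by
    simp only [schurSeries, add_mul, mul_add, smul_mul_assoc, mul_smul_comm, smul_sub, ite_mul,
      mul_ite, one_mul, mul_one, zero_mul, mul_zero]
    abel
  rw [e3, e1, e2, schurSeries]
  simp only [eq_comm (a := l), add_mul]
  split_ifs <;> simp only [one_mul, zero_mul] <;> module

theorem A_comm_schurSeries (p q : ι) (i j : κ) :
    A p q * schurSeries B C D R x i j - schurSeries B C D R x i j * A p q = 0 := by
  have e1 := A_comm_CRB hb h1 h2 p q i j
  have e2 := hb.AD p q i j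
  have e3 : A p q * schurSeries B C D R x i j - schurSeries B C D R x i j * A p q
      = x • (A p q * D i j - D i j * A p q)
        + x • x • (A p q * (C * R * B) i j - (C * R * B) i j * A p q) := by
    simp only [schurSeries, add_mul, mul_add, smul_mul_assoc, mul_smul_comm, smul_sub, ite_mul,
      mul_ite, one_mul, mul_one, zero_mul, mul_zero]
    abel
  rw [e3, e1, e2]
  simp

theorem schurSeries_comm_D (i j l s : κ) :
    schurSeries B C D R x i j * D l s - D l s * schurSeries B C D R x i j
      = (if l = j then schurSeries B C D R x i s else 0)
        - (if i = s then schurSeries B C D R x l j else 0) := by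
  have e1 := CRB_comm_D hb h1 h2 i j l s
  have e2 := hb.DD i j l s
  have e3 : schurSeries B C D R x i j * D l s - D l s * schurSeries B C D R x i j
      = x • (D i j * D l s - D l s * D i j)
        + x • x • ((C * R * B) i j * D l s - D l s * (C * R * B) i j) := by
    simp only [schurSeries, add_mul, mul_add, smul_mul_assoc, mul_smul_comm, smul_sub, ite_mul,
      mul_ite, one_mul, mul_one, zero_mul, mul_zero]
    abel
  rw [e3, e1, e2]
  by_cases hlj : l = j <;> by_cases his : i = s <;> simp [hlj, his, schurSeries] <;> module

theorem schurSeries_comm_resolvent (h3 : (1 - y • A) * Q = 1) (h4 : Q * (1 - y • A) = 1)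
    (i j : κ) (p q : ι) :
    schurSeries B C D R x i j * Q p q = Q p q * schurSeries B C D R x i j := by
  rw [← sub_eq_zero, commutator_resolvent h3 h4]
  have h : ∀ a b, schurSeries B C D R x i j * A a b - A a b * schurSeries B C D R x i j = 0 :=
    fun a b => by rw [← neg_sub, A_comm_schurSeries hb h1 h2, neg_zero]
  simp [h]

/-- Moving t past C and past B gives two sums in which t stands in the middle. Bringing t to the
outside produces the same cubic correction in both, and the two corrections cancel. -/
theorem schurSeries_comm_CQB (h3 : (1 - y • A) * Q = 1) (h4 : Q * (1 - y • A) = 1)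
    (i j l s : κ) :
    schurSeries B C D R x i j * (C * Q * B) l s - (C * Q * B) l s * schurSeries B C D R x i j
      = x • (schurSeries B C D R x l j * (C * (R * Q) * B) i s
        - (C * (R * Q) * B) l j * schurSeries B C D R x i s) := by
  set t : κ → κ → S := schurSeries B C D R x with ht
  have hRQ := resolvent_commute h1 h2 h3 h4
  have tR : ∀ i j p q, t i j * R p q = R p q * t i j :=
    schurSeries_comm_resolvent hb h1 h2 h1 h2
  have tQ : ∀ i j p q, t i j * Q p q = Q p q * t i j :=
    schurSeries_comm_resolvent hb h1 h2 h3 h4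
  have tC : ∀ i j l p, t i j * C l p - C l p * t i j = x • ((C * R) i p * t l j) :=
    schurSeries_mul_C hb h1 h2
  have tB : ∀ q i j l, B q l * t i j - t i j * B q l = x • (t i l * (R * B) q j) :=
    B_mul_schurSeries hb h1 h2
  have tCM : ∀ (M : Matrix ι ι S), (∀ i j p q, t i j * M p q = M p q * t i j) → ∀ i j l b,
      t i j * (C * M) l b - (C * M) l b * t i j = x • ((C * (R * M)) i b * t l j) := by
    intro M hM i j l b
    rw [← Matrix.mul_assoc]
    simp only [mul_entry C M, mul_entry (C * R) M, Finset.mul_sum, Finset.sum_mul,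
      ← Finset.sum_sub_distrib, Finset.smul_sum]
    refine Finset.sum_congr rfl fun a _ => ?_
    rw [mul_assoc (C l a), ← hM, ← mul_assoc, ← mul_assoc, ← sub_mul, tC, mul_assoc _ (M a b), ← hM,
      smul_mul_assoc, mul_assoc]
  have tRQ : ∀ i j p q, t i j * (R * Q) p q = (R * Q) p q * t i j := by
    intro i j p q
    simp only [mul_entry R Q, Finset.mul_sum, Finset.sum_mul]
    refine Finset.sum_congr rfl fun a _ => ?_
    rw [← mul_assoc, tR, mul_assoc, tQ, mul_assoc]
  -- the two contributions of `[t, C]` and `[t, B]`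
  have hfirst : ∑ b, (C * (R * Q)) i b * t l j * B b s
      = t l j * (C * (R * Q) * B) i s
        - x • ∑ b, (C * (R * (R * Q))) l b * t i j * B b s := by
    simp only [mul_entry _ B, Finset.mul_sum, Finset.smul_sum, ← Finset.sum_sub_distrib]
    refine Finset.sum_congr rfl fun b _ => ?_
    rw [← smul_mul_assoc, ← tCM _ tRQ]
    noncomm_ring
  have hsecond : ∑ b, (C * Q) l b * (t i s * (R * B) b j)
      = (C * (R * Q) * B) l j * t i s
        - x • ∑ b, (C * (R * (R * Q))) l b * t i j * B b s := by
    have e1 : ∀ b, t i s * (R * B) b j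
        = (R * B) b j * t i s - x • ∑ a, R b a * t i j * (R * B) a s := fun b => by
      simp only [mul_entry R B b j, Finset.mul_sum, Finset.sum_mul, Finset.smul_sum,
        ← Finset.sum_sub_distrib]
      refine Finset.sum_congr rfl fun a _ => ?_
      rw [mul_assoc (R b a) (t i j), ← mul_smul_comm, ← tB]
      rw [← mul_assoc, tR]
      noncomm_ring
    have e2 : ∑ b, (C * Q) l b * ∑ a, R b a * t i j * (R * B) a s
        = ∑ b, (C * (R * (R * Q))) l b * t i j * B b s := by
      have e3 : C * (R * (R * Q)) = C * Q * R * R := by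
        rw [hRQ, ← mul_assoc, hRQ]; simp only [Matrix.mul_assoc]
      calc ∑ b, (C * Q) l b * ∑ a, R b a * t i j * (R * B) a s
          = ∑ a, (C * Q * R) l a * t i j * (R * B) a s := by
            simp only [mul_entry (C * Q) R, Finset.mul_sum, Finset.sum_mul]
            rw [Finset.sum_comm]
            simp only [mul_assoc]
        _ = ∑ b, (C * Q * R * R) l b * t i j * B b s := by
            simp only [mul_entry (C * Q * R) R, mul_entry R B, Finset.mul_sum, Finset.sum_mul]
            rw [Finset.sum_comm]
            refine Finset.sum_congr rfl fun b _ => Finset.sum_congr rfl fun a _ => ?_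
            rw [mul_assoc _ (t i j), ← mul_assoc (t i j), tR]
            simp only [mul_assoc]
        _ = _ := by rw [e3]
    have e4 : ∑ b, (C * Q) l b * ((R * B) b j * t i s) = (C * (R * Q) * B) l j * t i s := by
      rw [hRQ, ← Matrix.mul_assoc, Matrix.mul_assoc (C * Q), mul_entry (C * Q), Finset.sum_mul]
      simp only [mul_assoc]
    simp only [e1, mul_sub, mul_smul_comm, Finset.sum_sub_distrib, e4, ← Finset.smul_sum, e2]
  have hsum : t i j * (C * Q * B) l s - (C * Q * B) l s * t i j
      = x • ∑ b, (C * (R * Q)) i b * t l j * B b s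
        - x • ∑ b, (C * Q) l b * (t i s * (R * B) b j) := by
    simp only [mul_entry (C * Q) B, Finset.mul_sum, Finset.sum_mul, Finset.smul_sum,
      ← Finset.sum_sub_distrib]
    refine Finset.sum_congr rfl fun b _ => ?_
    rw [← smul_mul_assoc, ← tCM Q tQ, ← mul_smul_comm, ← tB]
    noncomm_ring
  rw [hsum, hfirst, hsecond, smul_sub, smul_sub, smul_sub]
  abel

/-- The Yangian relations for the series `t_{ij}(x)`. -/
theorem schurSeries_relation (h3 : (1 - y • A) * Q = 1) (h4 : Q * (1 - y • A) = 1)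
    (i j l s : κ) :
    (y - x) • (schurSeries B C D R x i j * schurSeries B C D Q y l s
        - schurSeries B C D Q y l s * schurSeries B C D R x i j)
      = (x * y) • (schurSeries B C D R x l j * schurSeries B C D Q y i s
        - schurSeries B C D Q y l j * schurSeries B C D R x i s) := by
  -- The resolvent identity expresses C R Q B through the two series themselves, which closes the
  -- relation.
  have hM : ∀ i j, (x * y * (x - y)) • (C * (R * Q) * B) i j
      = y • schurSeries B C D R x i j - x • schurSeries B C D Q y i j
        + (x - y) • (if i = j then 1 else 0 : S) := by
    intro i j
    have h := resolvent_identity h2 h3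
    rw [mul_smul, ← Matrix.smul_apply, ← Matrix.smul_mul, ← Matrix.mul_smul, h, Matrix.mul_sub,
      Matrix.sub_mul, Matrix.mul_smul, Matrix.mul_smul, Matrix.smul_mul, Matrix.smul_mul,
      Matrix.sub_apply, Matrix.smul_apply, Matrix.smul_apply, schurSeries, schurSeries]
    module
  have e1 := schurSeries_comm_CQB hb h1 h2 h3 h4 i j l s
  have e2 := schurSeries_comm_D hb h1 h2 i j l s
  have e3 : schurSeries B C D R x i j * schurSeries B C D Q y l s
        - schurSeries B C D Q y l s * schurSeries B C D R x i j
      = y • (schurSeries B C D R x i j * D l s - D l s * schurSeries B C D R x i j)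
        + y • y • (schurSeries B C D R x i j * (C * Q * B) l s
          - (C * Q * B) l s * schurSeries B C D R x i j) := by
    rw [schurSeries.eq_1 B C D Q]
    simp only [add_mul, mul_add, smul_mul_assoc, mul_smul_comm, smul_sub, ite_mul,
      mul_ite, one_mul, mul_one, zero_mul, mul_zero]
    abel
  rw [e3, e2, e1]
  have m1 := hM i s
  have m2 := hM l j
  have e4 : (y - x) • y • y • x • (schurSeries B C D R x l j * (C * (R * Q) * B) i s
        - (C * (R * Q) * B) l j * schurSeries B C D R x i s)
      = -(y • (schurSeries B C D R x l j * ((x * y * (x - y)) • (C * (R * Q) * B) i s)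
        - ((x * y * (x - y)) • (C * (R * Q) * B) l j) * schurSeries B C D R x i s)) := by
    simp only [mul_smul_comm, smul_mul_assoc]
    module
  rw [smul_add, e4, m1, m2]
  simp only [mul_add, add_mul, mul_sub, sub_mul, mul_smul_comm, smul_mul_assoc, ite_mul,
      mul_ite, one_mul, mul_one, zero_mul, mul_zero]
  split_ifs <;> module

end Resolvent

end MickelssonZhelobenko

end

noncomputable section

namespace MickelssonZhelobenko

/-! ### From the series to its coefficients, and the super Olshanski homomorphism. -/

section SchurSequence

variable {ι κ U : Type*} [Fintype ι] [DecidableEq ι] [DecidableEq κ] [Ring U]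

/-- The coefficients `δ_{ij}, D_{ij}, (C B)_{ij}, (C A B)_{ij}, (C A² B)_{ij}, …`. -/
def schurSeq (A : Matrix ι ι U) (B : Matrix ι κ U) (C : Matrix κ ι U) (D : Matrix κ κ U)
    (i j : κ) : ℕ → U
  | 0 => if i = j then 1 else 0
  | 1 => D i j
  | r + 2 => (C * A ^ r * B) i j

omit [Fintype ι] in
theorem BlockRelations.map {S : Type*} [Ring S] (f : U →+* S)
    {A : Matrix ι ι U} {B : Matrix ι κ U} {C : Matrix κ ι U} {D : Matrix κ κ U}
    (h : BlockRelations A B C D) :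
    BlockRelations (A.map f) (B.map f) (C.map f) (D.map f) where
  AA p q k l := by simpa [apply_ite f] using congrArg f (h.AA p q k l)
  AB k l p j := by simpa [apply_ite f] using congrArg f (h.AB k l p j)
  AC k l i p := by simpa [apply_ite f] using congrArg f (h.AC k l i p)
  AD k l i j := by simpa [apply_ite f] using congrArg f (h.AD k l i j)
  DB i j k l := by simpa [apply_ite f] using congrArg f (h.DB i j k l)
  DC i j k l := by simpa [apply_ite f] using congrArg f (h.DC i j k l)
  DD i j k l := by simpa [apply_ite f] using congrArg f (h.DD i j k l)
  BC k j i l := by simpa [apply_ite f] using congrArg f (h.BC k j i l)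
  BB k j l i := by simpa [apply_ite f] using congrArg f (h.BB k j l i)
  CC i k j l := by simpa [apply_ite f] using congrArg f (h.CC i k j l)

open PowerSeries

/-- The resolvent identities need parameters x and y in a commutative ring acting on the algebra.
For series over a noncommutative ring the center serves: x is the outer variable and y the inner
one. -/
theorem X_mem_center (S : Type*) [Ring S] : (X : S⟦X⟧) ∈ Subring.center S⟦X⟧ :=
  Subring.mem_center_iff.2 fun g => (X_mul (φ := g)).symm

theorem C_X_mem_center (S : Type*) [Ring S] : (C (X : S⟦X⟧) : S⟦X⟧⟦X⟧) ∈ Subring.center S⟦X⟧⟦X⟧ :=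
  Subring.mem_center_iff.2 fun g => by
    ext1 r
    rw [coeff_mul_C, coeff_C_mul, X_mul]

/-- The series `∑_r c_r x^r` in the outer variable. -/
def outerSeries (c : ℕ → U) : U⟦X⟧⟦X⟧ := mk fun r => C (c r)

/-- The series `∑_s c_s y^s` in the inner variable. -/
def innerSeries (c : ℕ → U) : U⟦X⟧⟦X⟧ := C (mk c)

theorem coeff_outerSeries_mul_innerSeries (c d : ℕ → U) (r s : ℕ) :
    coeff s (coeff r (outerSeries c * innerSeries d)) = c r * d s := by
  simp [outerSeries, innerSeries, coeff_mul_C, coeff_C_mul]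

theorem coeff_innerSeries_mul_outerSeries (c d : ℕ → U) (r s : ℕ) :
    coeff s (coeff r (innerSeries d * outerSeries c)) = d s * c r := by
  simp [outerSeries, innerSeries, coeff_mul_C, coeff_C_mul]

variable (A : Matrix ι ι U) (B : Matrix ι κ U) (C' : Matrix κ ι U) (D : Matrix κ κ U)

/-- The embedding of constants. -/
abbrev constHom (U : Type*) [Ring U] : U →+* U⟦X⟧⟦X⟧ := (C (R := U⟦X⟧)).comp (C (R := U))

theorem outer_mul_geom :
    (1 - (⟨X, X_mem_center _⟩ : Subring.center U⟦X⟧⟦X⟧) • A.map (constHom U))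
      * (Matrix.of fun p q => outerSeries fun r => (A ^ r) p q) = 1 := by
  have h : (⟨X, X_mem_center _⟩ : Subring.center U⟦X⟧⟦X⟧) • (A.map (constHom U)
      * (Matrix.of fun p q => outerSeries fun r => (A ^ r) p q))
      = (Matrix.of fun p q => outerSeries fun r => (A ^ r) p q) - 1 := by
    refine Matrix.ext fun p q => PowerSeries.ext fun r => ?_
    rw [Matrix.smul_apply, Subring.smul_def, smul_eq_mul, Matrix.sub_apply, map_sub]
    rcases r with _ | r
    · by_cases hpq : p = q <;> simp [outerSeries, Matrix.one_apply, hpq]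
    · rw [coeff_succ_X_mul]
      by_cases hpq : p = q <;>
        simp [outerSeries, Matrix.one_apply, hpq, Matrix.mul_apply, pow_succ', coeff_one,
          coeff_C_mul]
  rw [sub_mul, one_mul, smul_mul_assoc, h, sub_sub_cancel]

theorem geom_mul_outer :
    (Matrix.of fun p q => outerSeries fun r => (A ^ r) p q) *
    (1 - (⟨X, X_mem_center _⟩ : Subring.center U⟦X⟧⟦X⟧) • A.map (constHom U)) = 1 := by
  have h : (⟨X, X_mem_center _⟩ : Subring.center U⟦X⟧⟦X⟧) •
      ((Matrix.of fun p q => outerSeries fun r => (A ^ r) p q) * A.map (constHom U))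
      = (Matrix.of fun p q => outerSeries fun r => (A ^ r) p q) - 1 := by
    refine Matrix.ext fun p q => PowerSeries.ext fun r => ?_
    rw [Matrix.smul_apply, Subring.smul_def, smul_eq_mul, Matrix.sub_apply, map_sub]
    rcases r with _ | r
    · by_cases hpq : p = q <;> simp [outerSeries, Matrix.one_apply, hpq]
    · rw [coeff_succ_X_mul]
      by_cases hpq : p = q <;>
        simp [outerSeries, Matrix.one_apply, hpq, Matrix.mul_apply, pow_succ, coeff_one,
          coeff_mul_C]
  rw [mul_sub, mul_one, mul_smul_comm, h, sub_sub_cancel]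

theorem inner_mul_geom :
    (1 - (⟨C X, C_X_mem_center _⟩ : Subring.center U⟦X⟧⟦X⟧) • A.map (constHom U))
      * (Matrix.of fun p q => innerSeries fun r => (A ^ r) p q) = 1 := by
  have h : (⟨C X, C_X_mem_center _⟩ : Subring.center U⟦X⟧⟦X⟧) • (A.map (constHom U)
      * (Matrix.of fun p q => innerSeries fun r => (A ^ r) p q))
      = (Matrix.of fun p q => innerSeries fun r => (A ^ r) p q) - 1 := by
    refine Matrix.ext fun p q => ?_
    rw [Matrix.smul_apply, Subring.smul_def, smul_eq_mul, Matrix.sub_apply, Matrix.one_apply,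
      show (if p = q then 1 else 0 : U⟦X⟧⟦X⟧) = C (if p = q then 1 else 0) by split_ifs <;> simp]
    simp only [Matrix.mul_apply, Matrix.map_apply, Matrix.of_apply, constHom, RingHom.comp_apply,
      innerSeries, ← map_mul, ← map_sum, ← map_sub]
    congr 1
    ext r
    rcases r with _ | r
    · by_cases hpq : p = q <;> simp [Matrix.one_apply, hpq]
    · rw [coeff_succ_X_mul]
      by_cases hpq : p = q <;>
        simp [hpq, Matrix.mul_apply, pow_succ', coeff_one, coeff_C_mul]
  rw [sub_mul, one_mul, smul_mul_assoc, h, sub_sub_cancel]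

theorem geom_mul_inner :
    (Matrix.of fun p q => innerSeries fun r => (A ^ r) p q) *
    (1 - (⟨C X, C_X_mem_center _⟩ : Subring.center U⟦X⟧⟦X⟧) • A.map (constHom U)) = 1 := by
  have h : (⟨C X, C_X_mem_center _⟩ : Subring.center U⟦X⟧⟦X⟧) •
      ((Matrix.of fun p q => innerSeries fun r => (A ^ r) p q) * A.map (constHom U))
      = (Matrix.of fun p q => innerSeries fun r => (A ^ r) p q) - 1 := by
    refine Matrix.ext fun p q => ?_
    rw [Matrix.smul_apply, Subring.smul_def, smul_eq_mul, Matrix.sub_apply, Matrix.one_apply,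
      show (if p = q then 1 else 0 : U⟦X⟧⟦X⟧) = C (if p = q then 1 else 0) by split_ifs <;> simp]
    simp only [Matrix.mul_apply, Matrix.map_apply, Matrix.of_apply, constHom, RingHom.comp_apply,
      innerSeries, ← map_mul, ← map_sum, ← map_sub]
    congr 1
    ext r
    rcases r with _ | r
    · by_cases hpq : p = q <;> simp [Matrix.one_apply, hpq]
    · rw [coeff_succ_X_mul]
      by_cases hpq : p = q <;>
        simp [hpq, Matrix.mul_apply, pow_succ, coeff_one, coeff_mul_C]
  rw [mul_sub, mul_one, mul_smul_comm, h, sub_sub_cancel]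

theorem schurSeries_outer (i j : κ) :
    schurSeries (B.map (constHom U)) (C'.map (constHom U)) (D.map (constHom U))
      (Matrix.of fun p q => outerSeries fun r => (A ^ r) p q)
      (⟨X, X_mem_center _⟩ : Subring.center U⟦X⟧⟦X⟧) i j
      = outerSeries (schurSeq A B C' D i j) := by
  ext1 r
  simp only [schurSeries, Subring.smul_def, smul_eq_mul, map_add]
  rcases r with _ | _ | r
  · by_cases hij : i = j <;> simp [outerSeries, schurSeq, hij]
  · rw [coeff_succ_X_mul, coeff_succ_X_mul]
    have : coeff 1 (if i = j then 1 else 0 : U⟦X⟧⟦X⟧) = 0 := by split_ifs <;> simp [coeff_one]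
    simp [outerSeries, schurSeq, this]
  · rw [coeff_succ_X_mul, coeff_succ_X_mul, coeff_succ_X_mul]
    have : coeff (r + 1 + 1) (if i = j then 1 else 0 : U⟦X⟧⟦X⟧) = 0 := by
      split_ifs <;> simp [coeff_one]
    simp [outerSeries, schurSeq, this, Matrix.mul_apply, coeff_mul_C, coeff_C_mul]

theorem schurSeries_inner (i j : κ) :
    schurSeries (B.map (constHom U)) (C'.map (constHom U)) (D.map (constHom U))
      (Matrix.of fun p q => innerSeries fun r => (A ^ r) p q)
      (⟨C X, C_X_mem_center _⟩ : Subring.center U⟦X⟧⟦X⟧) i j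
      = innerSeries (schurSeq A B C' D i j) := by
  have h : ∀ f g : U⟦X⟧, f = g → C f = C g := fun f g h => by rw [h]
  have h1 : (if i = j then 1 else 0 : U⟦X⟧⟦X⟧) = C (if i = j then 1 else 0) := by
    split_ifs <;> simp
  simp only [schurSeries, Subring.smul_def, smul_eq_mul, h1, Matrix.mul_apply, Matrix.map_apply,
    Matrix.of_apply, constHom, RingHom.comp_apply, innerSeries, ← map_mul, ← map_sum, ← map_add]
  refine h _ _ ?_
  ext1 r
  rw [map_add, map_add]
  rcases r with _ | _ | r
  · by_cases hij : i = j <;> simp [schurSeq, hij]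
  · rw [coeff_succ_X_mul, coeff_succ_X_mul]
    have : coeff 1 (if i = j then 1 else 0 : U⟦X⟧) = 0 := by split_ifs <;> simp [coeff_one]
    simp [schurSeq, this]
  · rw [coeff_succ_X_mul, coeff_succ_X_mul, coeff_succ_X_mul]
    have : coeff (r + 1 + 1) (if i = j then 1 else 0 : U⟦X⟧) = 0 := by
      split_ifs <;> simp [coeff_one]
    simp [schurSeq, this, Matrix.mul_apply, coeff_mul_C, coeff_C_mul]

variable {A B C' D}

theorem schurSeq_relation (hb : BlockRelations A B C' D) (i j l p : κ) (r s : ℕ) :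
    (schurSeq A B C' D i j (r + 1) * schurSeq A B C' D l p s
        - schurSeq A B C' D l p s * schurSeq A B C' D i j (r + 1))
      - (schurSeq A B C' D i j r * schurSeq A B C' D l p (s + 1)
        - schurSeq A B C' D l p (s + 1) * schurSeq A B C' D i j r)
      = schurSeq A B C' D l j r * schurSeq A B C' D i p s
        - schurSeq A B C' D l j s * schurSeq A B C' D i p r := by
  have h := schurSeries_relation (hb.map (constHom U)) (outer_mul_geom A) (geom_mul_outer A)
    (inner_mul_geom A) (geom_mul_inner A) i j l p
  simp only [schurSeries_outer, schurSeries_inner] at h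
  -- In the coefficient of x^(r+1) y^(s+1), the factors y, x and xy lower the indices to (r+1, s),
  -- (r, s+1) and (r, s).
  have h' := congrArg (fun f => coeff (s + 1) (coeff (r + 1) f)) h
  simp only [sub_smul, mul_smul, Subring.smul_def, smul_eq_mul, map_sub, mul_sub, 
    coeff_succ_X_mul, coeff_C_mul, coeff_outerSeries_mul_innerSeries,
    coeff_innerSeries_mul_outerSeries] at h'
  rw [← h']

theorem A_comm_schurSeq (hb : BlockRelations A B C' D) (p q : ι) (i j : κ) (r : ℕ) :
    A p q * schurSeq A B C' D i j r = schurSeq A B C' D i j r * A p q := by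
  have h := A_comm_schurSeries (hb.map (constHom U)) (outer_mul_geom A) (geom_mul_outer A) p q i j
  rw [schurSeries_outer] at h
  have h' := congrArg (fun f => coeff 0 (coeff r f)) h
  simp only [map_sub, Matrix.map_apply, constHom, RingHom.comp_apply, coeff_C_mul, coeff_mul_C,
    outerSeries, coeff_mk, coeff_zero_C, map_zero] at h'
  exact sub_eq_zero.1 h'

end SchurSequence

/-- The generating matrix of `U(gl(m|n))` satisfies the block relations. -/
theorem UGl.blockRelations (m n : ℕ) : BlockRelations
    (Matrix.of fun k l : Fin m => (UGl.E (Sum.inl k) (Sum.inl l) : UGl m n))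
    (Matrix.of fun (k : Fin m) (j : Fin n) => (UGl.E (Sum.inl k) (Sum.inr j) : UGl m n))
    (Matrix.of fun (i : Fin n) (l : Fin m) => (UGl.E (Sum.inr i) (Sum.inl l) : UGl m n))
    (Matrix.of fun i j : Fin n => (UGl.E (Sum.inr i) (Sum.inr j) : UGl m n)) where
  AA p q k l := by
    simpa [superSign, par] using UGl.comm (m := m) (n := n) (.inl p) (.inl q) (.inl k) (.inl l)
  AB k l p j := by
    simpa [superSign, par, eq_comm (a := p)] using
      UGl.comm (m := m) (n := n) (.inl k) (.inl l) (.inl p) (.inr j)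
  AC k l i p := by
    simpa [superSign, par, eq_comm (a := p)] using
      UGl.comm (m := m) (n := n) (.inl k) (.inl l) (.inr i) (.inl p)
  AD k l i j := by
    simpa [superSign, par] using UGl.comm (m := m) (n := n) (.inl k) (.inl l) (.inr i) (.inr j)
  DB i j k l := by
    simpa [superSign, par] using UGl.comm (m := m) (n := n) (.inr i) (.inr j) (.inl k) (.inr l)
  DC i j k l := by
    simpa [superSign, par, eq_comm (a := j)] using
      UGl.comm (m := m) (n := n) (.inr i) (.inr j) (.inr k) (.inl l)
  DD i j k l := by
    have h : (-1 : ℂ) ^ 4 = 1 := by norm_num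
    simpa [superSign, par, h] using UGl.comm (m := m) (n := n) (.inr i) (.inr j) (.inr k) (.inr l)
  BC k j i l := by
    have h := UGl.comm (m := m) (n := n) (.inl k) (.inr j) (.inr i) (.inl l)
    simp only [superSign, par, zero_add, add_zero, mul_one, pow_one, neg_smul, one_smul,
      sub_neg_eq_add, Sum.inl.injEq, Sum.inr.injEq, eq_comm (a := i)] at h
    exact h
  BB k j l i := by
    simpa [superSign, par] using UGl.comm (m := m) (n := n) (.inl k) (.inr j) (.inl l) (.inr i)
  CC i k j l := by
    simpa [superSign, par] using UGl.comm (m := m) (n := n) (.inr i) (.inl k) (.inr j) (.inl l)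

/-- The elements `∑ E_{m+i,k} (E^{r-2})_{kl} E_{l,m+j}` of `U(gl(m|n))`. -/
def olshanskiT (m n : ℕ) (i j : Fin n) (r : ℕ) : UGl m n :=
  schurSeq (Matrix.of fun k l : Fin m => (UGl.E (Sum.inl k) (Sum.inl l) : UGl m n))
    (Matrix.of fun (k : Fin m) (j : Fin n) => (UGl.E (Sum.inl k) (Sum.inr j) : UGl m n))
    (Matrix.of fun (i : Fin n) (l : Fin m) => (UGl.E (Sum.inr i) (Sum.inl l) : UGl m n))
    (Matrix.of fun i j : Fin n => (UGl.E (Sum.inr i) (Sum.inr j) : UGl m n)) i j r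

theorem olshanskiT_mem (m n : ℕ) (i j : Fin n) (r : ℕ) :
    olshanskiT m n i j r ∈ glCentralizer m n := by
  rw [glCentralizer, Subalgebra.mem_centralizer_iff]
  rintro _ ⟨k, l, rfl⟩
  exact A_comm_schurSeq (UGl.blockRelations m n) k l i j r

/-- The super Olshanski homomorphism. -/
def olshanskiHom (m n : ℕ) : Yangian n →ₐ[ℂ] glCentralizer m n :=
  Yangian.lift (fun i j r => ⟨olshanskiT m n i j r, olshanskiT_mem m n i j r⟩)
    (fun i j => Subtype.ext (by
      change olshanskiT m n i j 0 = ((if i = j then 1 else 0 : glCentralizer m n) : UGl m n)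
      simp only [olshanskiT, schurSeq]
      split_ifs <;> rfl))
    (fun i j k l r s => Subtype.ext (schurSeq_relation (UGl.blockRelations m n) i j k l r s))

theorem coe_olshanskiHom_t (m n : ℕ) (i j : Fin n) (r : ℕ) :
    (olshanskiHom m n (Yangian.t i j r) : UGl m n) = olshanskiT m n i j r :=
  congrArg Subtype.val (Yangian.lift_t _ _ _ i j r)

theorem olshanskiT_one (m n : ℕ) (i j : Fin n) :
    olshanskiT m n i j 1 = UGl.E (Sum.inr i) (Sum.inr j) := rfl

theorem olshanskiT_add_two (m n : ℕ) (i j : Fin n) (r : ℕ) :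
    olshanskiT m n i j (r + 2) = ∑ k : Fin m, ∑ l : Fin m,
      UGl.E (Sum.inr i) (Sum.inl k)
        * ((Matrix.of fun k l : Fin m =>
            (UGl.E (Sum.inl k) (Sum.inl l) : UGl m n)) ^ r) k l
        * UGl.E (Sum.inl l) (Sum.inr j) := by
  simp only [olshanskiT, schurSeq, Matrix.mul_apply, Matrix.of_apply, Finset.sum_mul]
  exact Finset.sum_comm

end MickelssonZhelobenko

end

noncomputable section

namespace MickelssonZhelobenko

/-! ### U'/J as a left module over U' and a right vector space over R(h). -/

/-- The quotient `U'(gl(m|n)) / J`. -/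
abbrev UModJ (m n : ℕ) : Type := UExt m n ⧸ UExt.J m n

/-- The element `E_{ij}` of `gl(m)` in `U'(gl(m|n))`. -/
abbrev UExt.e {m n : ℕ} (i j : Fin m) : UExt m n := UExt.E (Sum.inl i) (Sum.inl j)

namespace UModJ

open UExt

variable {m n : ℕ}

/-- Right multiplication by an element of the normalizer. -/
def rmul (z : normJ m n) : UModJ m n →ₗ[UExt m n] UModJ m n :=
  (J m n).liftQ (LinearMap.toSpanSingleton (UExt m n) (UModJ m n) (Submodule.Quotient.mk z.1))
    fun y hy => (Submodule.Quotient.mk_eq_zero _).2 (z.2 y hy)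

theorem rmul_mk (z : normJ m n) (x : UExt m n) :
    rmul z (Submodule.Quotient.mk x) = Submodule.Quotient.mk (x * z.1) := rfl

/-- The field `R(h)` acts on `U'(gl(m|n)) / J` by right multiplication. -/
instance : Module (CartanField m) (UModJ m n) where
  smul f v := rmul ⟨UExt.ofCartan m n f, ofCartan_mem_normJ f⟩ v
  one_smul v := by
    obtain ⟨x, rfl⟩ := Submodule.Quotient.mk_surjective _ v
    change Submodule.Quotient.mk (x * UExt.ofCartan m n 1) = _
    rw [map_one, mul_one]
  mul_smul f g v := by
    obtain ⟨x, rfl⟩ := Submodule.Quotient.mk_surjective _ v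
    change Submodule.Quotient.mk (x * UExt.ofCartan m n (f * g))
      = Submodule.Quotient.mk (x * UExt.ofCartan m n g * UExt.ofCartan m n f)
    rw [mul_comm f g, map_mul, mul_assoc]
  smul_zero f := map_zero _
  smul_add f := map_add _
  add_smul f g v := by
    obtain ⟨x, rfl⟩ := Submodule.Quotient.mk_surjective _ v
    change Submodule.Quotient.mk (x * UExt.ofCartan m n (f + g))
      = Submodule.Quotient.mk (x * UExt.ofCartan m n f + x * UExt.ofCartan m n g)
    rw [map_add, mul_add]
  zero_smul v := by
    obtain ⟨x, rfl⟩ := Submodule.Quotient.mk_surjective _ v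
    change Submodule.Quotient.mk (x * UExt.ofCartan m n 0) = _
    rw [map_zero, mul_zero]
    rfl

theorem smul_mk (f : CartanField m) (x : UExt m n) :
    f • (Submodule.Quotient.mk x : UModJ m n)
      = Submodule.Quotient.mk (x * UExt.ofCartan m n f) := rfl

instance : SMulCommClass (UExt m n) (CartanField m) (UModJ m n) where
  smul_comm x f v := ((rmul ⟨UExt.ofCartan m n f, ofCartan_mem_normJ f⟩).map_smul x v).symm

instance : SMulCommClass (CartanField m) (UExt m n) (UModJ m n) := SMulCommClass.symm _ _ _

/-- Left multiplication, as a homomorphism to the `R(h)`-linear endomorphisms. -/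
def lmul : UExt m n →+* Module.End (CartanField m) (UModJ m n) :=
  Module.toModuleEnd (CartanField m) (UModJ m n)

theorem lmul_apply (x : UExt m n) (v : UModJ m n) : lmul x v = x • v := rfl

/-- The image of `1` in `U'(gl(m|n)) / J`. -/
def vac (m n : ℕ) : UModJ m n := Submodule.Quotient.mk 1

theorem smul_vac (x : UExt m n) : x • vac m n = Submodule.Quotient.mk x := by
  rw [vac, ← Submodule.Quotient.mk_smul, smul_eq_mul, mul_one]

theorem exists_smul_vac (v : UModJ m n) : ∃ x : UExt m n, v = x • vac m n := by
  obtain ⟨x, rfl⟩ := Submodule.Quotient.mk_surjective _ v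
  exact ⟨x, (smul_vac x).symm⟩

theorem ofCartan_smul_vac (f : CartanField m) :
    UExt.ofCartan m n f • vac m n = f • vac m n := by
  rw [smul_vac, vac, smul_mk, one_mul]

theorem e_smul_vac {i j : Fin m} (h : i < j) : (e i j : UExt m n) • vac m n = 0 := by
  rw [smul_vac]
  exact (Submodule.Quotient.mk_eq_zero _).2 (E_mem_J h)

end UModJ

namespace UExt

variable {m n : ℕ}

theorem e_mul_e (i j k l : Fin m) : (e i j * e k l : UExt m n)
    = e k l * e i j + ((if j = k then e i l else 0) - (if i = l then e k j else 0)) := by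
  have h := comm (m := m) (n := n) (.inl i) (.inl j) (.inl k) (.inl l)
  simp only [superSign, par, mul_zero, add_zero, pow_zero, one_smul, Sum.inl.injEq,
    eq_comm (a := k)] at h
  rw [← h]; abel

theorem e_mul_E_inl (p q k : Fin m) (b : Fin n) :
    (e p q * E (.inl k) (.inr b) : UExt m n)
      = E (.inl k) (.inr b) * e p q + if q = k then E (.inl p) (.inr b) else 0 := by
  have h := comm (m := m) (n := n) (.inl p) (.inl q) (.inl k) (.inr b)
  simp only [superSign, par, add_zero, zero_mul, pow_zero, one_smul, Sum.inl.injEq,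
    eq_comm (a := k), reduceCtorEq, if_false, sub_zero] at h
  rw [← h]; abel

theorem e_mul_E_inr (p q k : Fin m) (a : Fin n) :
    (e p q * E (.inr a) (.inl k) : UExt m n)
      = E (.inr a) (.inl k) * e p q - if p = k then E (.inr a) (.inl q) else 0 := by
  have h := comm (m := m) (n := n) (.inl p) (.inl q) (.inr a) (.inl k)
  simp only [superSign, par, add_zero, zero_mul, pow_zero, one_smul, Sum.inl.injEq,
    reduceCtorEq, if_false, zero_sub] at h
  rw [eq_add_of_sub_eq h]; abel

theorem e_mul_E (i j : Fin m) (k l : Idx m n) : (e i j * E k l : UExt m n)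
    = E k l * e i j + ((if Sum.inl j = k then E (.inl i) l else 0)
      - (if Sum.inl i = l then E k (.inl j) else 0)) := by
  have h := comm (m := m) (n := n) (.inl i) (.inl j) k l
  simp only [superSign, par, add_zero, zero_mul, pow_zero, one_smul,
    eq_comm (a := k)] at h
  rw [← h]; abel

/-- The element g is f shifted by the weight of E_{kl}. Only its existence matters where a vanishing
statement has to be moved past a Cartan element. -/
theorem exists_e_mul_ofCartan (k l : Fin m) (f : CartanField m) :
    ∃ g, (e k l * ofCartan m n f : UExt m n) = ofCartan m n g * e k l := by
  obtain ⟨p, q, hq, rfl⟩ := IsFractionRing.div_surjective (A := MvPolynomial (Fin m) ℂ) f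
  have hinj := IsFractionRing.injective (MvPolynomial (Fin m) ℂ) (CartanField m)
  have hq0 : q ≠ 0 := nonZeroDivisors.ne_zero hq
  have hs : shift k l 1 q ≠ 0 := fun h0 => hq0 (by rw [← shift_shift k l q, h0, map_zero])
  have hs' : algebraMap _ (CartanField m) (shift k l 1 q) ≠ 0 := fun h0 =>
    hs (hinj (by rw [h0, map_zero]))
  have hq' : algebraMap _ (CartanField m) q ≠ 0 := fun h0 => hq0 (hinj (by rw [h0, map_zero]))
  refine ⟨algebraMap _ _ (shift k l 1 p) * (algebraMap _ _ (shift k l 1 q))⁻¹, ?_⟩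
  have key : (e k l : UExt m n) * ofCartan m n (algebraMap _ _ q)⁻¹
      = ofCartan m n (algebraMap _ _ (shift k l 1 q))⁻¹ * e k l := by
    calc (e k l : UExt m n) * ofCartan m n (algebraMap _ _ q)⁻¹
        = ofCartan m n ((algebraMap _ _ (shift k l 1 q))⁻¹ * algebraMap _ _ (shift k l 1 q))
            * (e k l * ofCartan m n (algebraMap _ _ q)⁻¹) := by
          rw [inv_mul_cancel₀ hs', map_one, one_mul]
      _ = ofCartan m n (algebraMap _ _ (shift k l 1 q))⁻¹
            * (ofCartan m n (algebraMap _ _ (shift k l 1 q)) * e k l)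
            * ofCartan m n (algebraMap _ _ q)⁻¹ := by
          rw [map_mul]; simp only [mul_assoc]
      _ = ofCartan m n (algebraMap _ _ (shift k l 1 q))⁻¹ * e k l
            * ofCartan m n (algebraMap _ _ q * (algebraMap _ _ q)⁻¹) := by
          rw [← E_mul_poly, map_mul]; simp only [mul_assoc]
      _ = _ := by rw [mul_inv_cancel₀ hq', map_one, mul_one]
  rw [div_eq_mul_inv, map_mul, ← mul_assoc, E_mul_poly, mul_assoc, key, map_mul, mul_assoc]

theorem exists_e_pow_mul_ofCartan (k l : Fin m) (f : CartanField m) (N : ℕ) :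
    ∃ g, (e k l ^ N * ofCartan m n f : UExt m n) = ofCartan m n g * e k l ^ N := by
  induction N with
  | zero => exact ⟨f, by simp⟩
  | succ N ih =>
    obtain ⟨g, hg⟩ := ih
    obtain ⟨g', hg'⟩ := exists_e_mul_ofCartan (n := n) k l g
    exact ⟨g', by rw [pow_succ', mul_assoc, hg, ← mul_assoc, hg', mul_assoc]⟩

/-- A Cartan element that passes through `x` with a shift can be inverted. -/
theorem mul_ofCartan_inv {x : UExt m n} {f g : CartanField m} (hf : f ≠ 0) (hg : g ≠ 0)
    (h : x * ofCartan m n f = ofCartan m n g * x) :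
    x * ofCartan m n f⁻¹ = ofCartan m n g⁻¹ * x := by
  calc x * ofCartan m n f⁻¹ = ofCartan m n (g⁻¹ * g) * (x * ofCartan m n f⁻¹) := by
        rw [inv_mul_cancel₀ hg, map_one, one_mul]
    _ = ofCartan m n g⁻¹ * (x * ofCartan m n f) * ofCartan m n f⁻¹ := by
        rw [h, map_mul]; simp only [mul_assoc]
    _ = ofCartan m n g⁻¹ * x * ofCartan m n (f * f⁻¹) := by
        rw [map_mul]; simp only [mul_assoc]
    _ = _ := by rw [mul_inv_cancel₀ hf, map_one, mul_one]

/-- Induction on the elements of `U'(gl(m|n))`. -/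
theorem induction_on {P : UExt m n → Prop} (x : UExt m n) (hE : ∀ k l, P (E k l))
    (hC : ∀ f, P (ofCartan m n f)) (hadd : ∀ x y, P x → P y → P (x + y))
    (hmul : ∀ x y, P x → P y → P (x * y)) : P x := by
  obtain ⟨y, rfl⟩ := RingQuot.mkAlgHom_surjective ℂ (ExtRel m n) x
  change P (mk m n y)
  induction y using FreeAlgebra.induction with
  | grade0 r =>
    have := hC (algebraMap ℂ _ r)
    rwa [AlgHom.commutes, ← AlgHom.commutes (mk m n)] at this
  | grade1 z =>
    rcases z with ⟨k, l⟩ | f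
    · exact hE k l
    · exact hC f
  | mul a b ha hb => rw [map_mul]; exact hmul _ _ ha hb
  | add a b ha hb => rw [map_add]; exact hadd _ _ ha hb

end UExt

section CartanField

variable {m : ℕ}

/-- If this linear polynomial were zero, its values c at the origin and 1 + c at the i-th unit
vector would both vanish. -/
theorem cartanE_sub_add_ne_zero {i j : Fin m} (h : i ≠ j) (c : ℤ) :
    cartanE i - cartanE j + (c : CartanField m) ≠ 0 := by
  intro h0
  have h1 : algebraMap (MvPolynomial (Fin m) ℂ) (CartanField m)
      (MvPolynomial.X i - MvPolynomial.X j + (c : MvPolynomial (Fin m) ℂ)) = 0 := by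
    rw [map_add, map_sub, map_intCast]; exact h0
  have h2 := IsFractionRing.injective (MvPolynomial (Fin m) ℂ) (CartanField m)
    (h1.trans (map_zero _).symm)
  have h3 := congrArg (MvPolynomial.eval (0 : Fin m → ℂ)) h2
  have h4 := congrArg (MvPolynomial.eval (Pi.single i 1 : Fin m → ℂ)) h2
  simp [h.symm] at h3 h4
  simp [h3] at h4

theorem cartanH_sub_add_ne_zero {i j : Fin m} (h : i ≠ j) (c : ℤ) :
    cartanH i - cartanH j + (c : CartanField m) ≠ 0 := by
  have := cartanE_sub_add_ne_zero h (c - i + j)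
  intro h0
  apply this
  rw [← h0, cartanH, cartanH]
  push_cast
  ring

theorem cartanH_sub_ne_zero {i j : Fin m} (h : i ≠ j) : cartanH i - cartanH j ≠ 0 := by
  simpa using cartanH_sub_add_ne_zero h 0

theorem cartanH_injective : Function.Injective (cartanH (m := m)) := fun i j h => by
  by_contra hij
  exact cartanH_sub_ne_zero hij (sub_eq_zero.2 h)

instance : CharZero (CartanField m) :=
  charZero_of_injective_algebraMap (algebraMap ℂ (CartanField m)).injective

end CartanField

end MickelssonZhelobenko

end

noncomputable section

namespace MickelssonZhelobenko

/-! ### Weights of root vectors and the root projectors. -/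

namespace UExt

variable {m n : ℕ}

theorem e_mul_ofCartan_cartanE (k l i : Fin m) :
    (e k l * ofCartan m n (cartanE i) : UExt m n)
      = ofCartan m n (cartanE i + (((if i = l then 1 else 0) - (if i = k then 1 else 0) : ℤ) :
          CartanField m)) * e k l := by
  rw [E_mul_cartanE, map_add]
  congr 2
  rw [map_intCast]
  push_cast
  split_ifs <;> simp

/-- The weight of `E_{kl}` with respect to `h_i - h_j`. -/
def rootWeight (k l i j : Fin m) : ℤ :=
  ((if i = l then 1 else 0) - (if i = k then 1 else 0))
    - ((if j = l then 1 else 0) - (if j = k then 1 else 0))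

theorem e_mul_ofCartan_cartanH (k l i j : Fin m) (c : ℤ) :
    (e k l * ofCartan m n (cartanH i - cartanH j + c) : UExt m n)
      = ofCartan m n (cartanH i - cartanH j + ((c + rootWeight k l i j : ℤ) : CartanField m))
        * e k l := by
  have h1 := e_mul_ofCartan_cartanE (n := n) k l i
  have h2 := e_mul_ofCartan_cartanE (n := n) k l j
  have e1 : (cartanH i - cartanH j + c : CartanField m)
      = cartanE i - cartanE j + ((c - i + j : ℤ) : CartanField m) := by
    simp only [cartanH]; push_cast; ring
  have e2 : (cartanH i - cartanH j + ((c + rootWeight k l i j : ℤ) : CartanField m))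
      = (cartanE i + (((if i = l then 1 else 0) - (if i = k then 1 else 0) : ℤ) : CartanField m))
        - (cartanE j + (((if j = l then 1 else 0) - (if j = k then 1 else 0) : ℤ) : CartanField m))
        + ((c - i + j : ℤ) : CartanField m) := by
    simp only [cartanH, rootWeight]; push_cast; ring
  have h3 : (e k l * ofCartan m n ((c - i + j : ℤ) : CartanField m) : UExt m n)
      = ofCartan m n ((c - i + j : ℤ) : CartanField m) * e k l := by
    rw [map_intCast, (Int.cast_commute _ _).eq]
  rw [e1, e2, map_add, map_sub, map_add (ofCartan m n) (_ - _), map_sub (ofCartan m n) (_ + _),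
    mul_add, mul_sub, h1, h2, h3]
  noncomm_ring

theorem e_mul_ofCartan_cartanH_inv {i j : Fin m} (hij : i ≠ j) (k l : Fin m) (c : ℤ) :
    (e k l * ofCartan m n (cartanH i - cartanH j + c)⁻¹ : UExt m n)
      = ofCartan m n (cartanH i - cartanH j + ((c + rootWeight k l i j : ℤ) : CartanField m))⁻¹
        * e k l :=
  mul_ofCartan_inv (cartanH_sub_add_ne_zero hij _) (cartanH_sub_add_ne_zero hij _)
    (e_mul_ofCartan_cartanH k l i j c)

theorem e_sub_e (i j : Fin m) : (e i i - e j j : UExt m n)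
    = ofCartan m n (cartanH i - cartanH j + ((i - j : ℤ) : CartanField m)) := by
  rw [e, e, ← ofCartan_cartanE, ← ofCartan_cartanE, ← map_sub]
  congr 1
  simp only [cartanH]; push_cast; ring

end UExt

open UExt

variable {m n : ℕ}

namespace UModJ

/-! ### Local nilpotency -/

/-- `E_{ij}` acts nilpotently on `v`. -/
def LocNil (i j : Fin m) (v : UModJ m n) : Prop := ∃ N : ℕ, (e i j ^ N : UExt m n) • v = 0

theorem LocNil.add {i j : Fin m} {v w : UModJ m n} (hv : LocNil i j v) (hw : LocNil i j w) :
    LocNil i j (v + w) := by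
  obtain ⟨N, hN⟩ := hv
  obtain ⟨M, hM⟩ := hw
  refine ⟨N + M, ?_⟩
  rw [smul_add, pow_add, mul_smul, mul_smul, hM, smul_zero, add_zero, ← mul_smul, ← pow_add,
    add_comm, pow_add, mul_smul, hN, smul_zero]

theorem LocNil.of_e_smul {i j : Fin m} {v : UModJ m n} (h : LocNil i j ((e i j : UExt m n) • v)) :
    LocNil i j v := by
  obtain ⟨N, hN⟩ := h
  exact ⟨N + 1, by rw [pow_succ, mul_smul, hN]⟩

theorem LocNil.e_smul {i j : Fin m} {v : UModJ m n} (h : LocNil i j v) :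
    LocNil i j ((e i j : UExt m n) • v) := by
  obtain ⟨N, hN⟩ := h
  exact ⟨N, by rw [← mul_smul, ← pow_succ, pow_succ', mul_smul, hN, smul_zero]⟩

/-- If the commutator of `E_{ij}` and `x` preserves local nilpotency, so does `x`. -/
theorem LocNil.smul_of_commutator {i j : Fin m} {x y : UExt m n} (hxy : e i j * x = x * e i j + y)
    (hy : ∀ v : UModJ m n, LocNil i j v → LocNil i j (y • v)) (v : UModJ m n) (hv : LocNil i j v) :
    LocNil i j (x • v) := by
  obtain ⟨N, hN⟩ := hv
  induction N generalizing v with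
  | zero => exact ⟨0, by simp_all⟩
  | succ N ih =>
    refine LocNil.of_e_smul ?_
    rw [← mul_smul, hxy, add_smul, mul_smul]
    refine (ih _ ?_).add (hy v ⟨_, hN⟩)
    rw [← mul_smul, ← pow_succ, hN]

theorem LocNil.zero (i j : Fin m) : LocNil i j (0 : UModJ m n) := ⟨0, smul_zero _⟩

theorem LocNil.neg {i j : Fin m} {v : UModJ m n} (hv : LocNil i j v) : LocNil i j (-v) := by
  obtain ⟨N, hN⟩ := hv
  exact ⟨N, by rw [smul_neg, hN, neg_zero]⟩

theorem LocNil.sub {i j : Fin m} {v w : UModJ m n} (hv : LocNil i j v) (hw : LocNil i j w) :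
    LocNil i j (v - w) := sub_eq_add_neg v w ▸ hv.add hw.neg

/-- Bracketing three times with E_{ij} kills every E_{kl}. The elements E_{il} and E_{kj} come
first, as their brackets with E_{ij} are 0 or ±E_{ij}; the bracket with a general E_{kl} involves
only these. -/
theorem LocNil.E_smul {i j : Fin m} (hij : i ≠ j) (k l : Idx m n) (v : UModJ m n)
    (hv : LocNil i j v) : LocNil i j ((E k l : UExt m n) • v) := by
  have h1 : ∀ (l : Idx m n) (v : UModJ m n), LocNil i j v →
      LocNil i j ((E (.inl i) l : UExt m n) • v) := fun l =>
    LocNil.smul_of_commutator (e_mul_E i j (.inl i) l) fun v hv => by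
      simp only [Sum.inl.injEq, hij.symm, if_false, zero_sub, neg_smul]
      split_ifs
      · exact hv.e_smul.neg
      · simpa using LocNil.zero i j
  have h2 : ∀ (k : Idx m n) (v : UModJ m n), LocNil i j v →
      LocNil i j ((E k (.inl j) : UExt m n) • v) := fun k =>
    LocNil.smul_of_commutator (e_mul_E i j k (.inl j)) fun v hv => by
      simp only [Sum.inl.injEq, hij, if_false, sub_zero]
      split_ifs
      · exact hv.e_smul
      · simpa using LocNil.zero i j
  refine LocNil.smul_of_commutator (e_mul_E i j k l) (fun v hv => ?_) v hv
  rw [sub_smul]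
  refine LocNil.sub ?_ ?_
  · split_ifs
    · exact h1 l v hv
    · simpa using LocNil.zero i j
  · split_ifs
    · exact h2 k v hv
    · simpa using LocNil.zero i j

/-- The class of 1 is killed by E_{ij}, and every element of U' preserves local nilpotency. This
makes the series in the root projectors finite. -/
theorem locNil {i j : Fin m} (hij : i < j) (v : UModJ m n) : LocNil i j v := by
  obtain ⟨x, rfl⟩ := exists_smul_vac v
  have h : ∀ v : UModJ m n, LocNil i j v → LocNil i j (x • v) := by
    refine UExt.induction_on (P := fun x => ∀ v : UModJ m n, LocNil i j v → LocNil i j (x • v)) x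
      (fun k l v => LocNil.E_smul hij.ne k l v) (fun f v hv => ?_)
      (fun x y hx hy v hv => ?_) (fun x y hx hy v hv => ?_)
    · obtain ⟨N, hN⟩ := hv
      obtain ⟨g, hg⟩ := exists_e_pow_mul_ofCartan (n := n) i j f N
      exact ⟨N, by rw [← mul_smul, hg, mul_smul, hN, smul_zero]⟩
    · rw [add_smul]; exact (hx v hv).add (hy v hv)
    · rw [mul_smul]; exact hx _ (hy v hv)
  exact h _ ⟨1, by rw [pow_one, e_smul_vac hij]⟩

/-! ### The root projectors -/

/-- The coefficient of `E_{ji}^k E_{ij}^k` in the root projector. -/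
def rootCoeff (i j : Fin m) (k : ℕ) : CartanField m :=
  (-1) ^ k / ((k.factorial : CartanField m)
    * ∏ s ∈ Finset.Icc 1 k, (cartanH i - cartanH j + (s : CartanField m)))

theorem rootProjector_def (i j : Fin m) (v : UModJ m n) : rootProjector i j v
    = ∑ᶠ k : ℕ, (e j i ^ k * e i j ^ k * UExt.ofCartan m n (rootCoeff i j k) : UExt m n) • v := rfl

theorem rootTerm_eq_zero {i j : Fin m} {N : ℕ} {v : UModJ m n}
    (hN : (e i j ^ N : UExt m n) • v = 0) (f : CartanField m) {k : ℕ} (hk : N ≤ k) :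
    (e j i ^ k * e i j ^ k * UExt.ofCartan m n f : UExt m n) • v = 0 := by
  obtain ⟨g, hg⟩ := exists_e_pow_mul_ofCartan (n := n) i j f k
  rw [mul_assoc, hg, mul_smul, mul_smul, ← Nat.sub_add_cancel hk, pow_add (e i j), mul_smul, hN]
  simp only [smul_zero]

theorem rootProjector_hasFiniteSupport {i j : Fin m} (hij : i < j) (v : UModJ m n) :
    (Function.support fun k : ℕ =>
      (e j i ^ k * e i j ^ k * UExt.ofCartan m n (rootCoeff i j k) : UExt m n) • v).Finite := by
  obtain ⟨N, hN⟩ := locNil hij v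
  refine (Finset.range N).finite_toSet.subset fun k hk => ?_
  by_contra h
  exact hk (rootTerm_eq_zero hN _ (by simpa using h))

/-- The root projectors commute with the additive maps that commute with the elements of weight
zero by which they are defined. -/
theorem rootProjector_map {i j : Fin m} (hij : i < j) (φ : UModJ m n →+ UModJ m n)
    (hφ : ∀ (k : ℕ) (f : CartanField m) (v : UModJ m n),
      φ ((e j i ^ k * e i j ^ k * UExt.ofCartan m n f : UExt m n) • v)
        = (e j i ^ k * e i j ^ k * UExt.ofCartan m n f : UExt m n) • φ v) (v : UModJ m n) :
    rootProjector i j (φ v) = φ (rootProjector i j v) := by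
  rw [rootProjector_def, rootProjector_def, φ.map_finsum (rootProjector_hasFiniteSupport hij v)]
  exact finsum_congr fun k => (hφ k _ v).symm

/-- Only the terms k = 0 and k = 1 survive. -/
theorem rootProjector_of_sq_eq_zero {i j : Fin m} {v : UModJ m n}
    (h : (e i j : UExt m n) • (e i j : UExt m n) • v = 0) :
    rootProjector i j v = v - (e j i * e i j
      * UExt.ofCartan m n (cartanH i - cartanH j + 1)⁻¹ : UExt m n) • v := by
  have h2 : (e i j ^ 2 : UExt m n) • v = 0 := by rw [pow_two, mul_smul, h]
  rw [rootProjector_def, finsum_eq_sum_of_support_subset (s := Finset.range 2)]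
  · simp only [Finset.sum_range_succ, Finset.range_zero, Finset.sum_empty, zero_add, pow_zero,
      mul_one, one_mul, pow_one, sub_eq_add_neg]
    congr 1
    · simp [rootCoeff]
    · rw [← neg_smul, ← mul_neg, ← map_neg]
      congr 3
      simp only [rootCoeff, pow_one, Nat.factorial_one, Nat.cast_one, Finset.Icc_self,
        Finset.prod_singleton, one_mul, sub_eq_add_neg]
      rw [div_eq_mul_inv, neg_one_mul]
  · intro k hk
    by_contra h'
    exact hk (rootTerm_eq_zero h2 _ (by simp at h'; omega))

theorem rootProjector_of_eq_zero {i j : Fin m} {v : UModJ m n}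
    (h : (e i j : UExt m n) • v = 0) : rootProjector i j v = v := by
  obtain ⟨g, hg⟩ := exists_e_mul_ofCartan (n := n) i j (cartanH i - cartanH j + 1)⁻¹
  rw [rootProjector_of_sq_eq_zero (by rw [h, smul_zero]), mul_assoc, hg, mul_smul, mul_smul, h]
  simp

end UModJ

end MickelssonZhelobenko

end

noncomputable section

namespace MickelssonZhelobenko

open UExt

variable {m n : ℕ}

namespace UModJ

/-! ### Vectors on which the root vectors `E_{dq}` act with square zero -/

/-- The products `E_{dq} E_{dr}` with `q, r > d` annihilate `v`. -/
def SqZero (d : Fin m) (v : UModJ m n) : Prop :=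
  ∀ q r, d < q → d < r → (e d q : UExt m n) • (e d r : UExt m n) • v = 0

theorem SqZero.add {d : Fin m} {v w : UModJ m n} (hv : SqZero d v) (hw : SqZero d w) :
    SqZero d (v + w) := fun q r hq hr => by
  rw [smul_add, smul_add, hv q r hq hr, hw q r hq hr, add_zero]

theorem SqZero.sub {d : Fin m} {v w : UModJ m n} (hv : SqZero d v) (hw : SqZero d w) :
    SqZero d (v - w) := fun q r hq hr => by
  rw [smul_sub, smul_sub, hv q r hq hr, hw q r hq hr, sub_zero]

theorem SqZero.zero (d : Fin m) : SqZero d (0 : UModJ m n) := fun q r _ _ => by simp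

theorem SqZero.ofCartan_smul {d : Fin m} {v : UModJ m n} (hv : SqZero d v) (f : CartanField m) :
    SqZero d (UExt.ofCartan m n f • v) := fun q r hq hr => by
  obtain ⟨g, hg⟩ := exists_e_mul_ofCartan (n := n) d r f
  obtain ⟨g', hg'⟩ := exists_e_mul_ofCartan (n := n) d q g
  rw [← mul_smul (e d r), hg, mul_smul, ← mul_smul (e d q), hg', mul_smul, hv q r hq hr, smul_zero]

theorem e_smul_e_smul (i j k l : Fin m) (v : UModJ m n) :
    (e i j : UExt m n) • (e k l : UExt m n) • v
      = (e k l : UExt m n) • (e i j : UExt m n) • v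
        + ((if j = k then (e i l : UExt m n) • v else 0)
          - (if i = l then (e k j : UExt m n) • v else 0)) := by
  rw [← mul_smul, e_mul_e, add_smul, mul_smul, sub_smul]
  congr 2 <;> split_ifs <;> simp

/-- The bracket of E_{dr} with E_{st} is E_{dt} or 0, again a root vector of row d, so the condition
is stable under the root vectors of later rows. -/
theorem SqZero.e_smul {d s t : Fin m} {v : UModJ m n} (hv : SqZero d v) (hs : d < s) (ht : d < t) :
    SqZero d ((e s t : UExt m n) • v) := fun q r hq hr => by
  rw [e_smul_e_smul d r s t, if_neg ht.ne, sub_zero, smul_add, e_smul_e_smul d q s t, hv q r hq hr,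
    if_neg ht.ne]
  by_cases h1 : q = s <;> by_cases h2 : r = s <;> simp [h1, h2, hv _ _ hs ht, hv _ _ ht hs,
    hv _ _ ht hr, hv _ _ hq ht]

theorem SqZero.pow_smul {d s t : Fin m} {v : UModJ m n} (hv : SqZero d v) (hs : d < s) (ht : d < t)
    (k : ℕ) : SqZero d ((e s t ^ k : UExt m n) • v) := by
  induction k with
  | zero => simpa using hv
  | succ k ih => rw [pow_succ', mul_smul]; exact ih.e_smul hs ht

theorem SqZero.rootProjector {d i j : Fin m} {v : UModJ m n} (hv : SqZero d v) (hi : d < i)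
    (hj : d < j) : SqZero d (rootProjector i j v) :=
  finsum_induction (SqZero d) (SqZero.zero d) (fun _ _ hx hy => hx.add hy) fun k => by
    rw [mul_smul, mul_smul]
    exact ((hv.ofCartan_smul _).pow_smul hi hj k).pow_smul hj hi k

/-- The row vectors `E_{dq}` still act with square zero after `E_{qd} E_{dq}`. -/
theorem SqZero.e_smul_e_smul {d t : Fin m} {v : UModJ m n} (hv : SqZero d v) (ht : d < t) :
    SqZero d ((e t d : UExt m n) • (e d t : UExt m n) • v) := fun q r hq hr => by
  have h1 : ∀ s r, d < s → d < r → (e d s : UExt m n) • (e r d : UExt m n) • (e d t : UExt m n) • v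
      = (if s = r then (e d d : UExt m n) • (e d t : UExt m n) • v else 0)
        - (e r s : UExt m n) • (e d t : UExt m n) • v := fun s r hs hr => by
    rw [UModJ.e_smul_e_smul d s r d, hv s t hs ht, smul_zero, zero_add, if_pos rfl]
  rw [h1 r t hr ht, smul_sub, UModJ.e_smul_e_smul d q t r, hv q t hq ht, if_neg hr.ne]
  by_cases h2 : q = t <;> by_cases h3 : r = t
  · simp [h2, h3, UModJ.e_smul_e_smul d t d d, hv t t ht ht, ht.ne']
  · simp [h2, h3, hv r t hr ht]
  · simp [h2, h3, UModJ.e_smul_e_smul d q d d, hv q t hq ht, hq.ne']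
  · simp [h2, h3]

theorem SqZero.row_rootProjector {d t : Fin m} {v : UModJ m n} (hv : SqZero d v) (ht : d < t) :
    SqZero d (MickelssonZhelobenko.rootProjector d t v) := by
  rw [rootProjector_of_sq_eq_zero (hv t t ht ht), mul_smul, mul_smul]
  exact hv.sub ((hv.ofCartan_smul _).e_smul_e_smul ht)

/-- Moving the denominator to the left of E_{dj} changes h_d - h_j by the weight -2, so +1 becomes
-1. -/
theorem rootProjector_eq_of_sqZero {d j : Fin m} {y : UModJ m n} (hy : SqZero d y) (hj : d < j) :
    rootProjector d j y = y - (e j d : UExt m n)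
      • UExt.ofCartan m n (cartanH d - cartanH j - 1)⁻¹ • (e d j : UExt m n) • y := by
  rw [rootProjector_of_sq_eq_zero (hy j j hj hj), mul_assoc]
  have h := e_mul_ofCartan_cartanH_inv (n := n) hj.ne d j 1
  have hw : (1 + rootWeight d j d j : ℤ) = -1 := by simp [rootWeight, hj.ne, hj.ne']
  rw [hw] at h
  push_cast at h
  rw [h, mul_smul, mul_smul, ← sub_eq_add_neg]

/-- The simple root vector annihilates the image of its own root projector. -/
theorem e_smul_rootProjector_self {d j : Fin m} {y : UModJ m n} (hy : SqZero d y)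
    (hj : (j : ℕ) = d + 1) : (e d j : UExt m n) • rootProjector d j y = 0 := by
  have hdj : d < j := by rw [Fin.lt_def]; omega
  rw [rootProjector_eq_of_sqZero hy hdj, smul_sub]
  set q := UExt.ofCartan m n (cartanH d - cartanH j - 1)⁻¹ • (e d j : UExt m n) • y with hq
  have hdq : (e d j : UExt m n) • q = 0 := by
    obtain ⟨g, hg⟩ := exists_e_mul_ofCartan (n := n) d j (cartanH d - cartanH j - 1)⁻¹
    rw [hq, ← mul_smul, hg, mul_smul, hy j j hdj hdj, smul_zero]
  have hne := cartanH_sub_add_ne_zero hdj.ne (-1)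
  push_cast at hne
  rw [← sub_eq_add_neg] at hne
  have hyq : (e d j : UExt m n) • y = UExt.ofCartan m n (cartanH d - cartanH j - 1) • q := by
    rw [hq, ← mul_smul, ← map_mul, mul_inv_cancel₀ hne, map_one, one_smul]
  have h : (e d j : UExt m n) • (e j d : UExt m n) • q
      = (e d d - e j j : UExt m n) • q := by
    rw [UModJ.e_smul_e_smul d j j d, hdq, smul_zero, zero_add, if_pos rfl, if_pos rfl, sub_smul]
  -- For adjacent indices E_{dd} - E_{jj} is h_d - h_j - 1, precisely the inverted denominator.
  rw [h, hyq, e_sub_e, hj, ← sub_smul, ← map_sub]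
  push_cast
  ring_nf
  simp

/-- The rank two relation: if `E_{jk}` with `k = j + 1` annihilates `y`, it annihilates
`p_{dj} p_{dk} y`. -/
theorem e_smul_rootProjector_rootProjector {d j k : Fin m} {y : UModJ m n} (hy : SqZero d y)
    (hdj : d < j) (hk : (k : ℕ) = j + 1) (he : (e j k : UExt m n) • y = 0) :
    (e j k : UExt m n) • rootProjector d j (rootProjector d k y) = 0 := by
  have hjk : j < k := by rw [Fin.lt_def]; omega
  have hdk := hdj.trans hjk
  have hy1 := hy.row_rootProjector hdk
  rw [rootProjector_eq_of_sqZero hy1 hdj, rootProjector_eq_of_sqZero hy hdk]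
  set q := UExt.ofCartan m n (cartanH d - cartanH k - 1)⁻¹ • (e d k : UExt m n) • y with hq
  have haq : (e d j : UExt m n) • q = 0 := by
    obtain ⟨g, hg⟩ := exists_e_mul_ofCartan (n := n) d j (cartanH d - cartanH k - 1)⁻¹
    rw [hq, ← mul_smul, hg, mul_smul, hy j k hdj hdk, smul_zero]
  have heq : (e j k : UExt m n) • q = 0 := by
    obtain ⟨g, hg⟩ := exists_e_mul_ofCartan (n := n) j k (cartanH d - cartanH k - 1)⁻¹
    rw [hq, ← mul_smul, hg, mul_smul, UModJ.e_smul_e_smul j k d k, he, if_neg hdk.ne',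
      if_neg hjk.ne]
    simp
  have hne := cartanH_sub_add_ne_zero hdk.ne (-1)
  push_cast at hne
  rw [← sub_eq_add_neg] at hne
  have hyq : (e d k : UExt m n) • y = UExt.ofCartan m n (cartanH d - cartanH k - 1) • q := by
    rw [hq, ← mul_smul, ← map_mul, mul_inv_cancel₀ hne, map_one, one_smul]
  -- `E_{dj}` and `E_{jk}` applied to `p_{dk} y`
  have ha1 : (e d j : UExt m n) • (y - (e k d : UExt m n) • q)
      = (e d j : UExt m n) • y + (e k j : UExt m n) • q := by
    rw [smul_sub, UModJ.e_smul_e_smul d j k d, haq, if_neg hjk.ne, if_pos rfl]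
    simp
  have he1 : (e j k : UExt m n) • (y - (e k d : UExt m n) • q) = -((e j d : UExt m n) • q) := by
    rw [smul_sub, he, UModJ.e_smul_e_smul j k k d, heq, if_pos rfl, if_neg hdj.ne']
    simp
  have he2 : (e j k : UExt m n) • ((e d j : UExt m n) • y + (e k j : UExt m n) • q)
      = (e j j - e k k : UExt m n) • q - (e d k : UExt m n) • y := by
    rw [smul_add, UModJ.e_smul_e_smul j k d j, UModJ.e_smul_e_smul j k k j, he, heq,
      if_neg hdk.ne', if_pos rfl, if_pos rfl, sub_smul]
    simp only [smul_zero, zero_add, zero_sub]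
    abel
  have hcart := e_mul_ofCartan_cartanH_inv (n := n) hdj.ne j k (-1)
  -- E_{jk} raises h_d - h_j by one, so the denominator h_d - h_j - 1 becomes h_d - h_j.
  have hw : (-1 + rootWeight j k d j : ℤ) = 0 := by
    simp [rootWeight, hdk.ne, hdj.ne, hjk.ne]
  rw [hw] at hcart
  push_cast at hcart
  rw [← sub_eq_add_neg, add_zero] at hcart
  rw [ha1, smul_sub, he1, UModJ.e_smul_e_smul j k j d, if_neg hjk.ne', if_neg hdj.ne', sub_zero,
    add_zero, ← mul_smul (e j k) (UExt.ofCartan m n _), hcart, mul_smul, he2, hyq, e_sub_e,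
    ← sub_smul, ← map_sub, ← mul_smul (UExt.ofCartan m n _), ← map_mul, hk]
  -- Here k = j + 1 is used: the numerator telescopes to -(h_d - h_j), and the remaining two copies
  -- of E_{jd} q cancel.
  have hs : (cartanH d - cartanH j)⁻¹ * (cartanH j - cartanH k + ((j - (j + 1 : ℕ) : ℤ) : CartanField m)
      - (cartanH d - cartanH k - 1)) = -1 := by
    have h0 := cartanH_sub_ne_zero hdj.ne
    have : (cartanH j - cartanH k + ((j - (j + 1 : ℕ) : ℤ) : CartanField m)
      - (cartanH d - cartanH k - 1)) = -(cartanH d - cartanH j) := by push_cast; ring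
    rw [this, mul_neg, inv_mul_cancel₀ h0]
  rw [hs]
  simp

/-- With q different from j and k, the vector E_{jk} commutes with both E_{dq} and E_{qd}. -/
theorem e_smul_rootProjector_of_commute {d j k q : Fin m} {y : UModJ m n} (hy : SqZero d y)
    (hdj : d < j) (hjk : j < k) (hdq : d < q) (hqj : q ≠ j) (hqk : q ≠ k)
    (he : (e j k : UExt m n) • y = 0) : (e j k : UExt m n) • rootProjector d q y = 0 := by
  obtain ⟨g, hg⟩ := exists_e_mul_ofCartan (n := n) j k (cartanH d - cartanH q - 1)⁻¹
  rw [rootProjector_eq_of_sqZero hy hdq, smul_sub, he, UModJ.e_smul_e_smul j k q d,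
    ← mul_smul (e j k) (UExt.ofCartan m n _), hg, mul_smul, UModJ.e_smul_e_smul j k d q, he]
  simp [hqj.symm, hqk.symm, hdj.ne', (hdj.trans hjk).ne']

/-! ### The extremal projector, row by row -/

theorem filter_le_finRange (m j : ℕ) :
    (List.finRange m).filter (fun q : Fin m => decide (j ≤ (q : ℕ))) = (List.finRange m).drop j := by
  induction m generalizing j with
  | zero => simp
  | succ m ih =>
    rw [List.finRange_succ]
    cases j with
    | zero => simp
    | succ j =>
      rw [List.filter_cons_of_neg (by simp), List.drop_succ_cons, ← List.map_drop, ← ih,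
        List.filter_map]
      congr 2
      funext q
      simp [Function.comp]

theorem drop_finRange {m j : ℕ} (h : j < m) :
    (List.finRange m).drop j = ⟨j, h⟩ :: (List.finRange m).drop (j + 1) := by
  rw [List.drop_eq_getElem_cons (by simpa using h)]
  simp

/-- The product `p_{d,j} p_{d,j+1} ⋯ p_{d,m}` (with `j` counted from zero). -/
def rowFrom (d : Fin m) (j : ℕ) (v : UModJ m n) : UModJ m n :=
  ((List.finRange m).drop j).foldr (fun q w => rootProjector d q w) v

/-- The product of the rows of the extremal projector from the row `j` on. -/
def rowsFrom (j : ℕ) (v : UModJ m n) : UModJ m n :=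
  ((List.finRange m).drop j).foldr (fun d w => rowFrom d (d + 1) w) v

theorem extremalProjector_eq_rowsFrom (v : UModJ m n) : extremalProjector v = rowsFrom 0 v := by
  have h : ∀ l : List (Fin m), ((l.product (List.finRange m)).filter fun ij => ij.1 < ij.2).foldr
      (fun ij w => rootProjector ij.1 ij.2 w) v = l.foldr (fun d w => rowFrom d (d + 1) w) v := by
    intro l
    induction l with
    | nil => rfl
    | cons d l ih =>
      rw [show (d :: l).product (List.finRange m) = (List.finRange m).map (fun q => (d, q))
          ++ l.product (List.finRange m) from rfl, List.filter_append, List.foldr_append, ih, List.foldr_cons,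
        List.filter_map, List.foldr_map, rowFrom, ← filter_le_finRange]
      rfl
  exact h _

theorem rowFrom_of_lt (d : Fin m) {j : ℕ} (h : j < m) (v : UModJ m n) :
    rowFrom d j v = rootProjector d ⟨j, h⟩ (rowFrom d (j + 1) v) := by
  rw [rowFrom, drop_finRange h]; rfl

theorem rowFrom_of_le (d : Fin m) {j : ℕ} (h : m ≤ j) (v : UModJ m n) : rowFrom d j v = v := by
  rw [rowFrom, List.drop_of_length_le (by simpa using h)]; rfl

theorem rowsFrom_of_lt {j : ℕ} (h : j < m) (v : UModJ m n) :
    rowsFrom j v = rowFrom ⟨j, h⟩ (j + 1) (rowsFrom (j + 1) v) := by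
  rw [rowsFrom, drop_finRange h]; rfl

theorem rowsFrom_of_le {j : ℕ} (h : m ≤ j) (v : UModJ m n) : rowsFrom j v = v := by
  rw [rowsFrom, List.drop_of_length_le (by simpa using h)]; rfl

theorem sqZero_rowFrom_self {d : Fin m} {v : UModJ m n} (hv : SqZero d v) {j : ℕ} (hj : d < j) :
    SqZero d (rowFrom d j v) := by
  induction hk : m - j generalizing j with
  | zero => rwa [rowFrom_of_le d (by omega)]
  | succ k ih =>
    rw [rowFrom_of_lt d (by omega : j < m)]
    exact (ih (by omega) (by omega)).row_rootProjector (by rw [Fin.lt_def]; exact hj)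

theorem sqZero_rowFrom {d i : Fin m} {v : UModJ m n} (hv : SqZero d v) (hdi : d < i) {j : ℕ}
    (hj : i < j) : SqZero d (rowFrom i j v) := by
  induction hk : m - j generalizing j with
  | zero => rwa [rowFrom_of_le i (by omega)]
  | succ k ih =>
    rw [rowFrom_of_lt i (by omega : j < m)]
    exact (ih (by omega) (by omega)).rootProjector hdi
      (by rw [Fin.lt_def] at hdi ⊢; simp only; omega)

/-- The vector `v` is annihilated by the simple root vectors `E_{p,p+1}` with `p ≥ j`. -/
def SimpleKill (j : ℕ) (v : UModJ m n) : Prop :=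
  ∀ p q : Fin m, (q : ℕ) = p + 1 → j ≤ p → (e p q : UExt m n) • v = 0

/-- The excluded case p + 1 = j is the one in which the partial row contains the factor p_{d,p+1}
without its partner p_{d,p}; the rank two relation needs both. -/
theorem e_smul_rowFrom {d : Fin m} {v : UModJ m n} (hv : SqZero d v) (hs : SimpleKill (d + 1) v)
    (j : ℕ) (hj : d < j) (p q : Fin m) (hpq : (q : ℕ) = p + 1) (hp : d < p)
    (hne : (p : ℕ) + 1 ≠ j) : (e p q : UExt m n) • rowFrom d j v = 0 := by
  induction hk : m - j using Nat.strong_induction_on generalizing j p q with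
  | _ k ih =>
    by_cases hjm : j < m
    · by_cases hpj : (p : ℕ) = j
      -- The factors p_{d,j} and p_{d,j+1} are treated together, so the induction jumps to j + 2.
      · have hjm' : j + 1 < m := by omega
        have hp' : p = ⟨j, hjm⟩ := Fin.ext hpj
        have hq' : q = ⟨j + 1, hjm'⟩ := Fin.ext (by simp only; omega)
        rw [rowFrom_of_lt d hjm, rowFrom_of_lt d hjm', hp', hq']
        refine e_smul_rootProjector_rootProjector (sqZero_rowFrom_self hv (by omega))
          (by rw [Fin.lt_def]; exact hj) rfl ?_
        exact ih (m - (j + 1 + 1)) (by omega) _ (by omega) _ _ rfl (by rw [Fin.lt_def]; exact hj)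
          (by simp only; omega) rfl
      · rw [rowFrom_of_lt d hjm]
        refine e_smul_rootProjector_of_commute (sqZero_rowFrom_self hv (by omega)) hp
          (by rw [Fin.lt_def]; omega) (by rw [Fin.lt_def]; exact hj)
          (fun h => hpj (by rw [← h])) (fun h => hne (by rw [← hpq, ← h])) ?_
        exact ih (m - (j + 1)) (by omega) _ (by omega) _ _ hpq hp (by omega) rfl
    · rw [rowFrom_of_le d (by omega)]
      exact hs p q hpq hp

theorem simpleKill_rowFrom {d : Fin m} {v : UModJ m n} (hv : SqZero d v)
    (hs : SimpleKill (d + 1) v) : SimpleKill d (rowFrom d (d + 1) v) := by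
  intro p q hpq hp
  rcases hp.eq_or_lt with h | h
  · have hdp : d = p := Fin.ext h
    subst hdp
    have hm : (d : ℕ) + 1 < m := by omega
    have hq : q = ⟨d + 1, hm⟩ := Fin.ext hpq
    rw [rowFrom_of_lt d hm, hq]
    exact e_smul_rootProjector_self (sqZero_rowFrom_self hv (by omega)) rfl
  · exact e_smul_rowFrom hv hs (d + 1) (by omega) p q hpq h (by omega)

/-- The second conjunct carries the square-zero property for the rows still to be applied; without
it their factors would not truncate. -/
theorem simpleKill_rowsFrom {v : UModJ m n} (hv : ∀ d, SqZero d v) (j : ℕ) :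
    SimpleKill j (rowsFrom j v) ∧ ∀ d : Fin m, d < j → SqZero d (rowsFrom j v) := by
  induction hk : m - j generalizing j with
  | zero =>
    refine ⟨fun p q hpq hp => by omega, fun d _ => ?_⟩
    rw [rowsFrom_of_le (by omega)]
    exact hv d
  | succ k ih =>
    have hj : j < m := by omega
    obtain ⟨h1, h2⟩ := ih (j + 1) (by omega)
    rw [rowsFrom_of_lt hj]
    exact ⟨simpleKill_rowFrom (h2 ⟨j, hj⟩ (Nat.lt_succ_self j)) h1, fun d hd => sqZero_rowFrom (h2 d (by omega))
      (by rw [Fin.lt_def]; exact hd) (by simp)⟩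

/-- `v` is annihilated by the raising root vectors. -/
def Singular (v : UModJ m n) : Prop := ∀ p q : Fin m, p < q → (e p q : UExt m n) • v = 0

/-- E_{pq} is the bracket of E_{p,q-1} and the simple root vector E_{q-1,q}. -/
theorem SimpleKill.singular {v : UModJ m n} (hv : SimpleKill 0 v) : Singular v := by
  intro p q hpq
  induction hk : (q : ℕ) - p - 1 generalizing q with
  | zero => exact hv p q (by rw [Fin.lt_def] at hpq; omega) (Nat.zero_le _)
  | succ k ih =>
    rw [Fin.lt_def] at hpq
    have hr : (q : ℕ) - 1 < m := by omega
    have h1 := ih ⟨q - 1, hr⟩ (by rw [Fin.lt_def]; simp only; omega) (by simp only; omega)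
    have h2 := hv ⟨q - 1, hr⟩ q (by simp only; omega) (Nat.zero_le _)
    have h3 := UModJ.e_smul_e_smul p ⟨q - 1, hr⟩ ⟨q - 1, hr⟩ q v
    rw [h1, h2, if_pos rfl, if_neg (fun h => by rw [h] at hpq; exact lt_irrefl _ hpq)] at h3
    simpa using h3.symm

/-- The extremal projector produces a singular vector. -/
theorem singular_extremalProjector {v : UModJ m n} (hv : ∀ d, SqZero d v) :
    Singular (extremalProjector v) := by
  rw [extremalProjector_eq_rowsFrom]
  exact (simpleKill_rowsFrom hv 0).1.singular

theorem mem_positiveRoots {ij : Fin m × Fin m} (h : ij ∈ positiveRoots m) : ij.1 < ij.2 := by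
  simpa using (List.mem_filter.1 h).2

theorem extremalProjector_of_singular {v : UModJ m n} (hv : Singular v) :
    extremalProjector v = v := by
  have h : ∀ l : List (Fin m × Fin m), (∀ ij ∈ l, ij.1 < ij.2) →
      l.foldr (fun ij w => rootProjector ij.1 ij.2 w) v = v := by
    intro l hl
    induction l with
    | nil => rfl
    | cons ij l ih =>
      rw [List.foldr_cons, ih fun x hx => hl x (List.mem_cons_of_mem _ hx)]
      exact rootProjector_of_eq_zero (hv _ _ (hl ij List.mem_cons_self))
  exact h _ fun ij => mem_positiveRoots

theorem extremalProjector_map (φ : UModJ m n →+ UModJ m n)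
    (hφ : ∀ (i j : Fin m) (k : ℕ) (f : CartanField m) (v : UModJ m n),
      φ ((e j i ^ k * e i j ^ k * UExt.ofCartan m n f : UExt m n) • v)
        = (e j i ^ k * e i j ^ k * UExt.ofCartan m n f : UExt m n) • φ v) (v : UModJ m n) :
    extremalProjector (φ v) = φ (extremalProjector v) := by
  have h : ∀ l : List (Fin m × Fin m), (∀ ij ∈ l, ij.1 < ij.2) →
      l.foldr (fun ij w => rootProjector ij.1 ij.2 w) (φ v)
        = φ (l.foldr (fun ij w => rootProjector ij.1 ij.2 w) v) := by
    intro l hl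
    induction l with
    | nil => rfl
    | cons ij l ih =>
      rw [List.foldr_cons, ih fun x hx => hl x (List.mem_cons_of_mem _ hx), List.foldr_cons]
      exact rootProjector_map (hl ij List.mem_cons_self) φ (hφ _ _) _
  exact h _ fun ij => mem_positiveRoots

end UModJ

end MickelssonZhelobenko

end

noncomputable section

namespace MickelssonZhelobenko

open Polynomial

/-! ### Triangular operators -/

section Triangular

variable {R M : Type*} [Field R] [AddCommGroup M] [Module R M]

theorem commute_aeval {T X : Module.End R M} (h : Commute X T) (g : R[X]) :
    Commute X (aeval T g) := by
  induction g using Polynomial.induction_on' with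
  | add p q hp hq => rw [map_add]; exact hp.add_right hq
  | monomial k c =>
    rw [aeval_monomial]
    exact (show Commute X (algebraMap R _ c) from (Algebra.commutes c X).symm).mul_right
      (h.pow_right k)

/-- If `T` is triangular on the vectors `u k` with diagonal entries `α k`, then a polynomial in `T`
that vanishes at the diagonal entries below `k` annihilates `u k`. -/
theorem aeval_eq_zero_of_triangular {ι : Type*} {T : Module.End R M} {r : ι → ι → Prop}
    (hr : WellFounded r) (htrans : ∀ i j k, r i j → r j k → r i k) {α : ι → R}
    (hα : Function.Injective α) {u : ι → M} (S : ι → Finset ι) (hS : ∀ k, ∀ q ∈ S k, r q k)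
    (X' : ι → ι → Module.End R M) (hX : ∀ k q, Commute (X' k q) T)
    (hT : ∀ k, T (u k) = α k • u k + ∑ q ∈ S k, X' k q (u q)) (k : ι) (g : R[X])
    (hk : g.eval (α k) = 0) (hg : ∀ q, r q k → g.eval (α q) = 0) : aeval T g (u k) = 0 := by
  induction k using hr.induction generalizing g with
  | _ k ih =>
    obtain ⟨g', rfl⟩ := dvd_iff_isRoot.2 hk
    -- One factor of g absorbs the diagonal term. The quotient g' still vanishes at the lower
    -- diagonal entries, as these differ from α k, so induction applies to each u q.
    have h1 : aeval T ((X - C (α k)) * g') (u k) = aeval T g' (T (u k) - α k • u k) := by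
      rw [mul_comm, map_mul, Module.End.mul_apply, map_sub, aeval_X, aeval_C]
      rfl
    have h0 : ∀ q, r q k → g'.eval (α q) = 0 := fun q hq => by
      have h := hg q hq
      rw [eval_mul, eval_sub, eval_X, eval_C] at h
      refine (mul_eq_zero.1 h).resolve_left fun h' => ?_
      have := hα (sub_eq_zero.1 h')
      subst this
      exact hr.asymmetric _ _ hq hq
    rw [h1, hT, add_sub_cancel_left, map_sum]
    refine Finset.sum_eq_zero fun q hq => ?_
    have hc := congrArg (fun F : Module.End R M => F (u q)) (commute_aeval (hX k q) g').eq
    simp only [Module.End.mul_apply] at hc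
    rw [← hc, ih q (hS k q hq) g' (h0 q (hS k q hq)) fun q' hq' =>
      h0 q' (htrans _ _ _ hq' (hS k q hq)), map_zero]

theorem aeval_apply_of_eigen {T : Module.End R M} {a : R} {v : M} (h : T v = a • v) (g : R[X]) :
    aeval T g v = g.eval a • v := by
  induction g using Polynomial.induction_on' with
  | add p q hp hq => rw [map_add, LinearMap.add_apply, hp, hq, eval_add, add_smul]
  | monomial k c =>
    have hp : (T ^ k) v = a ^ k • v := by
      induction k with
      | zero => simp
      | succ k ih => rw [pow_succ', Module.End.mul_apply, ih, map_smul, h, smul_smul, pow_succ]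
    rw [aeval_monomial, eval_monomial, Module.End.mul_apply, hp, mul_smul]
    rfl

theorem sub_mul_basis_eval_eq_zero {ι : Type*} [Fintype ι] [DecidableEq ι] {α : ι → R} (i j : ι) :
    ((X - C (α i)) * Lagrange.basis Finset.univ α i).eval (α j) = 0 := by
  rw [eval_mul, eval_sub, eval_X, eval_C]
  by_cases h : i = j
  · rw [h, sub_self, zero_mul]
  · rw [Lagrange.eval_basis_of_ne h (Finset.mem_univ j), mul_zero]

end Triangular

open UExt

variable {m n : ℕ}

/-! ### The quadratic Casimir element. -/

namespace UExt

/-- The quadratic Casimir element of `gl(m)`. -/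
def casimir (m n : ℕ) : UExt m n := ∑ i : Fin m, ∑ j : Fin m, e i j * e j i

theorem e_comm_casimir (p q : Fin m) : (e p q * casimir m n : UExt m n) = casimir m n * e p q := by
  have h : ∀ i j : Fin m, (e p q * (e i j * e j i) : UExt m n) - e i j * e j i * e p q
      = ((if q = i then e p j else 0) - (if p = j then e i q else 0)) * e j i
        + e i j * ((if q = j then e p i else 0) - (if p = i then e j q else 0)) := fun i j => by
    rw [← sub_eq_iff_eq_add'.2 (e_mul_e p q i j), ← sub_eq_iff_eq_add'.2 (e_mul_e p q j i)]
    noncomm_ring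
  rw [← sub_eq_zero, casimir]
  simp only [Finset.mul_sum, Finset.sum_mul, ← Finset.sum_sub_distrib, h]
  simp only [Finset.sum_add_distrib, sub_mul, mul_sub, Finset.sum_sub_distrib, ite_mul, mul_ite,
    zero_mul, mul_zero, Finset.sum_ite_eq, Finset.mem_univ, if_true, Finset.sum_ite_irrel,
    Finset.sum_const_zero]
  abel

/-- Commuting with the E_{ii} gives the polynomials, and inverting the denominators gives the
fractions. -/
theorem casimir_comm_ofCartan (f : CartanField m) :
    casimir m n * UExt.ofCartan m n f = UExt.ofCartan m n f * casimir m n := by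
  have hp : ∀ p : MvPolynomial (Fin m) ℂ, casimir m n * UExt.ofCartan m n (algebraMap _ _ p)
      = UExt.ofCartan m n (algebraMap _ _ p) * casimir m n := by
    intro p
    induction p using MvPolynomial.induction_on with
    | C c =>
      rw [← MvPolynomial.algebraMap_eq, ← IsScalarTower.algebraMap_apply, AlgHom.commutes,
        Algebra.commutes]
    | add p q hp hq => simp only [map_add, mul_add, add_mul, hp, hq]
    | mul_X p i hp =>
      have h : UExt.ofCartan m n (algebraMap (MvPolynomial (Fin m) ℂ) (CartanField m)
          (MvPolynomial.X i)) = e i i := ofCartan_cartanE i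
      rw [map_mul, map_mul, h, ← mul_assoc, hp, mul_assoc, mul_assoc, e_comm_casimir]
  obtain ⟨p, q, hq, rfl⟩ := IsFractionRing.div_surjective (A := MvPolynomial (Fin m) ℂ) f
  have hq' : algebraMap _ (CartanField m) q ≠ 0 := fun h0 =>
    nonZeroDivisors.ne_zero hq (IsFractionRing.injective (MvPolynomial (Fin m) ℂ) (CartanField m)
      (h0.trans (map_zero _).symm))
  rw [div_eq_mul_inv, map_mul, ← mul_assoc, hp, mul_assoc, mul_ofCartan_inv hq' hq' (hp q),
    mul_assoc]

/-- Bracketing with the Casimir element realizes, up to a factor 2 and a scalar, the matrix (E_{kq})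
acting on the column (E_{qb}). This is what lets powers of E be read as powers of one operator. -/
theorem casimir_mul_E_inl (k : Fin m) (b : Fin n) :
    (casimir m n * E (.inl k) (.inr b) : UExt m n) = E (.inl k) (.inr b) * casimir m n
      + 2 * ∑ q, e k q * E (.inl q) (.inr b) - m * E (.inl k) (.inr b) := by
  have h : ∀ i j : Fin m, (e i j * e j i * E (.inl k) (.inr b) : UExt m n)
      = E (.inl k) (.inr b) * (e i j * e j i)
        + (if j = k then E (.inl i) (.inr b) * e k i else 0)
        + (if i = k then e k j * E (.inl j) (.inr b) else 0) := fun i j => by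
    rw [mul_assoc, e_mul_E_inl, mul_add, ← mul_assoc, e_mul_E_inl, add_mul, mul_assoc]
    congr 1
    · congr 1; split_ifs with h <;> simp [h]
    · split_ifs with h <;> simp [h]
  have h2 : ∀ i : Fin m, (E (.inl i) (.inr b) * e k i : UExt m n)
      = e k i * E (.inl i) (.inr b) - E (.inl k) (.inr b) := fun i => by
    rw [e_mul_E_inl, if_pos rfl, add_sub_cancel_right]
  rw [casimir]
  simp only [Finset.mul_sum, Finset.sum_mul, h, Finset.sum_add_distrib, Finset.sum_ite_eq',
    Finset.sum_ite_irrel, Finset.sum_const_zero, Finset.mem_univ, if_true, h2,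
    Finset.sum_sub_distrib, Finset.sum_const, Finset.card_univ, Fintype.card_fin, nsmul_eq_mul]
  rw [← Finset.mul_sum, two_mul]
  abel

theorem casimir_mul_E_inr (k : Fin m) (a : Fin n) :
    (casimir m n * E (.inr a) (.inl k) : UExt m n) = E (.inr a) (.inl k) * casimir m n
      - 2 * ∑ q, E (.inr a) (.inl q) * e q k + m * E (.inr a) (.inl k) := by
  have h : ∀ i j : Fin m, (e i j * e j i * E (.inr a) (.inl k) : UExt m n)
      = E (.inr a) (.inl k) * (e i j * e j i)
        - (if i = k then E (.inr a) (.inl j) * e j k else 0)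
        - (if j = k then e i k * E (.inr a) (.inl i) else 0) := fun i j => by
    rw [mul_assoc, e_mul_E_inr, mul_sub, ← mul_assoc, e_mul_E_inr, sub_mul, mul_assoc]
    congr 1
    · congr 1; split_ifs with h <;> simp [h]
    · split_ifs with h <;> simp [h]
  have h2 : ∀ i : Fin m, (e i k * E (.inr a) (.inl i) : UExt m n)
      = E (.inr a) (.inl i) * e i k - E (.inr a) (.inl k) := fun i => by
    rw [e_mul_E_inr, if_pos rfl]
  rw [casimir]
  simp only [Finset.mul_sum, Finset.sum_mul, h, Finset.sum_sub_distrib, Finset.sum_ite_eq',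
    Finset.sum_ite_irrel, Finset.sum_const_zero, Finset.mem_univ, if_true, h2,
    Finset.sum_const, Finset.card_univ, Fintype.card_fin, nsmul_eq_mul]
  rw [← Finset.mul_sum, two_mul]
  abel

end UExt

namespace UModJ

/-- `v` has weight `x`: `E_{jj}` acts on `v` as the scalar `x j` (acting on the right). -/
def HasWt (v : UModJ m n) (x : Fin m → CartanField m) : Prop :=
  ∀ j, (e j j : UExt m n) • v = x j • v

theorem singular_vac : Singular (vac m n) := fun _ _ h => e_smul_vac h

theorem hasWt_vac : HasWt (vac m n) cartanE := fun j => by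
  rw [← ofCartan_smul_vac, UExt.ofCartan_cartanE]

/-- The eigenvalue of the Casimir element on singular vectors. -/
def casimirValue (x : Fin m → CartanField m) : CartanField m :=
  ∑ i, ∑ j, if i = j then x i ^ 2 else if i < j then x i - x j else 0

theorem casimir_smul {v : UModJ m n} {x : Fin m → CartanField m} (hs : Singular v)
    (hw : HasWt v x) : casimir m n • v = casimirValue x • v := by
  simp only [casimir, casimirValue, Finset.sum_smul]
  refine Finset.sum_congr rfl fun i _ => Finset.sum_congr rfl fun j _ => ?_
  rw [mul_smul]
  split_ifs with h1 h2
  · subst h1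
    rw [hw, smul_comm, hw, pow_two, mul_smul]
  · rw [e_smul_e_smul, hs i j h2, if_pos rfl, if_pos rfl, hw, hw, sub_smul, smul_zero, zero_add]
  · rw [hs j i (lt_of_le_of_ne (not_lt.1 h2) (Ne.symm h1)), smul_zero, zero_smul]

/-- Only terms with an index equal to k change. The m - 1 - k indices above k contribute +c each and
the k indices below it -c each, with k counted from zero. -/
theorem casimirValue_add_single (k : Fin m) (c : CartanField m) :
    casimirValue (fun j => cartanE j + if j = k then c else 0)
      = casimirValue cartanE + 2 * c * cartanE k + c ^ 2
        + c * ((m : CartanField m) - 1 - 2 * ((k : ℕ) : CartanField m)) := by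
  have h : ∀ i j : Fin m, (if i = j then (cartanE i + if i = k then c else 0) ^ 2
        else if i < j then (cartanE i + if i = k then c else 0)
          - (cartanE j + if j = k then c else 0) else 0 : CartanField m)
      = (if i = j then cartanE i ^ 2 else if i < j then cartanE i - cartanE j else 0)
        + (if i = k then (if j = k then 2 * c * cartanE k + c ^ 2 else 0) else 0)
        + (if i = k then (if k < j then c else 0) else 0)
        - (if j = k then (if i < k then c else 0) else 0) := by
    intro i j
    rcases lt_trichotomy i j with hij | hij | hij
    · by_cases h1 : i = k
      · subst h1; simp [hij, hij.ne, hij.ne']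
        ring
      · by_cases h2 : j = k
        · subst h2; simp [hij, hij.ne]
          ring
        · simp [hij, hij.ne, h1, h2]
    · subst hij
      by_cases h1 : i = k
      · subst h1; simp; ring
      · simp [h1]
    · by_cases h1 : i = k
      · subst h1; simp [hij.not_gt, hij.ne, hij.ne']
      · by_cases h2 : j = k
        · subst h2; simp [hij.not_gt, hij.ne']
        · simp [hij.not_gt, hij.ne', h1, h2]
  have h3 : ∑ j : Fin m, (if k < j then c else 0) 
      = ((m : CartanField m) - 1 - ((k : ℕ) : CartanField m)) * c := by
    have hk := k.2
    rw [← Finset.sum_filter, Finset.sum_const, nsmul_eq_mul, Finset.filter_lt_eq_Ioi, Fin.card_Ioi]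
    rw [Nat.cast_sub (by omega), Nat.cast_sub (by omega)]
    push_cast; ring
  have h4 : ∑ j : Fin m, (if j < k then c else 0) = ((k : ℕ) : CartanField m) * c := by
    rw [← Finset.sum_filter, Finset.sum_const, nsmul_eq_mul, Finset.filter_gt_eq_Iio, Fin.card_Iio]
  simp only [casimirValue, h, Finset.sum_add_distrib, Finset.sum_sub_distrib, Finset.sum_ite_irrel,
    Finset.sum_const_zero, Finset.sum_ite_eq', Finset.mem_univ, if_true, h3, h4]
  ring

/-- The normalized Casimir operator; it acts on the vectors `E_{kb}` as the matrix `(E_{kl})`. -/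
def Omega (m n : ℕ) : Module.End (CartanField m) (UModJ m n) :=
  (2 : CartanField m)⁻¹ • (lmul (casimir m n)
    + algebraMap (CartanField m) _ ((m : CartanField m) - casimirValue cartanE))

theorem Omega_apply (v : UModJ m n) : Omega m n v
    = (2 : CartanField m)⁻¹ • (casimir m n • v + ((m : CartanField m) - casimirValue cartanE) • v) :=
  rfl

theorem lmul_e_commute_Omega (p q : Fin m) : Commute (lmul (e p q : UExt m n)) (Omega m n) := by
  refine Commute.smul_right (Commute.add_right ?_ (Algebra.commutes _ _).symm) _
  rw [Commute, SemiconjBy, ← map_mul, ← map_mul, e_comm_casimir]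

theorem lmul_ofCartan_commute_Omega (f : CartanField m) :
    Commute (lmul (UExt.ofCartan m n f)) (Omega m n) := by
  refine Commute.smul_right (Commute.add_right ?_ (Algebra.commutes _ _).symm) _
  rw [Commute, SemiconjBy, ← map_mul, ← map_mul, casimir_comm_ofCartan]

theorem Omega_of_singular {v : UModJ m n} (hs : Singular v) {k : Fin m} {c : CartanField m}
    (hw : HasWt v fun j => cartanE j + if j = k then c else 0) :
    Omega m n v
      = ((2 : CartanField m)⁻¹ * (2 * c * cartanE k + c ^ 2
          + c * ((m : CartanField m) - 1 - 2 * ((k : ℕ) : CartanField m)) + (m : CartanField m)))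
        • v := by
  rw [Omega_apply, casimir_smul hs hw, ← add_smul, smul_smul, casimirValue_add_single]
  congr 2
  ring

theorem casimir_smul_vac : casimir m n • vac m n = (casimirValue cartanE : CartanField m) • vac m n :=
  casimir_smul singular_vac hasWt_vac

theorem two_inv_two_mul (v : UModJ m n) :
    (2 : CartanField m)⁻¹ • ((2 : UExt m n) • v) = v := by
  have h : (2 : UExt m n) • v = (2 : CartanField m) • v := by
    rw [two_smul, ← one_add_one_eq_two, add_smul, one_smul]
  rw [h, smul_smul, inv_mul_cancel₀ two_ne_zero, one_smul]

theorem natCast_smul (k : ℕ) (v : UModJ m n) :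
    (k : UExt m n) • v = (k : CartanField m) • v := by
  rw [Nat.cast_smul_eq_nsmul, Nat.cast_smul_eq_nsmul]

/-- The additive constant in `Omega` is chosen to cancel both the scalar m and the Casimir
eigenvalue of the class of 1. -/
theorem Omega_E_inl (k : Fin m) (b : Fin n) :
    Omega m n ((E (.inl k) (.inr b) : UExt m n) • vac m n)
      = ∑ q, (e k q : UExt m n) • (E (.inl q) (.inr b) : UExt m n) • vac m n := by
  rw [Omega_apply, ← mul_smul, casimir_mul_E_inl, sub_smul, add_smul, mul_smul, casimir_smul_vac,
    mul_smul (2 : UExt m n), mul_smul (m : UExt m n), natCast_smul, smul_comm (E _ _), sub_smul]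
  rw [show ∀ a b c : UModJ m n, a + b - c + (c - a) = b from fun a b c => by abel]
  rw [two_inv_two_mul, Finset.sum_smul]
  simp only [mul_smul]

/-- The hypothesis says that every x k has the same Casimir eigenvalue as the class of 1. It holds
for vectors obtained from that class by gl(m). -/
theorem Omega_E_inr (a : Fin n) (x : Fin m → UModJ m n)
    (hx : ∀ k, Omega m n (x k) = ((2 : CartanField m)⁻¹ * m) • x k) :
    Omega m n (∑ k, (E (.inr a) (.inl k) : UExt m n) • x k)
      = (m : CartanField m) • (∑ k, (E (.inr a) (.inl k) : UExt m n) • x k)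
        - ∑ k, (E (.inr a) (.inl k) : UExt m n) • ∑ q, (e k q : UExt m n) • x q := by
  have hc : ∀ k, casimir m n • x k = casimirValue cartanE • x k := fun k => by
    have h := hx k
    rw [Omega_apply, mul_smul] at h
    have h2 := smul_right_injective (UModJ m n) (inv_ne_zero (two_ne_zero (α := CartanField m))) h
    rw [sub_smul] at h2
    rw [eq_sub_of_add_eq h2]
    abel
  have h1 : ∀ k, Omega m n ((E (.inr a) (.inl k) : UExt m n) • x k)
      = (m : CartanField m) • (E (.inr a) (.inl k) : UExt m n) • x k
        - ∑ q, (E (.inr a) (.inl q) : UExt m n) • (e q k : UExt m n) • x k := fun k => by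
    rw [Omega_apply, ← mul_smul, casimir_mul_E_inr, add_smul, sub_smul, mul_smul, hc,
      mul_smul (2 : UExt m n), mul_smul (m : UExt m n), natCast_smul, smul_comm (E _ _), sub_smul]
    rw [show ∀ a b c : UModJ m n, a - b + c + (c - a) = (c + c) - b from fun a b c => by abel,
      smul_sub, two_inv_two_mul, Finset.sum_smul]
    simp only [mul_smul]
    rw [← two_smul (CartanField m), smul_smul, inv_mul_cancel₀ two_ne_zero, one_smul]
  rw [map_sum]
  simp only [h1, Finset.sum_sub_distrib, Finset.smul_sum]
  rw [Finset.sum_comm]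

end UModJ

end MickelssonZhelobenko

end

noncomputable section

namespace MickelssonZhelobenko

open Polynomial UExt

variable {m n : ℕ}

theorem UExt.e_self_mul_e_pow (s i j : Fin m) (k : ℕ) :
    (e s s * e i j ^ k : UExt m n) = e i j ^ k * (e s s
      + (((k : ℤ) * ((if s = i then 1 else 0) - (if s = j then 1 else 0)) : ℤ) : UExt m n)) := by
  have h1 : (e s s * e i j : UExt m n) = e i j * e s s
      + e i j * (((if s = i then 1 else 0) - (if s = j then 1 else 0) : ℤ) : UExt m n) := by
    rw [e_mul_e]
    congr 1
    by_cases h : s = i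
    · subst h
      by_cases h' : s = j
      · subst h'; simp
      · simp [h']
    · by_cases h' : s = j
      · subst h'; simp [h]
      · simp [h, h']
  induction k with
  | zero => simp
  | succ k ih =>
    rw [pow_succ, ← mul_assoc, ih, mul_assoc, add_mul, h1, (Int.cast_commute _ (e i j)).eq, mul_assoc,
      add_assoc, ← mul_add, ← mul_add, ← Int.cast_add]
    congr 4
    push_cast; ring

theorem UExt.e_self_mul_rootTerm (s i j : Fin m) (k : ℕ) (f : CartanField m) :
    (e s s * (e j i ^ k * e i j ^ k * UExt.ofCartan m n f) : UExt m n)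
      = e j i ^ k * e i j ^ k * UExt.ofCartan m n f * e s s := by
  have h : (e s s * (e j i ^ k * e i j ^ k) : UExt m n) = e j i ^ k * e i j ^ k * e s s := by
    rw [← mul_assoc, e_self_mul_e_pow, mul_assoc, add_mul, e_self_mul_e_pow,
      (Int.cast_commute _ (e i j ^ k)).eq, ← mul_add, mul_assoc, add_assoc, ← Int.cast_add]
    congr 2
    simp only [← mul_add]
    simp
  rw [← mul_assoc, h, mul_assoc, mul_assoc _ (UExt.ofCartan m n f)]
  rw [show (e s s : UExt m n) = UExt.ofCartan m n (cartanE s) from (ofCartan_cartanE s).symm,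
    ← map_mul, ← map_mul, mul_comm f]

namespace UModJ

theorem extremalProjector_apply_of_commute {T : Module.End (CartanField m) (UModJ m n)}
    (h1 : ∀ p q, Commute (lmul (e p q : UExt m n)) T)
    (h2 : ∀ f, Commute (lmul (UExt.ofCartan m n f)) T) (v : UModJ m n) :
    extremalProjector (T v) = T (extremalProjector v) := by
  refine extremalProjector_map T.toAddMonoidHom (fun i j k f v => ?_) v
  have h : Commute (lmul (e j i ^ k * e i j ^ k * UExt.ofCartan m n f : UExt m n)) T := by
    rw [map_mul, map_mul, map_pow, map_pow]
    exact (((h1 j i).pow_left k).mul_left ((h1 i j).pow_left k)).mul_left (h2 f)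
  exact (congrArg (fun F : Module.End (CartanField m) (UModJ m n) => F v) h.eq).symm

theorem extremalProjector_smul (f : CartanField m) (v : UModJ m n) :
    extremalProjector (f • v) = f • extremalProjector v :=
  extremalProjector_apply_of_commute (T := algebraMap (CartanField m) _ f)
    (fun _ _ => (Algebra.commutes _ _).symm) (fun _ => (Algebra.commutes _ _).symm) v

/-- All terms of the root projectors have weight zero, and the weight acts on the right, where p is
linear. -/
theorem HasWt.extremalProjector {v : UModJ m n} {x : Fin m → CartanField m} (hv : HasWt v x) :
    HasWt (extremalProjector v) x := fun s => by
  have h := extremalProjector_map (DistribSMul.toAddMonoidHom (UModJ m n) (e s s : UExt m n))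
    (fun i j k f w => by
      simp only [DistribSMul.toAddMonoidHom_apply]
      rw [← mul_smul, ← mul_smul, e_self_mul_rootTerm]) v
  simp only [DistribSMul.toAddMonoidHom_apply] at h
  rw [← h, hv s, extremalProjector_smul]

theorem extremalProjector_aeval_Omega (g : (CartanField m)[X]) (v : UModJ m n) :
    extremalProjector (aeval (Omega m n) g v) = aeval (Omega m n) g (extremalProjector v) :=
  extremalProjector_apply_of_commute (fun p q => commute_aeval (lmul_e_commute_Omega p q) g)
    (fun f => commute_aeval (lmul_ofCartan_commute_Omega f) g) v

theorem smul_aeval_Omega (p q : Fin m) (g : (CartanField m)[X]) (v : UModJ m n) :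
    (e p q : UExt m n) • aeval (Omega m n) g v = aeval (Omega m n) g ((e p q : UExt m n) • v) :=
  congrArg (fun F : Module.End (CartanField m) (UModJ m n) => F v)
    (commute_aeval (lmul_e_commute_Omega p q) g).eq

/-- Splitting a sum at an index. -/
theorem sum_univ_split {M : Type*} [AddCommMonoid M] (k : Fin m) (f : Fin m → M) :
    ∑ q, f q = ∑ q ∈ Finset.Iio k, f q + f k + ∑ q ∈ Finset.Ioi k, f q := by
  rw [← Finset.sum_filter_add_sum_filter_not Finset.univ (fun q => q < k), add_assoc,
    ← Finset.sum_filter_add_sum_filter_not (Finset.univ.filter fun q => ¬ q < k) (fun q => q = k)]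
  congr 1
  · exact Finset.sum_congr (by ext; simp) fun _ _ => rfl
  congr 1
  · rw [show (Finset.univ.filter fun q => ¬ q < k).filter (fun q => q = k) = {k} by
      ext q; simp; rintro rfl; exact le_rfl, Finset.sum_singleton]
  · exact Finset.sum_congr (by
      ext q
      simp only [Finset.mem_filter, Finset.mem_univ, true_and, Finset.mem_Ioi, not_lt]
      exact ⟨fun h => lt_of_le_of_ne h.1 (Ne.symm h.2), fun h => ⟨h.le, h.ne'⟩⟩) fun _ _ => rfl

/-! ### The vectors `E_{kb}` -/

/-- The image of `E_{kb}` in `U'(gl(m|n)) / J`. -/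
def up (k : Fin m) (b : Fin n) : UModJ m n := (E (.inl k) (.inr b) : UExt m n) • vac m n

theorem e_smul_up (p q k : Fin m) (b : Fin n) : (e p q : UExt m n) • up k b
    = (E (.inl k) (.inr b) : UExt m n) • (e p q : UExt m n) • vac m n
      + if q = k then up p b else 0 := by
  rw [up, ← mul_smul, e_mul_E_inl, add_smul, mul_smul]
  congr 1
  split_ifs <;> simp [up]

theorem e_smul_up_of_lt {p q : Fin m} (h : p < q) (k : Fin m) (b : Fin n) :
    (e p q : UExt m n) • up k b = if q = k then up p b else 0 := by
  rw [e_smul_up, e_smul_vac h, smul_zero, zero_add]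

theorem sqZero_up (d k : Fin m) (b : Fin n) : SqZero d (up k b : UModJ m n) := fun q r hq hr => by
  rw [e_smul_up_of_lt hr]
  split_ifs
  · rw [e_smul_up_of_lt hq, if_neg hq.ne']
  · rw [smul_zero]

theorem hasWt_up (k : Fin m) (b : Fin n) :
    HasWt (up k b : UModJ m n) fun j => cartanE j + if j = k then 1 else 0 := fun j => by
  rw [e_smul_up, hasWt_vac j, smul_comm, add_smul, up]
  congr 1
  split_ifs with h
  · subst h; rw [one_smul, up]
  · rw [zero_smul]

/-- For q > k the vector E_{kq} kills the class of 1 and turns E_{qb} into E_{kb}. These m - 1 - k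
copies and the diagonal value E_{kk} + 1 add up to h_k + m, while the terms with q < k stay as the
triangular part. -/
theorem Omega_up (k : Fin m) (b : Fin n) : Omega m n (up k b)
    = (cartanH k + (m : CartanField m)) • up k b
      + ∑ q ∈ Finset.Iio k, (e k q : UExt m n) • up q b := by
  rw [up, Omega_E_inl, sum_univ_split k, ← up]
  have h1 : ∑ q ∈ Finset.Ioi k, (e k q : UExt m n) • (E (.inl q) (.inr b) : UExt m n) • vac m n
      = ((m : CartanField m) - 1 - ((k : ℕ) : CartanField m)) • up k b := by
    have hk := k.2
    rw [Finset.sum_congr rfl fun q hq => (show (e k q : UExt m n) • (E (.inl q) (.inr b) : UExt m n)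
        • vac m n = up k b from (e_smul_up_of_lt (Finset.mem_Ioi.1 hq) q b).trans (if_pos rfl)), Finset.sum_const, Fin.card_Ioi, ← Nat.cast_smul_eq_nsmul (CartanField m),
      Nat.cast_sub (by omega), Nat.cast_sub (by omega), Nat.cast_one]
  rw [h1, hasWt_up k b k, add_assoc, ← add_smul, add_comm]
  congr 2
  simp only [if_true]
  rw [cartanH]
  ring

/-- The Lagrange polynomials for the nodes `h_i + c`. -/
def nodePoly (m : ℕ) (c : CartanField m) (i : Fin m) : (CartanField m)[X] :=
  Lagrange.basis Finset.univ (fun k : Fin m => cartanH k + c) i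

theorem node_injective (c : CartanField m) :
    Function.Injective fun k : Fin m => cartanH k + c := fun _ _ h =>
  cartanH_injective (add_right_cancel h)

theorem nodePoly_eval_self (c : CartanField m) (i : Fin m) :
    (nodePoly m c i).eval (cartanH i + c) = 1 :=
  Lagrange.eval_basis_self (node_injective c).injOn (Finset.mem_univ i)

theorem nodePoly_eval_of_ne (c : CartanField m) {i j : Fin m} (h : i ≠ j) :
    (nodePoly m c i).eval (cartanH j + c) = 0 :=
  Lagrange.eval_basis_of_ne (v := fun k : Fin m => cartanH k + c) h (Finset.mem_univ j)

/-- The component of `E_{kb}` in the `i`-th eigenspace of the Casimir operator. -/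
def upPart (i k : Fin m) (b : Fin n) : UModJ m n := aeval (Omega m n) (nodePoly m m i) (up k b)

theorem aeval_Omega_up_eq_zero (k : Fin m) (b : Fin n) {g : (CartanField m)[X]}
    (hg : ∀ q ≤ k, g.eval (cartanH q + (m : CartanField m)) = 0) :
    aeval (Omega m n) g (up k b) = 0 :=
  aeval_eq_zero_of_triangular (r := (· < ·)) wellFounded_lt (fun _ _ _ => lt_trans)
    (node_injective (m : CartanField m)) Finset.Iio (fun _ _ hq => Finset.mem_Iio.1 hq)
    (fun k q => lmul (e k q : UExt m n)) (fun k q => lmul_e_commute_Omega k q)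
    (fun k => Omega_up k b) k g (hg k le_rfl) fun q hq => hg q hq.le

theorem upPart_of_lt {i k : Fin m} (h : k < i) (b : Fin n) : (upPart i k b : UModJ m n) = 0 :=
  aeval_Omega_up_eq_zero k b fun _ hq => nodePoly_eval_of_ne _ (hq.trans_lt h).ne'

/-- The i-th Lagrange polynomial times X minus its own node vanishes at all nodes, so it kills every
E_{kb} by triangularity. -/
theorem Omega_upPart (i k : Fin m) (b : Fin n) : Omega m n (upPart i k b)
    = (cartanH i + (m : CartanField m)) • upPart i k b := by
  have h := aeval_Omega_up_eq_zero (n := n) k b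
    (g := (X - C (cartanH i + (m : CartanField m))) * nodePoly m m i)
    fun q _ => sub_mul_basis_eval_eq_zero (α := fun k : Fin m => cartanH k + (m : CartanField m)) i q
  rw [map_mul, Module.End.mul_apply, map_sub, aeval_X, aeval_C, LinearMap.sub_apply] at h
  exact sub_eq_zero.1 h

/-- Ω is evaluated on the component in two ways, as an eigenvalue and through its triangular form.
For k ≠ i the component is thereby determined by those with smaller k. -/
theorem sub_smul_upPart (i k : Fin m) (b : Fin n) : (cartanH i - cartanH k) • upPart i k b
    = ∑ q ∈ Finset.Iio k, (e k q : UExt m n) • upPart i q b := by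
  have h1 := Omega_upPart (n := n) i k b
  have h2 : Omega m n (upPart i k b) = aeval (Omega m n) (nodePoly m m i) (Omega m n (up k b)) := by
    rw [upPart, ← Module.End.mul_apply, ← Module.End.mul_apply,
      (commute_aeval (Commute.refl (Omega m n)) _).eq]
  rw [h2, Omega_up, map_add, map_smul, map_sum, ← upPart] at h1
  simp only [← smul_aeval_Omega] at h1
  change _ + ∑ q ∈ Finset.Iio k, (e k q : UExt m n) • upPart i q b = _ at h1
  rw [← add_sub_cancel_left ((cartanH k + (m : CartanField m)) • upPart i k b)
    (∑ q ∈ Finset.Iio k, (e k q : UExt m n) • upPart i q b), h1, ← sub_smul]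
  congr 1
  ring

theorem sum_upPart (k : Fin m) (b : Fin n) : ∑ i, upPart i k b = (up k b : UModJ m n) := by
  simp only [upPart]
  rw [← LinearMap.sum_apply, ← map_sum]
  simp only [nodePoly]
  rw [Lagrange.sum_basis (node_injective _).injOn ⟨k, Finset.mem_univ k⟩, map_one,
    Module.End.one_apply]

theorem Omega_pow_upPart (s : ℕ) (i k : Fin m) (b : Fin n) : (Omega m n ^ s) (upPart i k b)
    = (cartanH i + (m : CartanField m)) ^ s • upPart i k b := by
  have := aeval_apply_of_eigen (Omega_upPart (n := n) i k b) (X ^ s)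
  simpa using this

/-- Iteration is possible because Ω commutes with the entries of the matrix E. -/
theorem Omega_pow_up (s : ℕ) (k : Fin m) (b : Fin n) : (Omega m n ^ s) (up k b)
    = ∑ l, ((Matrix.of fun k l : Fin m => (e k l : UExt m n)) ^ s) k l • up l b := by
  induction s generalizing k with
  | zero => simp [Matrix.one_apply, ite_smul]
  | succ s ih =>
    rw [pow_succ, Module.End.mul_apply, up, Omega_E_inl, map_sum, pow_succ']
    simp only [Matrix.mul_apply, Finset.sum_smul]
    rw [Finset.sum_comm]
    refine Finset.sum_congr rfl fun q _ => ?_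
    have h := smul_aeval_Omega (n := n) k q (X ^ s) (up q b)
    rw [aeval_X_pow] at h
    rw [← up, ← h, ih, Finset.smul_sum]
    simp only [mul_smul, Matrix.of_apply]

/-- The only raising vectors not killing E_{ib} send it to E_{pb} with p < i, which has no component
in the i-th eigenspace. -/
theorem singular_upPart (i : Fin m) (b : Fin n) : Singular (upPart i i b : UModJ m n) :=
  fun p q h => by
    rw [upPart, smul_aeval_Omega, e_smul_up_of_lt h]
    split_ifs with hq
    · subst hq; exact upPart_of_lt h b
    · rw [map_zero]

/-- Being singular, p E_{ib} is an Ω-eigenvector with eigenvalue h_i + m, where the i-th Lagrange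
polynomial equals 1. As p commutes with polynomials in Ω and fixes singular vectors, projecting
`upPart i i b` gives both sides. -/
theorem extremalProjector_up (i : Fin m) (b : Fin n) :
    extremalProjector (up i b) = (upPart i i b : UModJ m n) := by
  have hs : Singular (extremalProjector (up i b : UModJ m n)) :=
    singular_extremalProjector fun d => sqZero_up d i b
  have hΩ := Omega_of_singular hs (hasWt_up i b).extremalProjector
  have h1 : (2 : CartanField m)⁻¹ * (2 * 1 * cartanE i + 1 ^ 2
      + 1 * ((m : CartanField m) - 1 - 2 * ((i : ℕ) : CartanField m)) + (m : CartanField m))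
      = cartanH i + m := by
    rw [cartanH]; field_simp; ring
  rw [h1] at hΩ
  rw [← extremalProjector_of_singular (singular_upPart i b), upPart, extremalProjector_aeval_Omega,
    aeval_apply_of_eigen hΩ, nodePoly_eval_self, one_smul]

theorem hasWt_upPart (i : Fin m) (b : Fin n) :
    HasWt (upPart i i b : UModJ m n) fun j => cartanE j + if j = i then 1 else 0 :=
  extremalProjector_up (n := n) i b ▸ (hasWt_up i b).extremalProjector

end UModJ

end MickelssonZhelobenko

end

noncomputable section

namespace MickelssonZhelobenko

open Polynomial UExt

variable {m n : ℕ}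

/-! ### A diagonal entry of a Lagrange polynomial in a triangular matrix. -/

section Triangular

variable {R N : Type*} [Field R] [AddCommGroup N] [Module R N]

/-- The diagonal values of the Lagrange polynomials at a triangular matrix all of whose entries
above the diagonal are `-1`. -/
theorem diag_basis_eq {a : Fin m → R} (ha : Function.Injective a) {u : Fin m → R[X] →ₗ[R] N} {v : N}
    (hu : ∀ r g, u r (X * g) = a r • u r g - ∑ q ∈ Finset.Ioi r, u q g) (h1 : ∀ r, u r 1 = v)
    (i : Fin m) : u i (Lagrange.basis Finset.univ a i)
      = (∏ j ∈ Finset.Ioi i, (1 - (a i - a j)⁻¹)) • v := by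
  -- vanishing of the diagonal values below `i`
  have hvan : ∀ r (g : R[X]), (∀ q, r ≤ q → g.eval (a q) = 0) → u r g = 0 := by
    intro r
    induction r using WellFoundedGT.induction with
    | _ r ih =>
      intro g hg
      obtain ⟨g', rfl⟩ := dvd_iff_isRoot.2 (hg r le_rfl)
      rw [sub_mul, map_sub, hu, ← smul_eq_C_mul, map_smul, sub_right_comm, sub_self, zero_sub,
        neg_eq_zero]
      refine Finset.sum_eq_zero fun q hq => ih q (Finset.mem_Ioi.1 hq) g' fun s hs => ?_
      have hrs := (Finset.mem_Ioi.1 hq).trans_le hs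
      have h := hg s hrs.le
      rw [eval_mul, eval_sub, eval_X, eval_C] at h
      exact (mul_eq_zero.1 h).resolve_left (sub_ne_zero.2 fun h' => hrs.ne' (ha h'))
  -- a left eigenvector of the matrix
  let P : Fin m → R := fun r => ∏ j ∈ Finset.Ioo i r, (1 - (a i - a j)⁻¹)
  let w : Fin m → R := fun r => if r < i then 0 else if r = i then 1 else -((a i - a r)⁻¹ * P r)
  have hw0 : ∀ r, r < i → w r = 0 := fun r hr => if_pos hr
  have hwi : w i = 1 := by simp [w]
  have hwr : ∀ r, i < r → w r = -((a i - a r)⁻¹ * P r) := fun r hr => by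
    simp [w, hr.not_gt, hr.ne']
  have hsum : ∀ r, i < r → ∑ s ∈ Finset.Iio r, w s = P r := by
    intro r hr
    have h : ∑ s ∈ Finset.Iio r, w s = w i + ∑ s ∈ Finset.Ioo i r, w s := by
      rw [← Finset.sum_insert (by simp)]
      refine (Finset.sum_subset (fun s hs => ?_) fun s hs hs' => hw0 s ?_).symm
      · rcases Finset.mem_insert.1 hs with rfl | hs
        · exact Finset.mem_Iio.2 hr
        · exact Finset.mem_Iio.2 (Finset.mem_Ioo.1 hs).2
      · simp only [Finset.mem_insert, Finset.mem_Ioo, not_or, not_and, Finset.mem_Iio] at hs hs'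
        exact lt_of_le_of_ne (not_lt.1 fun h => hs'.2 h hs) hs'.1
    rw [h, hwi, show P r = _ from Finset.prod_one_sub_ordered _ _, sub_eq_add_neg,
      ← Finset.sum_neg_distrib]
    congr 1
    refine Finset.sum_congr rfl fun s hs => ?_
    rw [hwr s (Finset.mem_Ioo.1 hs).1]
    refine congrArg (fun z => -(_ * z)) (Finset.prod_congr ?_ fun _ _ => rfl)
    ext j
    simp only [Finset.mem_filter, Finset.mem_Ioo] at hs ⊢
    exact ⟨fun h => ⟨⟨h.1, h.2.trans hs.2⟩, h.2⟩, fun h => ⟨h.1.1, h.2⟩⟩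
  -- The left eigenvector equation. For q > i it gives w q as minus the sum of the earlier entries
  -- over a i - a q, and those partial sums are the products P.
  have hcol : ∀ q, w q * a q - ∑ r ∈ Finset.Iio q, w r = a i * w q := fun q => by
    rcases lt_trichotomy q i with h | h | h
    · rw [hw0 q h, Finset.sum_eq_zero fun r hr => hw0 r ((Finset.mem_Iio.1 hr).trans h)]
      ring
    · subst h
      rw [Finset.sum_eq_zero fun r hr => hw0 r (Finset.mem_Iio.1 hr), sub_zero, mul_comm]
    · have hne : a i - a q ≠ 0 := sub_ne_zero.2 fun h' => h.ne (ha h')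
      rw [hsum q h, hwr q h]
      field_simp
      ring
  -- Weighting by the eigenvector diagonalizes the recursion, so this functional is evaluation at a
  -- i times its value at 1.
  let lam : R[X] →ₗ[R] N := ∑ r, w r • u r
  have hlX : ∀ g, lam (X * g) = a i • lam g := fun g => by
    simp only [lam, LinearMap.sum_apply, LinearMap.smul_apply, hu, smul_sub, Finset.smul_sum,
      Finset.sum_sub_distrib]
    rw [Finset.sum_comm' (t' := Finset.univ) (s' := Finset.Iio) (by simp), ← Finset.sum_sub_distrib]
    refine Finset.sum_congr rfl fun q _ => ?_
    rw [← Finset.sum_smul, smul_smul, ← sub_smul, hcol, mul_smul]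
  have hl : ∀ g, lam g = g.eval (a i) • lam 1 := fun g => by
    induction g using Polynomial.induction_on with
    | C c => rw [eval_C, ← mul_one (C c), ← smul_eq_C_mul, map_smul]
    | add p q hp hq => rw [map_add, hp, hq, eval_add, add_smul]
    | monomial k c ih =>
      rw [pow_succ', mul_left_comm, hlX, ih, smul_smul]
      simp only [eval_mul, eval_X]
  have hl1 : lam 1 = (∏ j ∈ Finset.Ioi i, (1 - (a i - a j)⁻¹)) • v := by
    simp only [lam, LinearMap.sum_apply, LinearMap.smul_apply, h1]
    rw [← Finset.sum_smul, Finset.prod_one_sub_ordered, UModJ.sum_univ_split i, hwi,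
      Finset.sum_eq_zero fun r hr => hw0 r (Finset.mem_Iio.1 hr), zero_add, sub_eq_add_neg,
      ← Finset.sum_neg_distrib]
    congr 2
    refine Finset.sum_congr rfl fun s hs => ?_
    rw [hwr s (Finset.mem_Ioi.1 hs)]
    refine congrArg (fun z => -(_ * z)) (Finset.prod_congr ?_ fun _ _ => rfl)
    ext j
    simp only [Finset.mem_filter, Finset.mem_Ioo, Finset.mem_Ioi]
  -- Entries below i have weight zero, and those above i vanish because the Lagrange polynomial is
  -- zero at all nodes from there on.
  have hfin : lam (Lagrange.basis Finset.univ a i) = u i (Lagrange.basis Finset.univ a i) := by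
    simp only [lam, LinearMap.sum_apply, LinearMap.smul_apply]
    rw [Finset.sum_eq_single i, hwi, one_smul]
    · intro r _ hr
      rcases lt_or_gt_of_ne hr with h | h
      · rw [hw0 r h, zero_smul]
      · rw [hvan r _ fun q hq => Lagrange.eval_basis_of_ne (h.trans_le hq).ne (Finset.mem_univ q),
          smul_zero]
    · exact fun h => absurd (Finset.mem_univ i) h
  rw [← hfin, hl, Lagrange.eval_basis_self ha.injOn (Finset.mem_univ i), one_smul, hl1]

end Triangular

namespace UModJ

/-! ### Columns -/

/-- Columns of length `m` of elements of `U'(gl(m|n)) / J`. -/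
abbrev Col (m n : ℕ) : Type := Fin m → UModJ m n

/-- The action of the matrix `(E_{jq})` on columns. -/
def colMul (m n : ℕ) : Module.End (CartanField m) (Col m n) :=
  LinearMap.pi fun j => ∑ q, (lmul (e j q : UExt m n)).comp (LinearMap.proj q)

theorem colMul_apply (x : Col m n) (j : Fin m) :
    colMul m n x j = ∑ q, (e j q : UExt m n) • x q := by
  simp [colMul, lmul_apply]

/-- The action of `E_{pq}` on columns, twisted by the dual of the vector representation. -/
def colAct (p q : Fin m) : Module.End (CartanField m) (Col m n) :=
  LinearMap.pi fun j =>
    (lmul (e p q : UExt m n)).comp (LinearMap.proj (φ := fun _ => UModJ m n) j)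
      - if q = j then LinearMap.proj p else 0

theorem colAct_apply (p q : Fin m) (x : Col m n) (j : Fin m) :
    colAct p q x j = (e p q : UExt m n) • x j - if q = j then x p else 0 := by
  simp only [colAct, LinearMap.pi_apply, LinearMap.sub_apply]
  split_ifs <;> rfl

/-- The matrix (E_{jq}) is invariant when gl(m) acts on its entries by brackets and on its indices
by the dual twist. -/
theorem colAct_commute_colMul (p q : Fin m) : Commute (colAct p q) (colMul m n) := by
  refine LinearMap.ext fun x => funext fun j => ?_
  simp only [Module.End.mul_apply, colAct_apply, colMul_apply, smul_sub, Finset.smul_sum,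
    Finset.sum_sub_distrib, e_smul_e_smul p q j, Finset.sum_add_distrib, Finset.sum_ite_irrel,
    smul_ite, smul_zero, Finset.sum_ite_eq, Finset.mem_univ, if_true,
    Finset.sum_const_zero]
  abel

/-- The column with the single entry `1` in the place `r`. -/
def colVac (r : Fin m) : Col m n := Pi.single r (vac m n)

theorem colVac_apply (r j : Fin m) : (colVac r : Col m n) j = if j = r then vac m n else 0 := by
  rw [colVac, Pi.single_apply]

theorem colAct_colVac {p q : Fin m} (h : p < q) (r : Fin m) :
    colAct p q (colVac r : Col m n) = -(if p = r then colVac q else 0) := by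
  funext j
  rw [colAct_apply, colVac_apply, colVac_apply, smul_ite, e_smul_vac h, smul_zero, ite_self, zero_sub,
    Pi.neg_apply]
  congr 1
  split_ifs with h1 h2 h2
  · rw [colVac_apply, if_pos h1.symm]
  · rfl
  · rw [colVac_apply, if_neg (Ne.symm h1)]
  · rfl

theorem colAct_self_colVac (s r : Fin m) : colAct s s (colVac r : Col m n)
    = (cartanE s - if s = r then 1 else 0 : CartanField m) • colVac r := by
  funext j
  rw [colAct_apply, Pi.smul_apply, colVac_apply, colVac_apply, smul_ite, hasWt_vac s, smul_zero]
  by_cases h1 : s = r <;> by_cases h2 : s = j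
  · subst h1; subst h2; simp [sub_smul]
  · subst h1; simp [h2, Ne.symm h2]
  · subst h2; simp [h1]
  · by_cases h3 : j = r <;> simp [h1, h2, h3]

/-- The column `g(E)` applied to the `r`-th unit column. -/
def colPoly (r : Fin m) (g : (CartanField m)[X]) : Col m n := aeval (colMul m n) g (colVac r)

theorem colPoly_one (r : Fin m) : (colPoly r 1 : Col m n) = colVac r := by
  rw [colPoly, map_one, Module.End.one_apply]

theorem colPoly_X_mul (r : Fin m) (g : (CartanField m)[X]) :
    (colPoly r (X * g) : Col m n) = colMul m n (colPoly r g) := by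
  rw [colPoly, map_mul, aeval_X, Module.End.mul_apply, colPoly]

/-- The columns `colPoly r g`, linearly in `g`. -/
def colPolyHom (r : Fin m) : (CartanField m)[X] →ₗ[CartanField m] Col m n :=
  (LinearMap.applyₗ (colVac r)).comp (aeval (colMul m n)).toLinearMap

theorem colPolyHom_apply (r : Fin m) (g : (CartanField m)[X]) :
    colPolyHom r g = (colPoly r g : Col m n) := rfl

theorem colAct_colPoly (p q r : Fin m) (g : (CartanField m)[X]) :
    colAct p q (colPoly r g : Col m n) = aeval (colMul m n) g (colAct p q (colVac r)) :=
  congrArg (fun F : Module.End (CartanField m) (Col m n) => F (colVac r))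
    (commute_aeval (colAct_commute_colMul p q) g).eq

theorem colAct_colPoly_of_lt {p q : Fin m} (h : p < q) (r : Fin m) (g : (CartanField m)[X]) :
    colAct p q (colPoly r g : Col m n) = -(if p = r then colPoly q g else 0) := by
  rw [colAct_colPoly, colAct_colVac h, map_neg]
  split_ifs
  · rfl
  · rw [map_zero]

theorem e_smul_colPoly {p q : Fin m} (h : p < q) (r j : Fin m) (g : (CartanField m)[X]) :
    (e p q : UExt m n) • (colPoly r g : Col m n) j
      = (if q = j then colPoly r g p else 0) - if p = r then (colPoly q g : Col m n) j else 0 := by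
  have h1 := congrFun (colAct_colPoly_of_lt (n := n) h r g) j
  rw [colAct_apply, sub_eq_iff_eq_add] at h1
  rw [h1, Pi.neg_apply, add_comm, ← sub_eq_add_neg]
  congr 1
  split_ifs <;> rfl

theorem hasWt_colPoly (r k : Fin m) (g : (CartanField m)[X]) : HasWt ((colPoly r g : Col m n) k)
    fun s => cartanE s + (if s = k then 1 else 0) - if s = r then 1 else 0 := fun s => by
  have h := congrFun (colAct_colPoly (n := n) s s r g) k
  rw [colAct_self_colVac, map_smul, colAct_apply, sub_eq_iff_eq_add] at h
  rw [h, Pi.smul_apply, ← colPoly]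
  change _ = (cartanE s + (if s = k then 1 else 0) - if s = r then 1 else 0 : CartanField m) • _
  by_cases h1 : s = k
  · subst h1
    rw [if_pos rfl, if_pos rfl, add_sub_right_comm, add_smul _ (1 : CartanField m), one_smul]
  · rw [if_neg h1, if_neg h1, add_zero, add_zero]

/-- The induction covers all j < r at once. Entries at q ≥ r are multiplied by E_{jq} with j < q,
which brings them back to the vanishing entry j. -/
theorem colPoly_of_lt {r j : Fin m} (h : j < r) (g : (CartanField m)[X]) :
    (colPoly r g : Col m n) j = 0 := by
  induction g using Polynomial.induction_on generalizing j with
  | C c =>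
    rw [← mul_one (C c), ← smul_eq_C_mul, ← colPolyHom_apply, map_smul, colPolyHom_apply, colPoly_one,
      Pi.smul_apply, colVac_apply, if_neg h.ne, smul_zero]
  | add p q hp hq =>
    rw [← colPolyHom_apply, map_add, Pi.add_apply, colPolyHom_apply, colPolyHom_apply, hp h, hq h,
      add_zero]
  | monomial k c ih =>
    rw [pow_succ', mul_left_comm, colPoly_X_mul, colMul_apply]
    refine Finset.sum_eq_zero fun q _ => ?_
    rcases lt_or_ge q r with hq | hq
    · rw [ih hq, smul_zero]
    · rw [e_smul_colPoly (h.trans_le hq), if_pos rfl, ih h, if_neg h.ne, sub_zero]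

/-- For q > r, E_{rq} acting on the q-th entry yields the difference of the r-th and q-th diagonal
entries. So the diagonal entries satisfy a closed recursion, the one solved by `diag_basis_eq`. -/
theorem colPoly_X_mul_self (r : Fin m) (g : (CartanField m)[X]) :
    (colPoly r (X * g) : Col m n) r = (cartanH r + ((m : CartanField m) - 1)) • colPoly r g r
      - ∑ q ∈ Finset.Ioi r, (colPoly q g : Col m n) q := by
  have hr := r.2
  rw [colPoly_X_mul, colMul_apply, sum_univ_split r, Finset.sum_eq_zero fun q hq => by
    rw [colPoly_of_lt (Finset.mem_Iio.1 hq), smul_zero], zero_add, hasWt_colPoly r r g r,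
    Finset.sum_congr rfl fun q hq => by
      rw [e_smul_colPoly (Finset.mem_Ioi.1 hq), if_pos rfl, if_pos rfl], Finset.sum_sub_distrib,
    Finset.sum_const, Fin.card_Ioi, ← Nat.cast_smul_eq_nsmul (CartanField m), ← add_sub_assoc,
    ← add_smul, Nat.cast_sub (by omega), Nat.cast_sub (by omega), Nat.cast_one]
  congr 2
  simp only [if_true, cartanH]
  ring

theorem colPoly_nodePoly_self (i : Fin m) :
    (colPoly i (nodePoly m ((m : CartanField m) - 1) i) : Col m n) i
      = (∏ j ∈ Finset.Ioi i, (1 - (cartanH i - cartanH j)⁻¹) : CartanField m) • vac m n := by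
  have h := diag_basis_eq (node_injective ((m : CartanField m) - 1))
    (u := fun r => (LinearMap.proj r).comp (colPolyHom (n := n) r)) (v := vac m n)
    (fun r g => colPoly_X_mul_self r g)
    (fun r => by
      change (colPoly r 1 : Col m n) r = _
      rw [colPoly_one, colVac_apply, if_pos rfl]) i
  simp only [add_sub_add_right_eq_sub] at h
  exact h

/-- Writing the off-diagonal terms with the operators `colAct`, which commute with `colMul`, puts
the matrix into the triangular form required by `aeval_eq_zero_of_triangular`. The nodes are h_k + m
- 1. -/
theorem colMul_colVac (k : Fin m) : colMul m n (colVac k)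
    = (cartanH k + ((m : CartanField m) - 1)) • colVac k
      + ∑ j ∈ Finset.Ioi k, colAct j k (colVac j) := by
  have hk := k.2
  have h1 : ∀ j ∈ Finset.Ioi k, colAct j k (colVac j : Col m n)
      = Pi.single j ((e j k : UExt m n) • vac m n) - colVac k := fun j hj => by
    funext l
    rw [colAct_apply, Pi.sub_apply, colVac_apply, colVac_apply, colVac_apply, if_pos rfl,
      Pi.single_apply, smul_ite, smul_zero]
    simp only [eq_comm]
  rw [Finset.sum_congr rfl h1, Finset.sum_sub_distrib, Finset.sum_const, Fin.card_Ioi,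
    ← Nat.cast_smul_eq_nsmul (CartanField m), Nat.cast_sub (by omega), Nat.cast_sub (by omega),
    Nat.cast_one]
  have h2 : colMul m n (colVac k) = ∑ j, Pi.single j ((e j k : UExt m n) • vac m n) := by
    funext j
    rw [colMul_apply, Finset.sum_apply, Finset.sum_eq_single k, Finset.sum_eq_single j, colVac_apply,
      if_pos rfl, Pi.single_eq_same]
    · intro l _ hl; rw [Pi.single_eq_of_ne (Ne.symm hl)]
    · exact fun h => absurd (Finset.mem_univ j) h
    · intro l _ hl; rw [colVac_apply, if_neg hl, smul_zero]
    · exact fun h => absurd (Finset.mem_univ k) h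
  rw [h2, sum_univ_split k, Finset.sum_eq_zero fun j hj => by
    rw [e_smul_vac (Finset.mem_Iio.1 hj), Pi.single_zero], zero_add, hasWt_vac k, Pi.single_smul,
    ← colVac]
  rw [show ∀ (x y z : Col m n), x + (y - z) = (x - z) + y from fun x y z => by abel, ← sub_smul]
  congr 2
  rw [cartanH]
  ring

theorem colPoly_eq_zero {k : Fin m} {g : (CartanField m)[X]}
    (hg : ∀ q, k ≤ q → g.eval (cartanH q + ((m : CartanField m) - 1)) = 0) :
    (colPoly k g : Col m n) = 0 :=
  aeval_eq_zero_of_triangular (r := (· > ·)) wellFounded_gt (fun _ _ _ h1 h2 => lt_trans h2 h1)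
    (node_injective ((m : CartanField m) - 1)) Finset.Ioi (fun _ _ hq => Finset.mem_Ioi.1 hq)
    (fun k q => colAct q k) (fun k q => colAct_commute_colMul q k) colMul_colVac k g (hg k le_rfl)
    fun q hq => hg q (le_of_lt hq)

/-- This is the k-th entry of the eigenvector equation for g_i(E)e_i. It has the shape of
`sub_smul_upPart` except for the extra -1 on the left. -/
theorem sub_smul_colPoly {i k : Fin m} (h : i < k) :
    (cartanH i - cartanH k - 1) • (colPoly i (nodePoly m ((m : CartanField m) - 1) i) : Col m n) k
      = ∑ q ∈ Finset.Iio k, (e k q : UExt m n)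
        • (colPoly i (nodePoly m ((m : CartanField m) - 1) i) : Col m n) q := by
  have hk := k.2
  set g := nodePoly m ((m : CartanField m) - 1) i with hg
  have h0 := colPoly_eq_zero (n := n) (k := i)
    (g := (X - C (cartanH i + ((m : CartanField m) - 1))) * g) fun q _ =>
      sub_mul_basis_eval_eq_zero (α := fun k : Fin m => cartanH k + ((m : CartanField m) - 1)) i q
  rw [sub_mul, ← colPolyHom_apply, map_sub, ← smul_eq_C_mul, map_smul, colPolyHom_apply,
    colPolyHom_apply, colPoly_X_mul, sub_eq_zero] at h0
  have h1 := congrFun h0 k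
  rw [colMul_apply, sum_univ_split k, hasWt_colPoly i k g k,
    Finset.sum_congr (s₁ := Finset.Ioi k) rfl fun q hq => by
      rw [e_smul_colPoly (Finset.mem_Ioi.1 hq), if_pos rfl, if_neg h.ne', sub_zero],
    Finset.sum_const, Fin.card_Ioi, ← Nat.cast_smul_eq_nsmul (CartanField m), add_assoc,
    ← add_smul, Nat.cast_sub (by omega), Nat.cast_sub (by omega), Nat.cast_one,
    Pi.smul_apply] at h1
  rw [eq_sub_of_add_eq h1, ← sub_smul]
  congr 1
  simp only [if_true, if_neg h.ne', cartanH]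
  ring

end UModJ

end MickelssonZhelobenko

end

noncomputable section

namespace MickelssonZhelobenko

open Polynomial UExt

variable {m n : ℕ}

namespace UModJ

/-! ### The vectors `E_{ak}` -/

/-- The pairing of a column with the row `(E_{ak})`. -/
def pairing (a : Fin n) : Col m n →ₗ[CartanField m] UModJ m n :=
  ∑ k, (lmul (E (.inr a) (.inl k) : UExt m n)).comp (LinearMap.proj (φ := fun _ => UModJ m n) k)

theorem pairing_apply (a : Fin n) (x : Col m n) :
    pairing a x = ∑ k, (E (.inr a) (.inl k) : UExt m n) • x k := by
  simp [pairing, lmul_apply]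

theorem e_smul_pairing (p q : Fin m) (a : Fin n) (x : Col m n) :
    (e p q : UExt m n) • pairing a x = pairing a (colAct p q x) := by
  simp only [pairing_apply, colAct_apply, Finset.smul_sum, smul_sub, Finset.sum_sub_distrib,
    ← mul_smul, e_mul_E_inr, sub_smul, smul_ite, smul_zero, ite_smul, zero_smul, Finset.sum_ite_eq,
    Finset.mem_univ, if_true]

/-- The image of `E_{ak}` in `U'(gl(m|n)) / J`. -/
def down (a : Fin n) (k : Fin m) : UModJ m n := (E (.inr a) (.inl k) : UExt m n) • vac m n

theorem pairing_colVac (a : Fin n) (k : Fin m) : pairing a (colVac k) = (down a k : UModJ m n) := by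
  rw [pairing_apply, Finset.sum_eq_single k, colVac_apply, if_pos rfl, down]
  · intro l _ hl; rw [colVac_apply, if_neg hl, smul_zero]
  · exact fun h => absurd (Finset.mem_univ k) h

theorem e_smul_down {p q : Fin m} (h : p < q) (a : Fin n) (k : Fin m) :
    (e p q : UExt m n) • down a k = -(if p = k then down a q else 0 : UModJ m n) := by
  rw [← pairing_colVac, e_smul_pairing, colAct_colVac h, map_neg]
  split_ifs
  · rw [pairing_colVac]
  · rw [map_zero]

theorem sqZero_down (d k : Fin m) (a : Fin n) : SqZero d (down a k : UModJ m n) :=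
  fun q r hq hr => by
    rw [e_smul_down hr]
    split_ifs
    · rw [smul_neg, e_smul_down hq, if_neg hr.ne, neg_zero, neg_zero]
    · rw [neg_zero, smul_zero]

theorem hasWt_down (a : Fin n) (k : Fin m) :
    HasWt (down a k : UModJ m n) fun j => cartanE j + if j = k then -1 else 0 := fun j => by
  rw [← pairing_colVac, e_smul_pairing, colAct_self_colVac, map_smul]
  change _ = (cartanE j + (if j = k then -1 else 0) : CartanField m) • _
  congr 1
  split_ifs <;> ring

/-- The operator `m - Ω`; it acts on the vectors `E_{ak}` as the transposed matrix `(E_{lk})`. -/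
def dualOmega (m n : ℕ) : Module.End (CartanField m) (UModJ m n) :=
  algebraMap (CartanField m) _ (m : CartanField m) - Omega m n

theorem dualOmega_apply (v : UModJ m n) :
    dualOmega m n v = (m : CartanField m) • v - Omega m n v := rfl

theorem Omega_vac : Omega m n (vac m n) = ((2 : CartanField m)⁻¹ * (m : CartanField m)) • vac m n := by
  rw [Omega_apply, casimir_smul_vac, ← add_smul, smul_smul]
  congr 2
  ring

/-- The entries arise from the class of 1 by gl(m) and R(h), with which the Casimir element
commutes. -/
theorem Omega_colPoly (r k : Fin m) (g : (CartanField m)[X]) :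
    Omega m n ((colPoly r g : Col m n) k)
      = ((2 : CartanField m)⁻¹ * (m : CartanField m)) • (colPoly r g : Col m n) k := by
  have hc : Commute ((Omega m n).compLeft (Fin m)) (colMul m n) := by
    refine LinearMap.ext fun x => funext fun j => ?_
    simp only [Module.End.mul_apply, LinearMap.compLeft_apply, Function.comp_apply, colMul_apply,
      map_sum]
    refine Finset.sum_congr rfl fun q _ => ?_
    have h := smul_aeval_Omega (n := n) j q X (x q)
    rw [aeval_X] at h
    exact h.symm
  have h1 : (Omega m n).compLeft (Fin m) (colVac r)
      = ((2 : CartanField m)⁻¹ * (m : CartanField m)) • colVac r := by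
    funext j
    rw [LinearMap.compLeft_apply, Function.comp_apply, Pi.smul_apply, colVac_apply]
    split_ifs
    · exact Omega_vac
    · rw [map_zero, smul_zero]
  have h2 := congrArg (fun F : Module.End (CartanField m) (Col m n) => F (colVac r))
    (commute_aeval hc g).eq
  simp only [Module.End.mul_apply, h1, map_smul] at h2
  exact congrFun h2 k

theorem dualOmega_pairing_colPoly (a : Fin n) (r : Fin m) (g : (CartanField m)[X]) :
    dualOmega m n (pairing a (colPoly r g)) = pairing a (colMul m n (colPoly r g)) := by
  rw [dualOmega_apply, pairing_apply, Omega_E_inr a _ fun k => Omega_colPoly r k g, sub_sub_cancel,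
    pairing_apply]
  simp only [colMul_apply]

/-- The pairing turns the matrix acting on columns into the operator m - Ω on U'/J, so the
projection argument used for E_{kb} applies to E_{ak}. -/
theorem pairing_colPoly (a : Fin n) (r : Fin m) (g : (CartanField m)[X]) :
    pairing a (colPoly r g) = aeval (dualOmega m n) g (down a r) := by
  induction g using Polynomial.induction_on with
  | C c =>
    rw [← mul_one (C c), ← smul_eq_C_mul, ← colPolyHom_apply, map_smul, map_smul, colPolyHom_apply,
      colPoly_one, pairing_colVac, map_smul, map_one]
    rfl
  | add p q hp hq =>
    rw [← colPolyHom_apply, map_add, map_add, map_add, colPolyHom_apply, colPolyHom_apply, hp, hq]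
    rfl
  | monomial k c ih =>
    rw [pow_succ', mul_left_comm, colPoly_X_mul, ← dualOmega_pairing_colPoly, ih,
      map_mul (aeval (dualOmega m n)) X, aeval_X, Module.End.mul_apply]

/-- The component of the column `colVac i` whose pairings with the rows `(E_{ak})` are singular. -/
def colPart (i : Fin m) : Col m n := colPoly i (nodePoly m ((m : CartanField m) - 1) i)

theorem singular_pairing_colPart (a : Fin n) (i : Fin m) :
    Singular (pairing a (colPart i) : UModJ m n) := fun p q h => by
  rw [e_smul_pairing, colPart, colAct_colPoly_of_lt h]
  split_ifs with hp
  · subst hp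
    rw [colPoly_eq_zero fun s hs => nodePoly_eval_of_ne _ (h.trans_le hs).ne, neg_zero, map_zero]
  · rw [neg_zero, map_zero]

/-- As for `extremalProjector_up`, with m - Ω in place of Ω; its eigenvalue on p E_{ai} is h_i + m -
1. -/
theorem extremalProjector_down (a : Fin n) (i : Fin m) :
    extremalProjector (down a i) = (pairing a (colPart i) : UModJ m n) := by
  have hs : Singular (extremalProjector (down a i : UModJ m n)) :=
    singular_extremalProjector fun d => sqZero_down d i a
  have hΩ := Omega_of_singular hs (hasWt_down a i).extremalProjector
  have hd : dualOmega m n (extremalProjector (down a i))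
      = (cartanH i + ((m : CartanField m) - 1)) • extremalProjector (down a i) := by
    rw [dualOmega_apply, hΩ, ← sub_smul]
    congr 1
    rw [cartanH]; field_simp; ring
  have hc1 : ∀ p q, Commute (lmul (e p q : UExt m n)) (dualOmega m n) := fun p q =>
    Commute.sub_right (Algebra.commutes _ _).symm (lmul_e_commute_Omega p q)
  have hc2 : ∀ f, Commute (lmul (UExt.ofCartan m n f)) (dualOmega m n) := fun f =>
    Commute.sub_right (Algebra.commutes _ _).symm (lmul_ofCartan_commute_Omega f)
  rw [← extremalProjector_of_singular (singular_pairing_colPart a i), colPart, pairing_colPoly,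
    extremalProjector_apply_of_commute (fun p q => commute_aeval (hc1 p q) _)
      (fun f => commute_aeval (hc2 f) _), aeval_apply_of_eigen hd, nodePoly_eval_self, one_smul]

/-! ### Products of the raising and lowering elements -/

theorem rmul_smul_vac (z : normJ m n) (x : UExt m n) :
    rmul z (x • vac m n) = x • (Submodule.Quotient.mk z.1 : UModJ m n) := by
  rw [smul_vac, rmul_mk, ← Submodule.Quotient.mk_smul, smul_eq_mul]

theorem rmul_vac (z : normJ m n) : rmul z (vac m n) = Submodule.Quotient.mk z.1 := by
  simpa using rmul_smul_vac z 1

theorem rmul_smul {z : normJ m n} {f g : CartanField m}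
    (h : UExt.ofCartan m n f • (Submodule.Quotient.mk z.1 : UModJ m n)
      = g • (Submodule.Quotient.mk z.1 : UModJ m n)) (v : UModJ m n) :
    rmul z (f • v) = g • rmul z v := by
  obtain ⟨x, rfl⟩ := exists_smul_vac v
  rw [← smul_comm x f, ← ofCartan_smul_vac, map_smul, map_smul, map_smul, rmul_vac, h, smul_comm]

/-- The elements `f` of `R(h)` that act from the left on `v` as `g` does from the right. -/
def Passes (v : UModJ m n) (f g : CartanField m) : Prop := UExt.ofCartan m n f • v = g • v

theorem Passes.mul {v : UModJ m n} {f g f' g' : CartanField m} (h : Passes v f g)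
    (h' : Passes v f' g') : Passes v (f * f') (g * g') := by
  rw [Passes, map_mul, mul_smul, h', smul_comm, h, smul_smul, mul_comm]

theorem Passes.one (v : UModJ m n) : Passes v 1 1 := by
  rw [Passes, map_one, one_smul, one_smul]

theorem Passes.sub {v : UModJ m n} {f g f' g' : CartanField m} (h : Passes v f g)
    (h' : Passes v f' g') : Passes v (f - f') (g - g') := by
  rw [Passes, map_sub, sub_smul, sub_smul, h, h']

theorem Passes.inv {v : UModJ m n} {f g : CartanField m} (hf : f ≠ 0) (hg : g ≠ 0)
    (h : Passes v f g) : Passes v f⁻¹ g⁻¹ := by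
  have h1 : UExt.ofCartan m n f⁻¹ • UExt.ofCartan m n f • v = v := by
    rw [← mul_smul, ← map_mul, inv_mul_cancel₀ hf, map_one, one_smul]
  rw [h, smul_comm] at h1
  rw [Passes, ← one_smul (CartanField m) (UExt.ofCartan m n f⁻¹ • v), ← inv_mul_cancel₀ hg, mul_smul,
    h1]

theorem Passes.prod {ι : Type*} {v : UModJ m n} {s : Finset ι} {f g : ι → CartanField m}
    (h : ∀ j ∈ s, Passes v (f j) (g j)) : Passes v (∏ j ∈ s, f j) (∏ j ∈ s, g j) := by
  classical
  induction s using Finset.induction_on with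
  | empty => exact Passes.one v
  | insert a s ha ih =>
    rw [Finset.prod_insert ha, Finset.prod_insert ha]
    exact (h a (Finset.mem_insert_self a s)).mul (ih fun j hj => h j (Finset.mem_insert_of_mem hj))

/-- A vector of the weight of E_{ib} raises h_i by one and leaves the other h_k unchanged. -/
theorem Passes.cartanH_sub {v : UModJ m n} {i : Fin m}
    (hv : HasWt v fun j => cartanE j + if j = i then 1 else 0) {k : Fin m} (hk : k ≠ i) :
    Passes v (cartanH i - cartanH k) (cartanH i - cartanH k + 1) := by
  have h1 := hv i
  have h2 := hv k
  simp only [if_true, if_neg hk] at h1 h2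
  have h3 : (UExt.ofCartan m n (cartanH i - cartanH k) : UExt m n)
      = e i i - e k k - ((((i : ℕ) : ℤ) - ((k : ℕ) : ℤ) : ℤ) : UExt m n) := by
    rw [e_sub_e, map_add, map_intCast]
    push_cast
    abel
  rw [Passes, h3, sub_smul, sub_smul, h1, h2, Int.cast_smul_eq_zsmul,
    ← Int.cast_smul_eq_zsmul (CartanField m), ← sub_smul, ← sub_smul]
  congr 1
  simp only [cartanH]
  push_cast
  ring

/-- The sum `∑_k E_{ak} E_{kb}` with `E_{kb}` replaced by its component in the `i`-th eigenspace. -/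
def tau (a : Fin n) (i : Fin m) (b : Fin n) : UModJ m n :=
  ∑ k, (E (.inr a) (.inl k) : UExt m n) • upPart i k b

section Product

variable {z : normJ m n} {i : Fin m} {b : Fin n}

/-- Induction on k. Both sides vanish for k < i, and k = i is the diagonal entry with each h_i
raised by one in passing z. For k > i the factor h_i - h_k - 1 of the column recursion becomes h_i -
h_k in passing z, which matches the recursion of `upPart`. -/
theorem rmul_colPart (hz : (Submodule.Quotient.mk z.1 : UModJ m n) = upPart i i b) (k : Fin m) :
    rmul z ((colPart i : Col m n) k)
      = (∏ j ∈ Finset.Ioi i, (1 - (cartanH i - cartanH j + 1)⁻¹) : CartanField m) • upPart i k b := by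
  have hw := hasWt_upPart (n := n) i b
  induction k using WellFoundedLT.induction with
  | _ k ih =>
    rcases lt_trichotomy k i with hk | hk | hk
    · rw [colPart, colPoly_of_lt hk, upPart_of_lt hk, map_zero, smul_zero]
    · subst hk
      rw [colPart, colPoly_nodePoly_self, rmul_smul (g := ∏ j ∈ Finset.Ioi k,
        (1 - (cartanH k - cartanH j + 1)⁻¹)), rmul_vac, hz]
      rw [hz]
      refine Passes.prod fun j hj => (Passes.one _).sub ?_
      have hjk := (Finset.mem_Ioi.1 hj).ne
      exact (Passes.cartanH_sub hw hjk.symm).inv (cartanH_sub_ne_zero hjk)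
        (by simpa using cartanH_sub_add_ne_zero hjk 1)
    · have h1 : Passes (upPart i i b) (cartanH i - cartanH k - 1) (cartanH i - cartanH k + 1 - 1) :=
        (Passes.cartanH_sub hw hk.ne').sub (Passes.one (upPart i i b : UModJ m n))
      rw [add_sub_cancel_right, ← hz] at h1
      refine smul_right_injective (UModJ m n) (cartanH_sub_ne_zero hk.ne) ?_
      change (cartanH i - cartanH k) • _ = (cartanH i - cartanH k) • _
      rw [← rmul_smul h1, colPart, sub_smul_colPoly hk, smul_comm (cartanH i - cartanH k),
        sub_smul_upPart, map_sum, Finset.smul_sum]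
      refine Finset.sum_congr rfl fun q hq => ?_
      rw [map_smul, ← colPart, ih q (Finset.mem_Iio.1 hq), smul_comm]

theorem rmul_pairing_colPart (hz : (Submodule.Quotient.mk z.1 : UModJ m n) = upPart i i b)
    (a : Fin n) : rmul z (pairing a (colPart i))
      = (∏ j ∈ Finset.Ioi i, (1 - (cartanH i - cartanH j + 1)⁻¹) : CartanField m) • tau a i b := by
  rw [pairing_apply, map_sum, tau, Finset.smul_sum]
  refine Finset.sum_congr rfl fun k _ => ?_
  rw [map_smul, rmul_colPart hz, smul_comm]

end Product

theorem raising_eq (i : Fin m) (b : Fin n) : (raising i b : UModJ m n)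
    = (∏ j ∈ Finset.Iio i, (cartanH i - cartanH j) : CartanField m) • upPart i i b := by
  rw [raising, ← smul_mk, ← smul_vac, extremalProjector_smul, ← up, extremalProjector_up,
    Finset.filter_gt_eq_Iio]

theorem lowering_eq (a : Fin n) (i : Fin m) : (lowering a i : UModJ m n)
    = (∏ j ∈ Finset.Ioi i, (cartanH i - cartanH j) : CartanField m) • pairing a (colPart i) := by
  rw [lowering, ← smul_mk, ← smul_vac, extremalProjector_smul, ← down, extremalProjector_down,
    Finset.filter_lt_eq_Ioi]

theorem Singular.smul {v : UModJ m n} (hv : Singular v) (f : CartanField m) : Singular (f • v) :=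
  fun p q h => by rw [smul_comm, hv p q h, smul_zero]

/-- Being singular means E_{ij} x ∈ J for the generators of J, which suffices for x to normalize J.
-/
theorem exists_normJ {v : UModJ m n} (hv : Singular v) :
    ∃ z : normJ m n, (Submodule.Quotient.mk z.1 : UModJ m n) = v := by
  obtain ⟨x, rfl⟩ := Submodule.Quotient.mk_surjective _ v
  refine ⟨⟨x, mem_normJ_of_gen fun i j hij => ?_⟩, rfl⟩
  rw [← Submodule.Quotient.mk_eq_zero, ← smul_eq_mul, Submodule.Quotient.mk_smul]
  exact hv i j hij

end UModJ

/-! ### Products z_{ai} z_{ib} and the image of the Olshanski map. -/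

namespace MZ

open UModJ

theorem exists_incl_eq {v : UModJ m n} (hv : Singular v) : ∃ z, incl m n z = v := by
  obtain ⟨z, hz⟩ := exists_normJ hv
  exact ⟨Ideal.Quotient.mk _ z, hz⟩

theorem exists_incl_raising (i : Fin m) (b : Fin n) : ∃ z, incl m n z = raising i b :=
  exists_incl_eq (raising_eq (n := n) i b ▸ (singular_upPart i b).smul _)

theorem exists_incl_lowering (a : Fin n) (i : Fin m) : ∃ z, incl m n z = lowering a i :=
  exists_incl_eq (lowering_eq (n := n) a i ▸ (singular_pairing_colPart a i).smul _)

theorem incl_mul_mk (x : MZ m n) (z : normJ m n) :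
    incl m n (x * Ideal.Quotient.mk _ z) = rmul z (incl m n x) := by
  obtain ⟨x, rfl⟩ := Ideal.Quotient.mk_surjective x
  rfl

theorem incl_mul_ofCartan (x : MZ m n) (f : CartanField m) :
    incl m n (x * MZ.ofCartan m n f) = f • incl m n x :=
  incl_mul_mk x _

/-- The factors h_i - h_j with j > i in z_{ai} become h_i - h_j + 1 in passing p E_{ib}. Multiplied
by 1 - 1/(h_i - h_j + 1) they return to h_i - h_j, and the factors with j < i come from z_{ib}. -/
theorem incl_lowering_mul_raising {a b : Fin n} {i : Fin m} {x y : MZ m n}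
    (hx : incl m n x = lowering a i) (hy : incl m n y = raising i b) :
    incl m n (x * y) = (∏ j ∈ Finset.univ.erase i, (cartanH i - cartanH j) : CartanField m)
      • tau a i b := by
  obtain ⟨z, hz⟩ := exists_normJ (singular_upPart (n := n) i b)
  obtain ⟨y, rfl⟩ := Ideal.Quotient.mk_surjective y
  have hr : ∀ v, rmul y v = (∏ j ∈ Finset.Iio i, (cartanH i - cartanH j) : CartanField m) • rmul z v :=
    fun v => by
      obtain ⟨x, rfl⟩ := exists_smul_vac v
      rw [rmul_smul_vac, rmul_smul_vac, hz, ← incl_mk, hy, raising_eq, smul_comm]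
  have hp : Passes (upPart i i b : UModJ m n) (∏ j ∈ Finset.Ioi i, (cartanH i - cartanH j))
      (∏ j ∈ Finset.Ioi i, (cartanH i - cartanH j + 1)) := Passes.prod fun j hj =>
    Passes.cartanH_sub (hasWt_upPart i b) (Finset.mem_Ioi.1 hj).ne'
  rw [← hz] at hp
  rw [incl_mul_mk, hx, lowering_eq, hr, rmul_smul hp, rmul_pairing_colPart hz, smul_smul, smul_smul]
  congr 1
  rw [mul_assoc, ← Finset.prod_mul_distrib, Finset.prod_congr (s₁ := Finset.Ioi i) rfl
    (g := fun j => cartanH i - cartanH j) fun j hj => by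
      have h0 := cartanH_sub_add_ne_zero (Finset.mem_Ioi.1 hj).ne 1
      rw [Int.cast_one] at h0
      rw [mul_sub, mul_inv_cancel₀ h0, mul_one, add_sub_cancel_right], ← Finset.prod_union]
  · refine Finset.prod_congr ?_ fun _ _ => rfl
    ext j
    simp [lt_or_lt_iff_ne]
  · exact Finset.disjoint_left.2 fun j h1 h2 =>
      lt_asymm (Finset.mem_Iio.1 h1) (Finset.mem_Ioi.1 h2)

/-- The element `z_{ai} z_{ib} ∏_{j ≠ i} (h_i - h_j)⁻¹`. -/
def residue (zUp : Fin m → Fin n → MZ m n) (zDown : Fin n → Fin m → MZ m n) (a : Fin n) (i : Fin m)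
    (b : Fin n) : MZ m n :=
  zDown a i * zUp i b * MZ.ofCartan m n (∏ j ∈ Finset.univ.erase i, (cartanH i - cartanH j))⁻¹

section

variable {zUp : Fin m → Fin n → MZ m n} {zDown : Fin n → Fin m → MZ m n}

theorem incl_residue (hU : ∀ i a, incl m n (zUp i a) = raising i a)
    (hD : ∀ a i, incl m n (zDown a i) = lowering a i) (a : Fin n) (i : Fin m) (b : Fin n) :
    incl m n (residue zUp zDown a i b) = tau a i b := by
  rw [residue, incl_mul_ofCartan, incl_lowering_mul_raising (hD a i) (hU i b), smul_smul,
    inv_mul_cancel₀, one_smul]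
  exact Finset.prod_ne_zero_iff.2 fun j hj => cartanH_sub_ne_zero (Finset.ne_of_mem_erase hj).symm

/-- In U'/J the power E^s acts on the column (E_{lb}) as Ω^s, which is the right scalar (h_i + m)^s
on the i-th components. -/
theorem ofCentralizer_olshanskiHom_add_two (hU : ∀ i a, incl m n (zUp i a) = raising i a)
    (hD : ∀ a i, incl m n (zDown a i) = lowering a i) (a b : Fin n) (s : ℕ) :
    ofCentralizer m n (olshanskiHom m n (Yangian.t a b (s + 2)))
      = ∑ i, residue zUp zDown a i b
        * MZ.ofCartan m n ((cartanH i + (m : CartanField m)) ^ s) := by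
  refine incl_injective m n ?_
  rw [map_sum]
  simp only [incl_mul_ofCartan, incl_residue hU hD, tau, Finset.smul_sum]
  rw [Finset.sum_comm]
  have h0 : incl m n (ofCentralizer m n (olshanskiHom m n (Yangian.t a b (s + 2))))
      = UExt.ofUGl m n (olshanskiT m n a b (s + 2)) • vac m n := by
    rw [← coe_olshanskiHom_t, smul_vac]
    rfl
  have hM : ∀ k l, UExt.ofUGl m n (((Matrix.of fun k l : Fin m =>
        (UGl.E (Sum.inl k) (Sum.inl l) : UGl m n)) ^ s) k l)
      = ((Matrix.of fun k l : Fin m => (e k l : UExt m n)) ^ s) k l := fun k l => by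
    have h := congrFun (congrFun (map_pow (UExt.ofUGl m n).toRingHom.mapMatrix
      (Matrix.of fun k l : Fin m => (UGl.E (Sum.inl k) (Sum.inl l) : UGl m n)) s) k) l
    refine h.trans (congrArg (fun M : Matrix (Fin m) (Fin m) (UExt m n) => (M ^ s) k l) ?_)
    ext p q
    exact ofUGl_E _ _
  rw [h0, olshanskiT_add_two]
  simp only [map_sum, map_mul, ofUGl_E, hM, Finset.sum_smul, mul_smul]
  refine Finset.sum_congr rfl fun k _ => ?_
  have h1 : ∀ i : Fin m, (cartanH i + (m : CartanField m)) ^ s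
        • (UExt.E (Sum.inr a) (Sum.inl k) : UExt m n) • upPart i k b
      = (UExt.E (Sum.inr a) (Sum.inl k) : UExt m n) • (Omega m n ^ s) (upPart i k b) := fun i => by
    rw [Omega_pow_upPart, smul_comm]
  rw [Finset.sum_congr rfl fun i _ => h1 i, ← Finset.smul_sum, ← Finset.smul_sum, ← map_sum,
    sum_upPart, Omega_pow_up]
  rfl

end

end MZ

end MickelssonZhelobenko

end

noncomputable section

namespace MickelssonZhelobenko

open Polynomial

/-! ### Laurent series in `u⁻¹` -/

section AtInfinity

variable {A : Type} [Ring A]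

/-- `polyAtInfinity` as a ring homomorphism. -/
def polyAtInfinityHom (A : Type) [Ring A] : A[X] →+* HahnSeries ℤ A :=
  eval₂RingHom' HahnSeries.C (HahnSeries.single (-1) 1) fun a => by
    rw [Commute, SemiconjBy, HahnSeries.C_apply, HahnSeries.single_mul_single,
      HahnSeries.single_mul_single, add_comm, one_mul, mul_one]

theorem polyAtInfinityHom_apply (f : A[X]) : polyAtInfinityHom A f = polyAtInfinity f := by
  change eval₂ _ _ f = _
  rw [eval₂_eq_sum, polyAtInfinity]
  congr 1
  funext k c
  rw [HahnSeries.single_pow, HahnSeries.C_apply, HahnSeries.single_mul_single, one_pow, mul_one,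
    zero_add, smul_neg, nsmul_one]

theorem polyAtInfinityHom_C (a : A) : polyAtInfinityHom A (C a) = HahnSeries.C a :=
  eval₂_C _ _

theorem polyAtInfinityHom_X : polyAtInfinityHom A X = HahnSeries.single (-1) 1 :=
  eval₂_X _ _

variable {F : Type} [Field F] (ι : F →+* A)

/-- The series `∑_r f(r) u^{-r-1}`, with coefficients in the image of `F`. -/
def tailSeries (f : ℕ → F) : HahnSeries ℤ A :=
  HahnSeries.ofPowerSeries ℤ A (PowerSeries.X * PowerSeries.mk fun r => ι (f r))

/-- Polynomials over `F` as Laurent series in `u⁻¹` over `A`. -/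
def baseAtInfinity : F[X] →+* HahnSeries ℤ A := (polyAtInfinityHom A).comp (mapRingHom ι)

theorem baseAtInfinity_apply (f : F[X]) : baseAtInfinity ι f = polyAtInfinityHom A (f.map ι) := rfl

theorem baseAtInfinity_C (c : F) : baseAtInfinity ι (C c) = HahnSeries.C (ι c) := by
  rw [baseAtInfinity_apply, map_C, polyAtInfinityHom_C]

theorem baseAtInfinity_X_sub_C (c : F) :
    baseAtInfinity ι (X - C c) = HahnSeries.single (-1) 1 - HahnSeries.C (ι c) := by
  rw [map_sub, baseAtInfinity_C, baseAtInfinity_apply, map_X, polyAtInfinityHom_X]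

/-- The geometric series for 1/(u - c). The product in the other order is proved separately since A
is noncommutative. -/
theorem tailSeries_pow_mul (c : F) :
    tailSeries ι (fun r => c ^ r) * baseAtInfinity ι (X - C c) = 1 := by
  rw [baseAtInfinity_X_sub_C, mul_sub, tailSeries, (PowerSeries.commute_X _).symm.eq, map_mul,
    HahnSeries.ofPowerSeries_X, mul_assoc, HahnSeries.single_mul_single, ← HahnSeries.ofPowerSeries_C,
    ← HahnSeries.ofPowerSeries_X, ← map_mul, add_neg_cancel, mul_one, HahnSeries.single_zero_one,
    mul_one, ← map_mul, ← map_sub, ← map_one (HahnSeries.ofPowerSeries ℤ A)]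
  congr 1
  ext k
  rw [(PowerSeries.commute_X _).eq]
  cases k with
  | zero => simp
  | succ k => simp [PowerSeries.coeff_succ_X_mul, pow_succ, PowerSeries.coeff_one]

theorem mul_tailSeries_pow (c : F) :
    baseAtInfinity ι (X - C c) * tailSeries ι (fun r => c ^ r) = 1 := by
  rw [baseAtInfinity_X_sub_C, sub_mul, tailSeries, map_mul,
    HahnSeries.ofPowerSeries_X, ← mul_assoc, HahnSeries.single_mul_single,
    ← HahnSeries.ofPowerSeries_C, ← HahnSeries.ofPowerSeries_X, ← map_mul, neg_add_cancel, mul_one,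
    HahnSeries.single_zero_one, one_mul, ← map_mul, ← map_sub, ← map_one (HahnSeries.ofPowerSeries ℤ A)]
  congr 1
  ext k
  cases k with
  | zero => simp
  | succ k => simp [PowerSeries.coeff_succ_X_mul, pow_succ', PowerSeries.coeff_one]

theorem isUnit_baseAtInfinity_X_sub_C (c : F) : IsUnit (baseAtInfinity ι (X - C c)) :=
  ⟨⟨_, _, mul_tailSeries_pow ι c, tailSeries_pow_mul ι c⟩, rfl⟩

/-- The expansion of `1 / ((u - a) (u - b))`. -/
theorem tailSeries_div_mul {a b : F} (h : a ≠ b) :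
    tailSeries ι (fun r => (a ^ r - b ^ r) / (a - b)) * baseAtInfinity ι ((X - C b) * (X - C a))
      = 1 := by
  have h1 : tailSeries ι (fun r => (a ^ r - b ^ r) / (a - b))
      = (tailSeries ι (fun r => a ^ r) - tailSeries ι (fun r => b ^ r))
        * baseAtInfinity ι (C (a - b)⁻¹) := by
    rw [baseAtInfinity_C, ← HahnSeries.ofPowerSeries_C, tailSeries, tailSeries, tailSeries, ← map_sub,
      ← map_mul, ← mul_sub, mul_assoc]
    congr 2
    ext k
    simp [div_eq_mul_inv]
  rw [h1, mul_assoc, ← map_mul, mul_comm (C _), map_mul, ← mul_assoc, sub_mul]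
  nth_rewrite 1 [mul_comm (X - C b)]
  rw [map_mul, ← mul_assoc, tailSeries_pow_mul, one_mul, map_mul, ← mul_assoc, tailSeries_pow_mul,
    one_mul, ← map_sub, ← map_mul, sub_sub_sub_cancel_left, ← C_sub, ← C_mul,
    mul_inv_cancel₀ (sub_ne_zero.2 h), C_1, map_one]

theorem ofPowerSeries_mk_eq {κ : Type*} [Fintype κ] {T : ℕ → A} {d e : A} {y : κ → A} {f : ℕ → F}
    {g : κ → ℕ → F} (h0 : T 0 = d) (h : ∀ r, T (r + 1) = e * ι (f r) + ∑ i, y i * ι (g i r)) :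
    HahnSeries.ofPowerSeries ℤ A (PowerSeries.mk T) = HahnSeries.C d + HahnSeries.C e * tailSeries ι f
      + ∑ i, HahnSeries.C (y i) * tailSeries ι (g i) := by
  simp only [tailSeries, ← HahnSeries.ofPowerSeries_C, ← map_mul, ← map_sum, ← map_add]
  congr 1
  ext r
  cases r with
  | zero => simp [h0]
  | succ r => simp [h, PowerSeries.coeff_succ_X_mul]

end AtInfinity

variable {m n : ℕ}

theorem cartanH_add_ne_zero (i : Fin m) (c : ℤ) : cartanH i + (c : CartanField m) ≠ 0 := by
  intro h0
  have h1 : algebraMap (MvPolynomial (Fin m) ℂ) (CartanField m)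
      (MvPolynomial.X i + ((c - (i : ℕ) : ℤ) : MvPolynomial (Fin m) ℂ)) = 0 := by
    rw [map_add, map_intCast, ← h0, cartanH, cartanE]
    push_cast
    ring
  have h2 := IsFractionRing.injective (MvPolynomial (Fin m) ℂ) (CartanField m)
    (h1.trans (map_zero _).symm)
  have h3 := congrArg (MvPolynomial.eval (0 : Fin m → ℂ)) h2
  have h4 := congrArg (MvPolynomial.eval (1 : Fin m → ℂ)) h2
  simp only [map_add, MvPolynomial.eval_X, map_intCast, map_zero, Pi.zero_apply, Pi.one_apply,
    zero_add] at h3 h4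
  rw [h3, add_zero] at h4
  exact one_ne_zero h4

/-! ### The generating series of the composite homomorphism. -/

namespace MZ

/-- The homomorphism from the Yangian: the shift, followed by the super Olshanski homomorphism and
the natural projection. -/
def ofYangian (m n : ℕ) : Yangian n →ₐ[ℂ] MZ m n :=
  ((ofCentralizer m n).comp (olshanskiHom m n)).comp
    (Yangian.shiftEquiv n (m : ℂ) : Yangian n →ₐ[ℂ] Yangian n)

theorem ofYangian_t_zero (a b : Fin n) :
    ofYangian m n (Yangian.t a b 0) = if a = b then 1 else 0 := by
  rw [Yangian.t_zero]
  split_ifs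
  · exact map_one _
  · exact map_zero _

/-- If T(s+2) = ∑ y_i c_i^s with c_i = h_i + m, then X^(s+1) ↦ ∑ y_i c_i^(s+1)/c_i and only the
constant term of f sees T 1. Hence the divided differences between c_i and 0. -/
theorem seqFunctional_eq (T : ℕ → MZ m n) (y : Fin m → MZ m n)
    (hT : ∀ s, T (s + 2)
      = ∑ i, y i * MZ.ofCartan m n ((cartanH i + (m : CartanField m)) ^ s)) (f : ℂ[X]) :
    seqFunctional T f = T 1 * MZ.ofCartan m n (aeval (0 : CartanField m) f)
      + ∑ i, y i * MZ.ofCartan m n ((aeval (cartanH i + (m : CartanField m)) f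
          - aeval (0 : CartanField m) f) / (cartanH i + (m : CartanField m))) := by
  induction f using Polynomial.induction_on' with
  | add p q hp hq =>
    simp only [map_add, hp, hq, mul_add, add_sub_add_comm, add_div, Finset.sum_add_distrib]
    abel
  | monomial k c =>
    have hc : ∀ x : MZ m n, x * MZ.ofCartan m n (algebraMap ℂ _ c) = c • x := fun x => by
      rw [AlgHom.commutes, ← Algebra.commutes, Algebra.smul_def]
    rw [seqFunctional_monomial]
    cases k with
    | zero =>
      simp only [aeval_monomial, pow_zero, mul_one, sub_self, zero_div, map_zero, mul_zero,
        Finset.sum_const_zero, add_zero, hc, zero_add]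
    | succ k =>
      rw [hT, Finset.smul_sum]
      simp only [aeval_monomial, zero_pow (Nat.succ_ne_zero k), mul_zero, map_zero, zero_add,
        sub_zero]
      refine Finset.sum_congr rfl fun i _ => ?_
      have h0 : cartanH i + (m : CartanField m) ≠ 0 := by exact_mod_cast cartanH_add_ne_zero i m
      rw [pow_succ, ← mul_assoc, mul_div_cancel_right₀ _ h0, mul_comm (algebraMap _ _ c), map_mul,
        ← mul_assoc, hc]

section

variable {zUp : Fin m → Fin n → MZ m n} {zDown : Fin n → Fin m → MZ m n}
  (hU : ∀ i a, incl m n (zUp i a) = raising i a) (hD : ∀ a i, incl m n (zDown a i) = lowering a i)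
include hU hD

/-- The divided difference formula for f = (X - m)^r: its values at h_i + m and at 0 are h_i^r and
(-m)^r. -/
theorem ofYangian_t_succ (a b : Fin n) (r : ℕ) : ofYangian m n (Yangian.t a b (r + 1))
    = MZ.E a b * MZ.ofCartan m n ((-(m : CartanField m)) ^ r)
      + ∑ i, residue zUp zDown a i b * MZ.ofCartan m n
        ((cartanH i ^ r - (-(m : CartanField m)) ^ r) / (cartanH i - -(m : CartanField m))) := by
  have h1 : ofYangian m n (Yangian.t a b (r + 1))
      = ofCentralizer m n (olshanskiHom m n (Yangian.shiftT (m : ℂ) a b (r + 1))) :=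
    congrArg (fun x => ofCentralizer m n (olshanskiHom m n x)) (Yangian.shiftEquiv_t _ a b (r + 1))
  have hE : ofCentralizer m n (olshanskiHom m n (Yangian.t a b 1)) = MZ.E a b := by
    refine congrArg _ (Subtype.ext ?_)
    rw [coe_olshanskiHom_t]
    rfl
  rw [h1, Yangian.shiftT_succ, map_seqFunctional, map_seqFunctional, seqFunctional_eq _
    (fun i => residue zUp zDown a i b) (ofCentralizer_olshanskiHom_add_two hU hD a b), hE]
  simp

theorem mapSeries_ofYangian (a b : Fin n) : Yangian.mapSeries (ofYangian m n) a b
    = HahnSeries.C (if a = b then 1 else 0)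
      + HahnSeries.C (MZ.E a b)
        * tailSeries (MZ.ofCartan m n).toRingHom (fun r => (-(m : CartanField m)) ^ r)
      + ∑ i, HahnSeries.C (residue zUp zDown a i b)
        * tailSeries (MZ.ofCartan m n).toRingHom (fun r =>
          (cartanH i ^ r - (-(m : CartanField m)) ^ r) / (cartanH i - -(m : CartanField m))) :=
  ofPowerSeries_mk_eq _ (ofYangian_t_zero a b) (ofYangian_t_succ hU hD a b)

omit hU hD in
theorem polyAtInfinity_denomPoly : polyAtInfinity (denomPoly m n)
    = baseAtInfinity (MZ.ofCartan m n).toRingHom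
      ((X - C (-(m : CartanField m))) * ∏ i : Fin m, (X - C (cartanH i))) := by
  rw [← polyAtInfinityHom_apply, denomPoly, baseAtInfinity_apply, C_neg, sub_neg_eq_add]

omit hU hD in
theorem isUnit_denomPoly : IsUnit (polyAtInfinity (denomPoly m n)) := by
  rw [polyAtInfinity_denomPoly, map_mul]
  refine (isUnit_baseAtInfinity_X_sub_C _ _).mul ?_
  refine Finset.prod_induction _ (fun f => IsUnit (baseAtInfinity (MZ.ofCartan m n).toRingHom f))
    (fun f g hf hg => ?_) ?_ fun i _ => isUnit_baseAtInfinity_X_sub_C _ _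
  · rw [map_mul]; exact hf.mul hg
  · rw [map_one]; exact isUnit_one

omit hU hD in
theorem polyAtInfinity_Zpoly (a b : Fin n) : polyAtInfinity (Zpoly zUp zDown a b)
    = ((if a = b then baseAtInfinity (MZ.ofCartan m n).toRingHom (X - C (-(m : CartanField m)))
          else 0) + HahnSeries.C (MZ.E a b))
        * baseAtInfinity (MZ.ofCartan m n).toRingHom (∏ i : Fin m, (X - C (cartanH i)))
      + ∑ i : Fin m, HahnSeries.C (residue zUp zDown a i b)
        * baseAtInfinity (MZ.ofCartan m n).toRingHom
          (∏ j ∈ Finset.univ.erase i, (X - C (cartanH j))) := by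
  rw [← polyAtInfinityHom_apply, Zpoly, map_add, map_mul, map_add, map_sum, polyAtInfinityHom_C]
  refine congrArg₂ (· + ·) (congrArg₂ (· * ·) (congrArg₂ (· + ·) ?_ rfl) rfl) ?_
  · rw [apply_ite (polyAtInfinityHom (MZ m n)), map_zero, baseAtInfinity_apply, C_neg, sub_neg_eq_add,
      Polynomial.map_add, map_X, map_C]
    congr 4
    exact (map_natCast (MZ.ofCartan m n) m).symm
  · refine Finset.sum_congr rfl fun i _ => ?_
    have h : ∏ j ∈ Finset.univ.erase i, (X - C (cartanH j)) * C (cartanH i - cartanH j)⁻¹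
        = C (∏ j ∈ Finset.univ.erase i, (cartanH i - cartanH j))⁻¹
          * ∏ j ∈ Finset.univ.erase i, (X - C (cartanH j)) := by
      rw [Finset.prod_mul_distrib, mul_comm, ← map_prod C, Finset.prod_inv_distrib]
    rw [map_mul, polyAtInfinityHom_C, ← baseAtInfinity_apply, h, map_mul (baseAtInfinity _),
      baseAtInfinity_C, ← mul_assoc, residue, map_mul, map_mul, map_mul]
    rfl

/-- The terms carry 1/(u + m) and 1/((u + m)(u - h_i)). The denominator clears them and leaves ∏_j
(u - h_j) and ∏_{j≠i} (u - h_j), with all coefficients from R(h) standing on the right. -/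
theorem mapSeries_mul_denomPoly (a b : Fin n) :
    Yangian.mapSeries (ofYangian m n) a b * polyAtInfinity (denomPoly m n)
      = polyAtInfinity (Zpoly zUp zDown a b) := by
  rw [mapSeries_ofYangian hU hD, polyAtInfinity_denomPoly, polyAtInfinity_Zpoly, add_mul, add_mul,
    add_mul, Finset.sum_mul]
  congr 1
  · congr 1
    · split_ifs
      · rw [map_one, one_mul, map_mul]
      · rw [map_zero, zero_mul, zero_mul]
    · rw [map_mul, mul_assoc, ← mul_assoc (tailSeries _ _), tailSeries_pow_mul, one_mul]
  · refine Finset.sum_congr rfl fun i _ => ?_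
    have h0 : cartanH i ≠ -(m : CartanField m) := fun h =>
      cartanH_add_ne_zero i m (by rw [h]; simp)
    rw [← Finset.mul_prod_erase Finset.univ _ (Finset.mem_univ i), ← mul_assoc (X - C (-_)), map_mul,
      mul_assoc, ← mul_assoc (tailSeries _ _), tailSeries_div_mul _ h0, one_mul]

end

end MZ

end MickelssonZhelobenko

end

open MickelssonZhelobenko in
/-- The elements `z_{ia} = p E_{ia} (h_i - h_1) ⋯ (h_i - h_{i-1})` and
`z_{ai} = p E_{ai} (h_i - h_{i+1}) ⋯ (h_i - h_m)` belong to `Z(gl(m|n), gl(m))`, and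
`t_{ij}(u) ↦ Z_{m+i,m+j}(u) / ((u + m) (u - h_1) ⋯ (u - h_m))` defines an algebra homomorphism
`φ : Y(gl(n)) → Z(gl(m|n), gl(m))`; it is the composition of the shift `t_{ij}(u) ↦ t_{ij}(u + m)`,
the super Olshanski homomorphism `ψ : Y(gl(n)) → U(gl(m|n))^{gl(m)}` and the natural projection. -/
theorem proposition3p4 (m n : ℕ) :
    ∃ (zUp : Fin m → Fin n → MZ m n) (zDown : Fin n → Fin m → MZ m n),
      (∀ i a, MZ.incl m n (zUp i a) = raising i a) ∧
      (∀ a i, MZ.incl m n (zDown a i) = lowering a i) ∧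
      IsUnit (polyAtInfinity (denomPoly m n)) ∧
      ∃ φ : Yangian n →ₐ[ℂ] MZ m n,
        (∀ i j : Fin n, Yangian.mapSeries φ i j
          = polyAtInfinity (Zpoly zUp zDown i j)
            * Ring.inverse (polyAtInfinity (denomPoly m n))) ∧
        ∃ (ψ : Yangian n →ₐ[ℂ] glCentralizer m n) (σ : Yangian n ≃ₐ[ℂ] Yangian n),
          (∀ i j : Fin n,
            (ψ (Yangian.t i j 1) : UGl m n) = UGl.E (Sum.inr i) (Sum.inr j)) ∧
          (∀ (i j : Fin n) (r : ℕ), 2 ≤ r →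
            (ψ (Yangian.t i j r) : UGl m n) = ∑ k : Fin m, ∑ l : Fin m,
              UGl.E (Sum.inr i) (Sum.inl k)
                * ((Matrix.of fun k l : Fin m =>
                    (UGl.E (Sum.inl k) (Sum.inl l) : UGl m n)) ^ (r - 2)) k l
                * UGl.E (Sum.inl l) (Sum.inr j)) ∧
          (∀ (i j : Fin n) (r : ℕ), σ (Yangian.t i j r) = Yangian.shiftT (m : ℂ) i j r) ∧
          φ = ((MZ.ofCentralizer m n).comp ψ).comp (σ : Yangian n →ₐ[ℂ] Yangian n) := by
  choose zUp hU using fun (i : Fin m) (a : Fin n) => MZ.exists_incl_raising (m := m) i a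
  choose zDown hD using fun (a : Fin n) (i : Fin m) => MZ.exists_incl_lowering (m := m) a i
  refine ⟨zUp, zDown, hU, hD, MZ.isUnit_denomPoly, MZ.ofYangian m n, fun i j => ?_,
    olshanskiHom m n, Yangian.shiftEquiv n (m : ℂ), fun i j => ?_, fun i j r hr => ?_,
    Yangian.shiftEquiv_t _, rfl⟩
  · rw [← MZ.mapSeries_mul_denomPoly hU hD, mul_assoc, Ring.mul_inverse_cancel _ MZ.isUnit_denomPoly,
      mul_one]
  · rw [coe_olshanskiHom_t, olshanskiT_one]
  · obtain ⟨s, rfl⟩ := Nat.exists_eq_add_of_le' hr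
    rw [coe_olshanskiHom_t, olshanskiT_add_two, Nat.add_sub_cancel]
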